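/- **Setting.** Let $u:[0,\infty)\to\mathbb R$ be continuous with $\int_0^\infty(1+x^2)|u(x)|\,dx<\infty$. For $k\neq0$ and $x\ge 0$ let $\psi(x,k)$ ($\operatorname{Im}k\ge0$) and $\phi(x,k)$ ($k\in\mathbb C$) be the continuous solutions of $$\psi(x,k)=e^{ikx}+\frac1k\int_x^\infty \sin k(x-\xi)\,u(\xi)\psi(\xi,k)\,d\xi\quad\text{with } e^{-ikx}\psi(x,k)\text{ bounded in }x\ge0,$$ $$\phi(x,k)=e^{-ikx}-\frac1k\int_0^x \sin k(x-\xi)\,u(\xi)\phi(\xi,k)\,d\xi ,$$ and let $a(k)=\frac1{2ik}(\phi\psi_x-\psi\phi_x)$. Assume that $a(k)\ne0$ for all $k\neq 0$ with $\operatorname{Im}k\ge0$. Let $\beta,\gamma_1,\gamma_2\in\mathbb R$ with $\beta\neq0$, let $f,g$ be real-valued functions on $(0,\infty)$, and let $q$ be a real-valued function on the closed quarter plane $x,y\ge0$, $C^2$ in the open quarter plane and $C^1$ up to the boundary, such that $|q|,|q_x|,|q_y|\le C(1+x+y)^{-1-\delta}$ for some $C$ and some $\delta>0$, and $$q_{xx}+q_{yy}+u(x)q=0\quad(x,y>0),$$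 $$q_y(x,0)+\gamma_1q(x,0)=f(x)\quad(x>0),\qquad q_x(0,y)+\beta q_y(0,y)+\gamma_2q(0,y)=g(y)\quad(y>0).$$ Put $$g_0(k)=\int_0^\infty e^{ky}q(0,y)\,dy\ (\operatorname{Re}k\le0),\qquad f_0(k)=\int_0^\infty q(x,0)\phi(x,k)\,dx-\frac{\phi(0,k)}{\psi(0,k)}\int_0^\infty q(x,0)\psi(x,k)\,dx,$$ $$\rho(k)=\frac{f_0(k)}{ia(k)}+\frac{g_0(-k)}{\psi(0,k)} ,$$ $$D(k)=\psi_x(0,k)+(\gamma_2-\beta k)\psi(0,k),\qquad J(k)=\frac{k+\gamma_1}{k-\gamma_1}\,\frac{\psi_x(0,k)+(\gamma_2+\beta k)\psi(0,k)}{\psi_x(0,k)+(\gamma_2-\beta k)\psi(0,k)},$$ $$H(k)=\int_0^\infty f(x)\psi(x,k)\,dx+\psi(0,k)\int_0^\infty e^{ky}g(y)\,dy,\qquad F(k)=\frac{(k-\gamma_1)H(k)+(k+\gamma_1)\overline{H(-\bar k)}}{(k-\gamma_1)D(k)},$$ $$N(k)=-\frac{\psi(0,k)\int_0^\infty f(x)\phi(x,k)\,dx-\phi(0,k)\int_0^\infty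 f(x)\psi(x,k)\,dx}{ia(k)(k-\gamma_1)\psi(0,k)} .$$ **Proposition 3.2.** Under these assumptions the following hold. 0. The functions $\psi$ and $\phi$ above exist. Moreover $\psi(0,k)\ne0$ for $\operatorname{Im}k\ge0$, $k\ne0$, and $(k-\gamma_1)D(k)\neq0$ for $\arg k=\pi/2$. The following integrals converge absolutely: those of $e^{ky}q(0,y)$ and $e^{ky}g(y)$ over $0<y<\infty$ for $\operatorname{Re}k\le0$; those of $q(x,0)\psi(x,k)$ and $f(x)\psi(x,k)$ over $0<x<\infty$ for $\operatorname{Im}k\ge0$, $k\neq0$; and those of $q(x,0)\phi(x,k)$ and $f(x)\phi(x,k)$ over $0<x<\infty$ for real $k\ne0$. 1. For all $x,y>0$, with absolutely convergent integrals, $$q(x,y)=-\frac1{2i\pi}\int_0^\infty e^{-ky}\bigl(\rho(k)\psi(x,k)-\overline{\rho(k)}\,\overline{\psi(x,k)}\bigr)dk+\frac1{2i\pi}\int_0^{i\infty}\frac{\psi(x,k)}{\psi(0,k)}\bigl(e^{-ky}g_0(k)+e^{ky}g_0(-k)\bigr)dk .$$ 2. The sectionally analytic function $\{g_0(k),g_0(-k)\}$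 satisfies the scalar Riemann–Hilbert problem: $g_0$ is analytic for $\operatorname{Re}k<0$ and continuous for $\operatorname{Re}k\le0$; $g_0(k)=O(1/k)$ as $k\to\infty$ in $\operatorname{Re}k\le0$; and $$g_0(k)+J(k)g_0(-k)=\frac{2k\beta\psi(0,k)}{(k-\gamma_1)D(k)}\,q(0,0)+F(k),\qquad \arg k=\tfrac{\pi}{2},$$ $$g_0(-k)+J(-k)g_0(k)=\frac{2k\beta\psi(0,-k)}{(k+\gamma_1)D(-k)}\,q(0,0)+F(-k),\qquad \arg k=\tfrac{3\pi}{2}.$$ 3. For every $k\ne0,\gamma_1$ with $0\le\arg k\le\pi/2$ for which $\int_0^\infty q(x,0)\phi(x,k)\,dx$ and $\int_0^\infty f(x)\phi(x,k)\,dx$ converge absolutely (in particular for every real $k>0$, $k\ne\gamma_1$), $$\rho(k)=-\frac{k+\gamma_1}{k-\gamma_1}\,\frac{g_0(-k)}{\psi(0,k)}+N(k).$$ -/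

import Mathlib

open Set MeasureTheory
open scoped ComplexConjugate

namespace QuarterPlane

noncomputable section

/-! ### Eigenfunctions of the one-dimensional Schrodinger equation on the half line -/

/-- `ψ` is the Jost solution on `[0, ∞)` at the spectral parameter `k` (`Im k ≥ 0`, `k ≠ 0`):
`ψ(x) = e^{ikx} + (1/k) ∫_x^∞ sin k(x-ξ) u(ξ) ψ(ξ) dξ`, with `e^{-ikx} ψ(x)` bounded. -/
structure IsJost (u : ℝ → ℝ) (k : ℂ) (ψ : ℝ → ℂ) : Prop where
  continuousOn : ContinuousOn ψ (Ici 0)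
  bounded : ∃ C : ℝ, ∀ x : ℝ, 0 ≤ x → ‖Complex.exp (-(Complex.I * k * x)) * ψ x‖ ≤ C
  equation : ∀ x : ℝ, 0 ≤ x →
    ψ x = Complex.exp (Complex.I * k * x)
      + (1 / k) * ∫ ξ in Ioi x, Complex.sin (k * ((x : ℂ) - ξ)) * (u ξ : ℂ) * ψ ξ

/-- `φ` is the solution on `[0, ∞)` of
`φ(x) = e^{-ikx} - (1/k) ∫_0^x sin k(x-ξ) u(ξ) φ(ξ) dξ` (`k ≠ 0`). -/
structure IsRegular (u : ℝ → ℝ) (k : ℂ) (φ : ℝ → ℂ) : Prop where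
  continuousOn : ContinuousOn φ (Ici 0)
  equation : ∀ x : ℝ, 0 ≤ x →
    φ x = Complex.exp (-(Complex.I * k * x))
      - (1 / k) * ∫ ξ in (0 : ℝ)..x, Complex.sin (k * ((x : ℂ) - ξ)) * (u ξ : ℂ) * φ ξ

/-- The function `ψ(x, k)`: the solution of its Volterra equation (only `x ≥ 0` is meaningful). -/
def psi (u : ℝ → ℝ) (x : ℝ) (k : ℂ) : ℂ := Classical.epsilon (IsJost u k) x

/-- The function `φ(x, k)`: the solution of its Volterra equation (only `x ≥ 0` is meaningful). -/
def phi (u : ℝ → ℝ) (x : ℝ) (k : ℂ) : ℂ := Classical.epsilon (IsRegular u k) x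

/-- `ψ_x(0, k)`, the one-sided derivative at the endpoint. -/
def psiX (u : ℝ → ℝ) (k : ℂ) : ℂ := derivWithin (fun x : ℝ => psi u x k) (Ici 0) 0

/-- `φ_x(0, k)`, the one-sided derivative at the endpoint. -/
def phiX (u : ℝ → ℝ) (k : ℂ) : ℂ := derivWithin (fun x : ℝ => phi u x k) (Ici 0) 0

/-- `a(k) = (φ ψ_x - ψ φ_x) / (2ik)`. The Wronskian does not depend on `x`; it is taken at
`x = 0`. -/
def aCoef (u : ℝ → ℝ) (k : ℂ) : ℂ :=
  (phi u 0 k * psiX u k - psi u 0 k * phiX u k) / (2 * Complex.I * k)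

/-- Regularity and decay of the potential: `u` is continuous on `[0, ∞)` and
`∫_0^∞ (1 + x²) |u(x)| dx < ∞`. -/
structure IsPotential (u : ℝ → ℝ) : Prop where
  continuousOn : ContinuousOn u (Ici 0)
  integrable : IntegrableOn (fun x : ℝ => (1 + x ^ 2) * |u x|) (Ioi 0)

/-! ### The boundary value problem -/

/-- `q_x(x, y)` on the closed quarter plane (one-sided at `x = 0`). -/
def partialX (q : ℝ → ℝ → ℝ) (x y : ℝ) : ℝ := derivWithin (fun s : ℝ => q s y) (Ici 0) x

/-- `q_y(x, y)` on the closed quarter plane (one-sided at `y = 0`). -/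
def partialY (q : ℝ → ℝ → ℝ) (x y : ℝ) : ℝ := derivWithin (fun t : ℝ => q x t) (Ici 0) y

/-- `q` is a classical solution, `C²` in the open and `C¹` up to the boundary of the quarter plane,
of `q_xx + q_yy + u(x) q = 0`, which together with `q_x`, `q_y` is `O((1+x+y)^{-1-δ})` for
some `δ > 0`, and it satisfies the Poincaré conditions
`q_y + γ₁ q = f` on `y = 0` and `q_x + β q_y + γ₂ q = g` on `x = 0`. -/
structure IsSolution (u : ℝ → ℝ) (β γ₁ γ₂ : ℝ) (f g : ℝ → ℝ) (q : ℝ → ℝ → ℝ) : Prop where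
  contDiffOn_interior : ContDiffOn ℝ 2 (Function.uncurry q) (Ioi 0 ×ˢ Ioi 0)
  contDiffOn_closed : ContDiffOn ℝ 1 (Function.uncurry q) (Ici 0 ×ˢ Ici 0)
  decay : ∃ C δ : ℝ, 0 < δ ∧ ∀ x y : ℝ, 0 ≤ x → 0 ≤ y →
    |q x y| ≤ C * (1 + x + y) ^ (-(1 + δ)) ∧
    |partialX q x y| ≤ C * (1 + x + y) ^ (-(1 + δ)) ∧
    |partialY q x y| ≤ C * (1 + x + y) ^ (-(1 + δ))
  pde : ∀ x y : ℝ, 0 < x → 0 < y →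
    iteratedDeriv 2 (fun s : ℝ => q s y) x + iteratedDeriv 2 (fun t : ℝ => q x t) y
      + u x * q x y = 0
  boundary_bottom : ∀ x : ℝ, 0 < x → partialY q x 0 + γ₁ * q x 0 = f x
  boundary_left : ∀ y : ℝ, 0 < y → partialX q 0 y + β * partialY q 0 y + γ₂ * q 0 y = g y

/-! ### Transforms -/

/-- `∫_0^∞ h(x) ψ(x, k) dx`. -/
def psiTransform (u : ℝ → ℝ) (h : ℝ → ℝ) (k : ℂ) : ℂ := ∫ x in Ioi (0 : ℝ), (h x : ℂ) * psi u x k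

/-- `∫_0^∞ h(x) φ(x, k) dx`. -/
def phiTransform (u : ℝ → ℝ) (h : ℝ → ℝ) (k : ℂ) : ℂ := ∫ x in Ioi (0 : ℝ), (h x : ℂ) * phi u x k

/-- `∫_0^∞ e^{ky} h(y) dy`, for `Re k ≤ 0`. -/
def expTransform (h : ℝ → ℝ) (k : ℂ) : ℂ := ∫ y in Ioi (0 : ℝ), Complex.exp (k * y) * (h y : ℂ)

/-- `g₀(k) = ∫_0^∞ e^{ky} q(0, y) dy`, for `Re k ≤ 0`. -/
def g0 (q : ℝ → ℝ → ℝ) (k : ℂ) : ℂ := expTransform (fun y => q 0 y) k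

/-- `f₀(k) = ∫_0^∞ q(x,0) φ(x,k) dx - (φ(0,k)/ψ(0,k)) ∫_0^∞ q(x,0) ψ(x,k) dx`. -/
def f0 (u : ℝ → ℝ) (q : ℝ → ℝ → ℝ) (k : ℂ) : ℂ :=
  phiTransform u (fun x => q x 0) k
    - phi u 0 k / psi u 0 k * psiTransform u (fun x => q x 0) k

/-- `ρ(k) = f₀(k)/(i a(k)) + g₀(-k)/ψ(0,k)`. -/
def rho (u : ℝ → ℝ) (q : ℝ → ℝ → ℝ) (k : ℂ) : ℂ :=
  f0 u q k / (Complex.I * aCoef u k) + g0 q (-k) / psi u 0 k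

/-! ### Data of the Riemann-Hilbert problem -/

/-- `D(k) = ψ_x(0,k) + (γ₂ - βk) ψ(0,k)`. -/
def DFun (u : ℝ → ℝ) (β γ₂ : ℝ) (k : ℂ) : ℂ := psiX u k + (γ₂ - β * k) * psi u 0 k

/-- `J(k) = ((k+γ₁)/(k-γ₁)) (ψ_x(0,k) + (γ₂+βk) ψ(0,k)) / (ψ_x(0,k) + (γ₂-βk) ψ(0,k))`. -/
def JFun (u : ℝ → ℝ) (β γ₁ γ₂ : ℝ) (k : ℂ) : ℂ :=
  (k + γ₁) / (k - γ₁) *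
    ((psiX u k + (γ₂ + β * k) * psi u 0 k) / (psiX u k + (γ₂ - β * k) * psi u 0 k))

/-- `H(k) = ∫_0^∞ f(x) ψ(x,k) dx + ψ(0,k) ∫_0^∞ e^{ky} g(y) dy`. -/
def HFun (u f g : ℝ → ℝ) (k : ℂ) : ℂ := psiTransform u f k + psi u 0 k * expTransform g k

/-- `F(k) = ((k-γ₁) H(k) + (k+γ₁) conj (H(-conj k))) / ((k-γ₁) D(k))`. -/
def FFun (u f g : ℝ → ℝ) (β γ₁ γ₂ : ℝ) (k : ℂ) : ℂ :=
  ((k - γ₁) * HFun u f g k + (k + γ₁) * conj (HFun u f g (-conj k)))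
    / ((k - γ₁) * DFun u β γ₂ k)

/-- `N(k) = -(ψ(0,k) ∫ f φ dx - φ(0,k) ∫ f ψ dx) / (i a(k) (k-γ₁) ψ(0,k))`. -/
def NFun (u f : ℝ → ℝ) (γ₁ : ℝ) (k : ℂ) : ℂ :=
  -((psi u 0 k * phiTransform u f k - phi u 0 k * psiTransform u f k)
    / (Complex.I * aCoef u k * (k - γ₁) * psi u 0 k))

/-! ### The integral representation -/

/-- Integrand of the integral over `0 < k < ∞`. -/
def realIntegrand (u : ℝ → ℝ) (q : ℝ → ℝ → ℝ) (x y : ℝ) (k : ℂ) : ℂ :=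
  Complex.exp (-k * y) *
    (rho u q k * psi u x k - conj (rho u q k) * conj (psi u x k))

/-- Integrand of the integral from `0` to `i∞`. -/
def imagIntegrand (u : ℝ → ℝ) (q : ℝ → ℝ → ℝ) (x y : ℝ) (k : ℂ) : ℂ :=
  psi u x k / psi u 0 k *
    (Complex.exp (-k * y) * g0 q k + Complex.exp (k * y) * g0 q (-k))

/-- The contour integral `∫_0^{i∞} G(k) dk`, through `k = is`, `dk = i ds`. -/
def imagAxisIntegral (G : ℂ → ℂ) : ℂ := ∫ s in Ioi (0 : ℝ), G (Complex.I * s) * Complex.I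

end

end QuarterPlane

/-! ### Holomorphic parameter integrals and abstract Volterra equations. -/

namespace QuarterPlane

/-! The argument is a transform method adapted to the Schrödinger operator in `x`. If `v'' + (u +
k²) v = 0` and `κ² = k²`, the vector field with components `e^{-κy} (v q_x - v' q)` and `e^{-κy} v
(q_y + κ q)` is divergence free. Green's identity (`green_rectangle`, with its limits `green_strip`
and `green_half`) therefore ties the boundary values of `q` together, and the result comes from a
few choices of `v` and of the sign of `κ`.

With `v` the Jost solution and `k` on the positive imaginary axis, both `κ = k` and `κ = -k` are
admissible, because `e^{-κy}` only oscillates (`global_relation_jost`). The unknown integral of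
`q(x,0) ψ` enters the two relations with the coefficients `k - γ₁` and `-(k + γ₁)`. Eliminating it
leaves the jump relation between `g₀(k)` and `g₀(-k)` (`riemannHilbert_jump`).

With `v = s`, the solution normalized by `s(0) = 0`, `s'(0) = 1`, one gets `g₀(-k) = ∫ q_y(x,0) s dx
+ k ∫ q(x,0) s dx` for `k > 0`. Since `φ - (φ(0)/ψ(0)) ψ` is a multiple of `s`, the formula for `ρ`
is then algebra (`rho_eq_dirichlet`, `rho_eq`). At a complex `k` of the first quadrant, convergence
of the integrals forces exponential decay of the boundary data, because `s` grows like `e^{x Im k}`.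
Both sides are then holomorphic in the half strip below `k` and agree on its real edge, hence at `k`
(`dirichlet_relation`, resting on the boundary uniqueness theorem `eqOn_zero_of_real`).

For the integral representation, the cosine transform of `q` in `y` is determined by its Dirichlet
value at `x = 0` and by the Green potential of `q_y(·,0)` (`laplaceY_add_laplaceY_neg`), and
`cosine_inversion` recovers `q`. After regrouping, one part is the stated integral over the
imaginary axis. The other is twice the real part of an integral of `e^{-ky} S(k)`, where `S` is
`spectralFun`. This `S` is holomorphic in the open first quadrant and `O(1/k)`, so the contour
rotates onto the positive real axis (`integral_exp_mul_rotate`). There `ρψ + S` is real, which turns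
`S` minus its conjugate into the stated integrand (`realIntegrand_eq`).

The analytic input is a set of bounds uniform for `k` in the closed upper half plane, `k = 0`
included. They are obtained by replacing `sin(kt)/k` with `e^{ikt} sin(kt)/k = ∫_0^t e^{2iks} ds`
and by solving Volterra equations in weights that the integral operator contracts by `1/2`; a first
moment of `u` suffices. The denominators are controlled by `jostM_zero_ne`: `ψ(0,k)` is nonzero for
real `k` by a Wronskian, off both axes by self-adjointness, and on the imaginary axis by a Sturm
comparison fed by `a ≠ 0`. Compactness makes this quantitative (`exists_le_norm_jostM_zero`). -/

/-- An integral depending holomorphically on a parameter, with a uniform integrable majorant. -/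
theorem differentiableOn_integral_of_dominated {α : Type*} [MeasurableSpace α] {μ : Measure α}
    {F : ℂ → α → ℂ} {U : Set ℂ} (hU : IsOpen U) {bound : α → ℝ}
    (hm : ∀ k ∈ U, AEStronglyMeasurable (F k) μ)
    (hd : ∀ᵐ a ∂μ, DifferentiableOn ℂ (fun k => F k a) U)
    (hb : ∀ᵐ a ∂μ, ∀ k ∈ U, ‖F k a‖ ≤ bound a) (hbi : Integrable bound μ) :
    DifferentiableOn ℂ (fun k => ∫ a, F k a ∂μ) U := by
  intro k₀ hk₀
  obtain ⟨ε, hε, hball⟩ := Metric.isOpen_iff.1 hU k₀ hk₀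
  -- With a third of the radius, closed discs of radius `r` about points of `ball k₀ r` stay in `U`.
  -- Cauchy's estimate on these discs bounds the derivative by `bound / r`.
  set r : ℝ := ε / 3 with hr
  have hr0 : 0 < r := by positivity
  have hsub : ∀ k ∈ Metric.ball k₀ r, Metric.closedBall k r ⊆ U := by
    intro k hk z hz
    apply hball
    have h1 := Metric.mem_ball.1 hk
    have h2 := Metric.mem_closedBall.1 hz
    have h3 := dist_triangle z k k₀
    rw [Metric.mem_ball]
    have : ε = 3 * r := by rw [hr]; ring
    linarith
  have hmemU : ∀ k ∈ Metric.ball k₀ r, k ∈ U := fun k hk =>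
    hsub k hk (Metric.mem_closedBall_self hr0.le)
  have hderiv : ∀ᵐ a ∂μ, ∀ k ∈ Metric.ball k₀ r,
      HasDerivAt (fun k => F k a) (deriv (fun k => F k a) k) k := by
    filter_upwards [hd] with a ha k hk
    exact ((ha k (hmemU k hk)).differentiableAt (hU.mem_nhds (hmemU k hk))).hasDerivAt
  have key := hasDerivAt_integral_of_dominated_loc_of_deriv_le (μ := μ) (F := F)
    (F' := fun k a => deriv (fun k => F k a) k) (x₀ := k₀) (s := Metric.ball k₀ r)
    (bound := fun a => bound a / r) (Metric.ball_mem_nhds k₀ hr0)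
    (by filter_upwards [hU.mem_nhds hk₀] with k hk using hm k hk)
    (hbi.mono' (hm k₀ hk₀) (by filter_upwards [hb] with a ha using ha k₀ hk₀))
    (by
      -- The derivative at `k₀` is measurable as an almost everywhere limit of difference quotients
      -- along this null sequence of nonzero increments. The factor `1/2` keeps `k₀ + t n` in the
      -- ball.
      let t : ℕ → ℂ := fun n => ((r / 2 / ((n : ℝ) + 1) : ℝ) : ℂ)
      have ht0 : Filter.Tendsto t Filter.atTop (nhdsWithin 0 {0}ᶜ) := by
        rw [tendsto_nhdsWithin_iff]
        constructor
        · have : Filter.Tendsto (fun n : ℕ => (r / 2 / ((n : ℝ) + 1) : ℝ)) Filter.atTop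
              (nhds 0) := by
            have := (tendsto_one_div_add_atTop_nhds_zero_nat (𝕜 := ℝ)).const_mul (r / 2)
            simpa [div_eq_mul_inv] using this
          have h2 := (Complex.continuous_ofReal.tendsto (0 : ℝ)).comp this
          simpa [t, Function.comp_def] using h2
        · refine Filter.Eventually.of_forall fun n => ?_
          simp only [t, mem_compl_iff, mem_singleton_iff, Complex.ofReal_eq_zero]
          positivity
      refine aestronglyMeasurable_of_tendsto_ae Filter.atTop
        (f := fun n a => (t n)⁻¹ • (F (k₀ + t n) a - F k₀ a)) ?_ ?_
      · intro n
        refine ((hm (k₀ + t n) (hmemU _ ?_)).sub (hm k₀ hk₀)).const_smul (t n)⁻¹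
        have h0 : (0 : ℝ) < (n : ℝ) + 1 := by positivity
        rw [Metric.mem_ball, dist_eq_norm, add_sub_cancel_left, Complex.norm_real,
          Real.norm_of_nonneg (by positivity), div_lt_iff₀ h0]
        have : (0 : ℝ) ≤ n := by positivity
        nlinarith
      · filter_upwards [hderiv] with a ha
        exact ((ha k₀ (Metric.mem_ball_self hr0)).tendsto_slope_zero).comp ht0)
    (by
      filter_upwards [hd, hb] with a ha hab k hk
      refine Complex.norm_deriv_le_of_forall_mem_sphere_norm_le hr0 ?_ ?_
      · exact (ha.mono ((closure_mono Metric.ball_subset_closedBall).trans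
          (by rw [Metric.isClosed_closedBall.closure_eq]; exact hsub k hk))).diffContOnCl
      · intro z hz
        exact hab z (hsub k hk (Metric.sphere_subset_closedBall hz)))
    (hbi.div_const r) hderiv
  exact key.2.differentiableAt.differentiableWithinAt

/-- Neumann iterates of the integral operator with kernel `K`, started at `h`. -/
noncomputable def volterraIter (K : ℂ → ℝ → ℝ → ℂ) (h : ℂ → ℝ → ℂ) : ℕ → ℂ → ℝ → ℂ
  | 0 => h
  | n + 1 => fun k x => ∫ ξ, K k x ξ * volterraIter K h n k ξ

/-- The Neumann series. -/
noncomputable def volterraSol (K : ℂ → ℝ → ℝ → ℂ) (h : ℂ → ℝ → ℂ) (k : ℂ) (x : ℝ) : ℂ :=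
  ∑' n, volterraIter K h n k x

/-- The kernel is dominated by `W`, and `W` contracts the weight `E` by a factor `1/2`. -/
structure VolterraBound (S : Set ℂ) (K : ℂ → ℝ → ℝ → ℂ) (W : ℝ → ℝ → ℝ) (E : ℝ → ℝ) :
    Prop where
  meas : ∀ k ∈ S, Measurable (Function.uncurry (K k))
  bound : ∀ k ∈ S, ∀ x ξ, ‖K k x ξ‖ ≤ W x ξ
  integrable : ∀ x, Integrable (fun ξ => W x ξ * E ξ)
  contr : ∀ x, ∫ ξ, W x ξ * E ξ ≤ E x / 2

namespace VolterraBound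

variable {S : Set ℂ} {K : ℂ → ℝ → ℝ → ℂ} {W : ℝ → ℝ → ℝ} {E : ℝ → ℝ}

theorem nonneg_W (hV : VolterraBound S K W E) {k : ℂ} (hk : k ∈ S) (x ξ : ℝ) : 0 ≤ W x ξ :=
  (norm_nonneg _).trans (hV.bound k hk x ξ)

theorem norm_mul_le (hV : VolterraBound S K W E) {k : ℂ} (hk : k ∈ S) {d : ℝ → ℂ} {C : ℝ}
    (hd : ∀ x, ‖d x‖ ≤ C * E x) (x ξ : ℝ) : ‖K k x ξ * d ξ‖ ≤ C * (W x ξ * E ξ) := by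
  rw [norm_mul]
  calc ‖K k x ξ‖ * ‖d ξ‖ ≤ W x ξ * (C * E ξ) :=
        mul_le_mul (hV.bound k hk x ξ) (hd ξ) (norm_nonneg _) (hV.nonneg_W hk x ξ)
    _ = _ := by ring

theorem norm_integral_le (hV : VolterraBound S K W E) {k : ℂ} (hk : k ∈ S) {d : ℝ → ℂ} {C : ℝ}
    (hC : 0 ≤ C) (hd : ∀ x, ‖d x‖ ≤ C * E x) (x : ℝ) :
    ‖∫ ξ, K k x ξ * d ξ‖ ≤ C / 2 * E x := by
  have h1 : ‖∫ ξ, K k x ξ * d ξ‖ ≤ ∫ ξ, C * (W x ξ * E ξ) :=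
    norm_integral_le_of_norm_le ((hV.integrable x).const_mul C)
      (Filter.Eventually.of_forall fun ξ => hV.norm_mul_le hk hd x ξ)
  rw [integral_const_mul] at h1
  have h2 := mul_le_mul_of_nonneg_left (hV.contr x) hC
  linarith

/-- Each application of the operator halves the constant in the bound by `E`, so a weighted-bounded
solution of the homogeneous equation is squeezed to zero. All uniqueness statements for integral
equations reduce to this. -/
theorem eq_zero (hV : VolterraBound S K W E) {k : ℂ} (hk : k ∈ S) {d : ℝ → ℂ} {C : ℝ}
    (hC : 0 ≤ C) (hd : ∀ x, ‖d x‖ ≤ C * E x) (heq : ∀ x, d x = ∫ ξ, K k x ξ * d ξ) (x : ℝ) :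
    d x = 0 := by
  have h : ∀ n : ℕ, ∀ x, ‖d x‖ ≤ C * (1 / 2) ^ n * E x := by
    intro n
    induction n with
    | zero => simpa using hd
    | succ n ih =>
      intro x
      rw [heq x]
      refine (hV.norm_integral_le hk (by positivity) ih x).trans (le_of_eq ?_)
      ring
  have hlim : Filter.Tendsto (fun n : ℕ => C * (1 / 2 : ℝ) ^ n * E x) Filter.atTop (nhds 0) := by
    have := ((tendsto_pow_atTop_nhds_zero_of_lt_one (r := (1 / 2 : ℝ)) (by norm_num)
      (by norm_num)).const_mul C).mul_const (E x)
    simpa using this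
  have := ge_of_tendsto' hlim fun n => h n x
  exact norm_le_zero_iff.1 this

variable {h : ℂ → ℝ → ℂ} {A : ℝ}

theorem iter_bound (hV : VolterraBound S K W E) (hA : 0 ≤ A)
    (hh : ∀ k ∈ S, ∀ x, ‖h k x‖ ≤ A * E x) {k : ℂ} (hk : k ∈ S) (n : ℕ) (x : ℝ) :
    ‖volterraIter K h n k x‖ ≤ A * (1 / 2) ^ n * E x := by
  induction n generalizing x with
  | zero => simpa [volterraIter] using hh k hk x
  | succ n ih =>
    refine (hV.norm_integral_le hk (by positivity) ih x).trans (le_of_eq ?_)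
    ring

theorem iter_measurable (hV : VolterraBound S K W E) (hm : ∀ k ∈ S, Measurable (h k)) {k : ℂ}
    (hk : k ∈ S) (n : ℕ) : Measurable (volterraIter K h n k) := by
  induction n with
  | zero => exact hm k hk
  | succ n ih =>
    have : StronglyMeasurable (fun p : ℝ × ℝ => K k p.1 p.2 * volterraIter K h n k p.2) :=
      ((hV.meas k hk).mul (ih.comp measurable_snd)).stronglyMeasurable
    exact (this.integral_prod_right (ν := volume)).measurable

theorem summable_bound (A : ℝ) (e : ℝ) : Summable fun n : ℕ => A * (1 / 2 : ℝ) ^ n * e :=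
  (summable_geometric_two.mul_left A).mul_right e

theorem tsum_bound (A : ℝ) (e : ℝ) : ∑' n : ℕ, A * (1 / 2 : ℝ) ^ n * e = 2 * A * e := by
  rw [tsum_mul_right, tsum_mul_left, tsum_geometric_two]; ring

theorem iter_summable (hV : VolterraBound S K W E) (hA : 0 ≤ A)
    (hh : ∀ k ∈ S, ∀ x, ‖h k x‖ ≤ A * E x) {k : ℂ} (hk : k ∈ S) (x : ℝ) :
    Summable fun n => volterraIter K h n k x :=
  Summable.of_norm_bounded (summable_bound A (E x)) fun n => hV.iter_bound hA hh hk n x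

theorem sol_bound (hV : VolterraBound S K W E) (hA : 0 ≤ A)
    (hh : ∀ k ∈ S, ∀ x, ‖h k x‖ ≤ A * E x) {k : ℂ} (hk : k ∈ S) (x : ℝ) :
    ‖volterraSol K h k x‖ ≤ 2 * A * E x := by
  rw [← tsum_bound]
  exact tsum_of_norm_bounded (summable_bound A (E x)).hasSum
    fun n => hV.iter_bound hA hh hk n x

theorem sol_measurable (hV : VolterraBound S K W E) (hA : 0 ≤ A)
    (hh : ∀ k ∈ S, ∀ x, ‖h k x‖ ≤ A * E x) (hm : ∀ k ∈ S, Measurable (h k)) {k : ℂ}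
    (hk : k ∈ S) : Measurable (volterraSol K h k) := by
  refine measurable_of_tendsto_metrizable (f := fun n x =>
    ∑ i ∈ Finset.range n, volterraIter K h i k x) ?_ ?_
  · intro n
    exact Finset.measurable_sum _ fun i _ => hV.iter_measurable hm hk i
  · rw [tendsto_pi_nhds]
    intro x
    exact (hV.iter_summable hA hh hk x).hasSum.tendsto_sum_nat

/-- The iterates are dominated geometrically, so the kernel may be integrated against the series
term by term, which shifts the series by one index. -/
theorem sol_eq (hV : VolterraBound S K W E) (hA : 0 ≤ A)
    (hh : ∀ k ∈ S, ∀ x, ‖h k x‖ ≤ A * E x) (hm : ∀ k ∈ S, Measurable (h k)) {k : ℂ}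
    (hk : k ∈ S) (x : ℝ) :
    volterraSol K h k x = h k x + ∫ ξ, K k x ξ * volterraSol K h k ξ := by
  have hle : ∀ n ξ, ‖K k x ξ * volterraIter K h n k ξ‖ ≤ A * (1 / 2) ^ n * (W x ξ * E ξ) :=
    fun n ξ => hV.norm_mul_le hk (hV.iter_bound hA hh hk n) x ξ
  have hmK : Measurable (K k x) := (hV.meas k hk).comp measurable_prodMk_left
  have hint : ∀ n, Integrable (fun ξ => K k x ξ * volterraIter K h n k ξ) := fun n =>
    ((hV.integrable x).const_mul _).mono'
      (hmK.mul (hV.iter_measurable hm hk n)).aestronglyMeasurable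
      (Filter.Eventually.of_forall (hle n))
  have hsum : HasSum (fun n => ∫ ξ, K k x ξ * volterraIter K h n k ξ)
      (∫ ξ, ∑' n, K k x ξ * volterraIter K h n k ξ) := by
    refine hasSum_integral_of_summable_integral_norm hint ?_
    refine Summable.of_nonneg_of_le (fun n => integral_nonneg fun ξ => norm_nonneg _)
      (fun n => ?_) (summable_bound A (∫ ξ, W x ξ * E ξ))
    rw [← integral_const_mul]
    exact integral_mono (hint n).norm ((hV.integrable x).const_mul _) (hle n)
  simp only [tsum_mul_left] at hsum
  rw [volterraSol, (hV.iter_summable hA hh hk x).tsum_eq_zero_add]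
  exact congrArg (h k x + ·) hsum.tsum_eq

theorem iter_continuousOn (hV : VolterraBound S K W E) (hA : 0 ≤ A)
    (hh : ∀ k ∈ S, ∀ x, ‖h k x‖ ≤ A * E x) (hm : ∀ k ∈ S, Measurable (h k))
    (hKc : ∀ x ξ, ContinuousOn (fun k => K k x ξ) S)
    (hhc : ∀ x, ContinuousOn (fun k => h k x) S) (n : ℕ) (x : ℝ) :
    ContinuousOn (fun k => volterraIter K h n k x) S := by
  induction n generalizing x with
  | zero => exact hhc x
  | succ n ih =>
    refine continuousOn_of_dominated (bound := fun ξ => A * (1 / 2) ^ n * (W x ξ * E ξ)) ?_ ?_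
      ((hV.integrable x).const_mul _) ?_
    · intro k hk
      exact (((hV.meas k hk).comp measurable_prodMk_left).mul
        (hV.iter_measurable hm hk n)).aestronglyMeasurable
    · intro k hk
      exact Filter.Eventually.of_forall (hV.norm_mul_le hk (hV.iter_bound hA hh hk n) x)
    · exact Filter.Eventually.of_forall fun ξ => (hKc x ξ).mul (ih ξ)

theorem sol_continuousOn (hV : VolterraBound S K W E) (hA : 0 ≤ A)
    (hh : ∀ k ∈ S, ∀ x, ‖h k x‖ ≤ A * E x) (hm : ∀ k ∈ S, Measurable (h k))
    (hKc : ∀ x ξ, ContinuousOn (fun k => K k x ξ) S)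
    (hhc : ∀ x, ContinuousOn (fun k => h k x) S) (x : ℝ) :
    ContinuousOn (fun k => volterraSol K h k x) S :=
  continuousOn_tsum (fun n => hV.iter_continuousOn hA hh hm hKc hhc n x)
    (summable_bound A (E x)) fun n _ hk => hV.iter_bound hA hh hk n x

/-- The bounds live on `S`, which may be closed; holomorphy is asked only on an open part `U`. This
gives eigenfunctions continuous up to the real axis and holomorphic above it. -/
theorem iter_differentiableOn (hV : VolterraBound S K W E) (hA : 0 ≤ A)
    (hh : ∀ k ∈ S, ∀ x, ‖h k x‖ ≤ A * E x) (hm : ∀ k ∈ S, Measurable (h k))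
    {U : Set ℂ} (hU : IsOpen U) (hUS : U ⊆ S)
    (hKd : ∀ x ξ, DifferentiableOn ℂ (fun k => K k x ξ) U)
    (hhd : ∀ x, DifferentiableOn ℂ (fun k => h k x) U) (n : ℕ) (x : ℝ) :
    DifferentiableOn ℂ (fun k => volterraIter K h n k x) U := by
  induction n generalizing x with
  | zero => exact hhd x
  | succ n ih =>
    refine differentiableOn_integral_of_dominated hU
      (bound := fun ξ => A * (1 / 2) ^ n * (W x ξ * E ξ)) ?_ ?_ ?_
      ((hV.integrable x).const_mul _)
    · intro k hk
      exact (((hV.meas k (hUS hk)).comp measurable_prodMk_left).mul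
        (hV.iter_measurable hm (hUS hk) n)).aestronglyMeasurable
    · exact Filter.Eventually.of_forall fun ξ => (hKd x ξ).mul (ih ξ)
    · exact Filter.Eventually.of_forall fun ξ k hk =>
        hV.norm_mul_le (hUS hk) (hV.iter_bound hA hh (hUS hk) n) x ξ

theorem sol_differentiableOn (hV : VolterraBound S K W E) (hA : 0 ≤ A)
    (hh : ∀ k ∈ S, ∀ x, ‖h k x‖ ≤ A * E x) (hm : ∀ k ∈ S, Measurable (h k))
    {U : Set ℂ} (hU : IsOpen U) (hUS : U ⊆ S)
    (hKd : ∀ x ξ, DifferentiableOn ℂ (fun k => K k x ξ) U)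
    (hhd : ∀ x, DifferentiableOn ℂ (fun k => h k x) U) (x : ℝ) :
    DifferentiableOn ℂ (fun k => volterraSol K h k x) U :=
  Complex.differentiableOn_tsum_of_summable_norm (summable_bound A (E x))
    (fun n => hV.iter_differentiableOn hA hh hm hU hUS hKd hhd n x) hU
    fun n _ hk => hV.iter_bound hA hh (hUS hk) n x

end VolterraBound

/-! ### Exponential weights contracted by Volterra kernels. -/

/-- The weight `exp (2 ∫_x^∞ w)` is contracted by the backward Volterra operator. -/
theorem integral_Ioi_mul_exp_le {w : ℝ → ℝ} (hw : Continuous w) (h0 : ∀ x, 0 ≤ w x)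
    (hi : Integrable w) (x : ℝ) :
    IntegrableOn (fun ξ => w ξ * Real.exp (2 * ∫ t in Ioi ξ, w t)) (Ioi x) ∧
    ∫ ξ in Ioi x, w ξ * Real.exp (2 * ∫ t in Ioi ξ, w t)
      ≤ Real.exp (2 * ∫ t in Ioi x, w t) / 2 := by
  have hU : ∀ x, ∫ t in Ioi x, w t = (∫ t in Ioi (0 : ℝ), w t) - ∫ t in (0 : ℝ)..x, w t := by
    intro x
    rw [eq_sub_iff_add_eq, add_comm,
      intervalIntegral.integral_interval_add_Ioi' (hi.intervalIntegrable) hi.integrableOn]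
  have hd : ∀ x, HasDerivAt (fun x => ∫ t in Ioi x, w t) (-w x) x := by
    intro x
    have h1 := (intervalIntegral.integral_hasDerivAt_right (hi.intervalIntegrable (a := 0) (b := x))
      hw.aestronglyMeasurable.stronglyMeasurableAtFilter hw.continuousAt).const_sub
      (∫ t in Ioi (0 : ℝ), w t)
    exact h1.congr_of_eventuallyEq (Filter.Eventually.of_forall hU)
  -- The factor `2` in the exponent produces the contraction `1/2`: `w E` is exactly the derivative
  -- of `-E/2`, and the boundary term at infinity has the favourable sign.
  have hF : ∀ x, HasDerivAt (fun x => -(Real.exp (2 * ∫ t in Ioi x, w t) / 2))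
      (w x * Real.exp (2 * ∫ t in Ioi x, w t)) x := by
    intro x
    exact ((((hd x).const_mul 2).exp).div_const 2).neg.congr_deriv (by ring)
  have hpos : ∀ x, 0 ≤ w x * Real.exp (2 * ∫ t in Ioi x, w t) := fun x =>
    mul_nonneg (h0 x) (Real.exp_pos _).le
  have hlim : Filter.Tendsto (fun x => ∫ t in Ioi x, w t) Filter.atTop (nhds 0) := by
    have h1 := intervalIntegral_tendsto_integral_Ioi (0 : ℝ) hi.integrableOn Filter.tendsto_id
    have h2 := h1.const_sub (∫ t in Ioi (0 : ℝ), w t)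
    rw [sub_self] at h2
    exact h2.congr fun x => (hU x).symm
  have hlim2 : Filter.Tendsto (fun x => -(Real.exp (2 * ∫ t in Ioi x, w t) / 2)) Filter.atTop
      (nhds (-(1 / 2))) := by
    have := (((Real.continuous_exp.tendsto _).comp (hlim.const_mul 2)).div_const 2).neg
    simpa using this
  have hint := integrableOn_Ioi_deriv_of_nonneg' (a := x) (fun y _ => hF y) (fun y _ => hpos y)
    hlim2
  refine ⟨hint, ?_⟩
  rw [integral_Ioi_of_hasDerivAt_of_tendsto' (fun y _ => hF y) hint hlim2]
  linarith

/-- The weight `exp (2 ∫_0^x w)` is contracted by the forward Volterra operator. -/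
theorem integral_Ioc_mul_exp_le {w : ℝ → ℝ} (hw : Continuous w) {x : ℝ} (hx : 0 ≤ x) :
    IntegrableOn (fun ξ => w ξ * Real.exp (2 * ∫ t in (0 : ℝ)..ξ, w t)) (Ioc 0 x) ∧
    ∫ ξ in Ioc 0 x, w ξ * Real.exp (2 * ∫ t in (0 : ℝ)..ξ, w t)
      ≤ Real.exp (2 * ∫ t in (0 : ℝ)..x, w t) / 2 := by
  have hd : ∀ x, HasDerivAt (fun x => ∫ t in (0 : ℝ)..x, w t) (w x) x := fun x =>
    intervalIntegral.integral_hasDerivAt_right (hw.intervalIntegrable 0 x)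
      hw.aestronglyMeasurable.stronglyMeasurableAtFilter hw.continuousAt
  have hF : ∀ x, HasDerivAt (fun x => Real.exp (2 * ∫ t in (0 : ℝ)..x, w t) / 2)
      (w x * Real.exp (2 * ∫ t in (0 : ℝ)..x, w t)) x := by
    intro x
    exact ((((hd x).const_mul 2).exp).div_const 2).congr_deriv (by ring)
  have hc : Continuous (fun x => w x * Real.exp (2 * ∫ t in (0 : ℝ)..x, w t)) := by
    have : Continuous (fun x => ∫ t in (0 : ℝ)..x, w t) :=
      continuous_iff_continuousAt.2 fun x => (hd x).continuousAt
    fun_prop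
  refine ⟨(hc.integrableOn_Icc).mono_set Ioc_subset_Icc_self, ?_⟩
  rw [← intervalIntegral.integral_of_le hx,
    intervalIntegral.integral_eq_sub_of_hasDerivAt (fun y _ => hF y) (hc.intervalIntegrable _ _)]
  simp

end QuarterPlane

/-! ### Primitives on the half line. -/

namespace QuarterPlane

theorem hasDerivWithinAt_integral_zero {g : ℝ → ℂ} (hg : ContinuousOn g (Ici 0)) {x : ℝ}
    (hx : 0 ≤ x) :
    HasDerivWithinAt (fun x => ∫ ξ in (0 : ℝ)..x, g ξ) (g x) (Ici 0) x := by
  -- Freezing the argument at the endpoint extends the integrand continuously to the line, where the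
  -- two-sided theorem applies.
  have hc : Continuous (fun y => g (max y 0)) :=
    hg.comp_continuous (by fun_prop) fun y => le_max_right y 0
  have h1 : HasDerivAt (fun x => ∫ ξ in (0 : ℝ)..x, g (max ξ 0)) (g (max x 0)) x :=
    intervalIntegral.integral_hasDerivAt_right (hc.intervalIntegrable 0 x)
      hc.aestronglyMeasurable.stronglyMeasurableAtFilter hc.continuousAt
  have heq : ∀ y ∈ Ici (0 : ℝ), ∫ ξ in (0 : ℝ)..y, g ξ = ∫ ξ in (0 : ℝ)..y, g (max ξ 0) := by
    intro y hy
    refine intervalIntegral.integral_congr fun ξ hξ => ?_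
    rw [uIcc_of_le hy] at hξ
    simp only [max_eq_left hξ.1]
  rw [max_eq_left hx] at h1
  exact h1.hasDerivWithinAt.congr heq (heq x hx)

theorem integral_Ioi_eq_sub {g : ℝ → ℂ} (hi : IntegrableOn g (Ioi 0)) {x : ℝ} (hx : 0 ≤ x) :
    ∫ ξ in Ioi x, g ξ = (∫ ξ in Ioi (0 : ℝ), g ξ) - ∫ ξ in (0 : ℝ)..x, g ξ := by
  rw [eq_sub_iff_add_eq, add_comm, intervalIntegral.integral_interval_add_Ioi hi
    (hi.mono_set (Ioi_subset_Ioi hx))]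

theorem hasDerivWithinAt_integral_Ioi {g : ℝ → ℂ} (hg : ContinuousOn g (Ici 0))
    (hi : IntegrableOn g (Ioi 0)) {x : ℝ} (hx : 0 ≤ x) :
    HasDerivWithinAt (fun x => ∫ ξ in Ioi x, g ξ) (-g x) (Ici 0) x :=
  ((hasDerivWithinAt_integral_zero hg hx).const_sub (∫ ξ in Ioi (0 : ℝ), g ξ)).congr
    (fun _ hy => integral_Ioi_eq_sub hi hy) (integral_Ioi_eq_sub hi hx)

theorem continuousOn_integral_zero {g : ℝ → ℂ} (hi : IntegrableOn g (Ioi 0)) :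
    ContinuousOn (fun x => ∫ ξ in (0 : ℝ)..x, g ξ) (Ici 0) := by
  have h : Integrable ((Ioi (0 : ℝ)).indicator g) := hi.integrable_indicator measurableSet_Ioi
  have hc := (intervalIntegral.continuous_primitive (fun a b => h.intervalIntegrable) 0)
  refine hc.continuousOn.congr fun x hx => ?_
  simp only [intervalIntegral.integral_of_le (show (0 : ℝ) ≤ x from hx)]
  refine setIntegral_congr_fun measurableSet_Ioc fun ξ hξ => ?_
  rw [indicator_of_mem (show ξ ∈ Ioi (0 : ℝ) from hξ.1)]

theorem continuousOn_integral_Ioi {g : ℝ → ℂ} (hi : IntegrableOn g (Ioi 0)) :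
    ContinuousOn (fun x => ∫ ξ in Ioi x, g ξ) (Ici 0) :=
  (continuousOn_const.sub (continuousOn_integral_zero hi)).congr fun _ hx => integral_Ioi_eq_sub hi hx

theorem tendsto_integral_Ioi_atTop {w : ℝ → ℝ} (hi : IntegrableOn w (Ioi 0)) :
    Filter.Tendsto (fun x => ∫ t in Ioi x, w t) Filter.atTop (nhds 0) := by
  have h1 := intervalIntegral_tendsto_integral_Ioi (0 : ℝ) hi Filter.tendsto_id
  have h2 := h1.const_sub (∫ t in Ioi (0 : ℝ), w t)
  rw [sub_self] at h2
  refine h2.congr' ?_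
  filter_upwards [Filter.eventually_ge_atTop 0] with x hx
  rw [sub_eq_iff_eq_add', id, intervalIntegral.integral_interval_add_Ioi hi
    (hi.mono_set (Ioi_subset_Ioi hx))]

/-! ### The kernel `(e^{2ikt} - 1) / (2ik)` -/

/-- `∫_0^t e^{2iks} ds`. -/
noncomputable def kerD (k : ℂ) (t : ℝ) : ℂ :=
  ∫ s in (0 : ℝ)..t, Complex.exp (2 * Complex.I * k * s)

theorem continuous_kerD : Continuous (fun p : ℂ × ℝ => kerD p.1 p.2) := by
  have h : Continuous (Function.uncurry fun (p : ℂ × ℝ) (s : ℝ) =>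
      Complex.exp (2 * Complex.I * p.1 * s)) := by
    simp only [Function.uncurry_def]
    fun_prop
  exact intervalIntegral.continuous_parametric_intervalIntegral_of_continuous (a₀ := 0) h
    continuous_snd

theorem continuous_kerD_right (k : ℂ) : Continuous (kerD k) :=
  continuous_kerD.comp (by fun_prop : Continuous fun t : ℝ => (k, t))

theorem continuous_kerD_left (t : ℝ) : Continuous (fun k => kerD k t) :=
  continuous_kerD.comp (by fun_prop : Continuous fun k : ℂ => (k, t))

theorem kerD_hasDerivAt (k : ℂ) (t : ℝ) :
    HasDerivAt (kerD k) (Complex.exp (2 * Complex.I * k * t)) t := by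
  have hc : Continuous (fun s : ℝ => Complex.exp (2 * Complex.I * k * s)) := by fun_prop
  exact intervalIntegral.integral_hasDerivAt_right (hc.intervalIntegrable 0 t)
    hc.aestronglyMeasurable.stronglyMeasurableAtFilter hc.continuousAt

@[simp] theorem kerD_zero (k : ℂ) : kerD k 0 = 0 := by simp [kerD]

theorem exp_eq_kerD (k : ℂ) (t : ℝ) :
    Complex.exp (2 * Complex.I * k * t) = 1 + 2 * Complex.I * k * kerD k t := by
  have hd : ∀ s : ℝ, HasDerivAt (fun s : ℝ => Complex.exp (2 * Complex.I * k * s))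
      (2 * Complex.I * k * Complex.exp (2 * Complex.I * k * s)) s := by
    intro s
    have := ((Complex.ofRealCLM.hasDerivAt (x := s)).const_mul (2 * Complex.I * k)).cexp
    simpa [mul_comm] using this
  have hc : Continuous (fun s : ℝ => 2 * Complex.I * k * Complex.exp (2 * Complex.I * k * s)) := by
    fun_prop
  have := intervalIntegral.integral_eq_sub_of_hasDerivAt (fun y (_ : y ∈ uIcc 0 t) => hd y)
    (hc.intervalIntegrable _ _)
  rw [intervalIntegral.integral_const_mul] at this
  rw [kerD, this]
  simp

/-- Translation of the exponential separates the two variables. The variable limit then leaves the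
integrand of every Volterra equation below, which can be differentiated by the fundamental theorem
of calculus. -/
theorem kerD_sub (k : ℂ) (t x : ℝ) :
    kerD k (t - x) = Complex.exp (-(2 * Complex.I * k * x)) * (kerD k t - kerD k x) := by
  have h1 : kerD k (t - x) = ∫ s in x..t, Complex.exp (2 * Complex.I * k * ((s - x : ℝ) : ℂ)) := by
    rw [intervalIntegral.integral_comp_sub_right
      (fun s : ℝ => Complex.exp (2 * Complex.I * k * (s : ℂ))) x, sub_self]
    rfl
  have hc : Continuous (fun s : ℝ => Complex.exp (2 * Complex.I * k * s)) := by fun_prop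
  rw [h1, kerD, kerD, intervalIntegral.integral_interval_sub_left (hc.intervalIntegrable _ _)
    (hc.intervalIntegrable _ _), ← intervalIntegral.integral_const_mul]
  refine intervalIntegral.integral_congr fun s _ => ?_
  rw [← Complex.exp_add]
  congr 1
  push_cast
  ring

theorem norm_exp_two_le {k : ℂ} (hk : 0 ≤ k.im) {t : ℝ} (ht : 0 ≤ t) :
    ‖Complex.exp (2 * Complex.I * k * t)‖ ≤ 1 := by
  rw [Complex.norm_exp, Real.exp_le_one_iff]
  simp
  positivity

theorem norm_kerD_le {k : ℂ} (hk : 0 ≤ k.im) {t : ℝ} (ht : 0 ≤ t) : ‖kerD k t‖ ≤ t := by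
  have := intervalIntegral.norm_integral_le_of_norm_le_const (a := 0) (b := t) (C := 1)
    (f := fun s : ℝ => Complex.exp (2 * Complex.I * k * s)) (fun s hs => by
      rw [uIoc_of_le ht] at hs
      exact norm_exp_two_le hk hs.1.le)
  simpa [abs_of_nonneg ht, kerD] using this

/-- Complements the bound by `t`: that one is uniform down to `k = 0` and costs a moment of `u`,
this one gains `1/|k|` for large `k`. It comes from `2ik D = e^{2ikt} - 1`, whose norm is at most
`2`. -/
theorem norm_mul_kerD_le {k : ℂ} (hk : 0 ≤ k.im) {t : ℝ} (ht : 0 ≤ t) :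
    ‖k‖ * ‖kerD k t‖ ≤ 1 := by
  have h1 : 2 * Complex.I * k * kerD k t = Complex.exp (2 * Complex.I * k * t) - 1 := by
    rw [exp_eq_kerD]; ring
  have h2 : ‖2 * Complex.I * k * kerD k t‖ ≤ 2 := by
    rw [h1]
    refine (norm_sub_le _ _).trans ?_
    have := norm_exp_two_le hk ht
    rw [norm_one]; linarith
  simp only [norm_mul, Complex.norm_I, RCLike.norm_ofNat] at h2
  nlinarith

theorem differentiableOn_kerD (t : ℝ) :
    DifferentiableOn ℂ (fun k => kerD k t) {k : ℂ | 0 < k.im} := by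
  have h : ∀ k ∈ {k : ℂ | 0 < k.im},
      kerD k t = (Complex.exp (2 * Complex.I * k * t) - 1) / (2 * Complex.I * k) := by
    intro k hk
    have hk0 : k ≠ 0 := by rintro rfl; simp at hk
    rw [exp_eq_kerD, add_sub_cancel_left]
    field_simp
  refine DifferentiableOn.congr ?_ h
  refine DifferentiableOn.div (by fun_prop) (by fun_prop) fun k hk => ?_
  have hk0 : k ≠ 0 := by rintro rfl; simp at hk
  simp [hk0]

theorem conj_kerD (k : ℂ) (t : ℝ) : conj (kerD k t) = kerD (-conj k) t := by
  rw [kerD, kerD, intervalIntegral, intervalIntegral, map_sub, ← integral_conj, ← integral_conj]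
  congr 2 <;>
  · funext s
    rw [← Complex.exp_conj]
    simp [Complex.conj_ofNat]

/-! ### Potentials on the line -/

/-- A potential on the whole line, continuous and with integrable first moment. -/
structure LinePotential (u : ℝ → ℝ) : Prop where
  continuous : Continuous u
  integrable : Integrable fun x : ℝ => (1 + |x|) * |u x|

/-- The first moment density `|x| |u(x)|`. -/
def momentDensity (u : ℝ → ℝ) (x : ℝ) : ℝ := |x| * |u x|

namespace LinePotential

variable {u : ℝ → ℝ}

theorem integrable_abs (hu : LinePotential u) : Integrable fun x => |u x| := by
  refine hu.integrable.mono' hu.continuous.abs.aestronglyMeasurable ?_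
  refine Filter.Eventually.of_forall fun x => ?_
  have h1 := abs_nonneg x
  have h2 := abs_nonneg (u x)
  rw [Real.norm_of_nonneg h2]
  nlinarith

theorem continuous_moment (hu : LinePotential u) : Continuous (momentDensity u) :=
  continuous_abs.mul hu.continuous.abs

theorem integrable_moment (hu : LinePotential u) : Integrable (momentDensity u) := by
  refine hu.integrable.mono' hu.continuous_moment.aestronglyMeasurable ?_
  refine Filter.Eventually.of_forall fun x => ?_
  have h1 := abs_nonneg x
  have h2 := abs_nonneg (u x)
  rw [momentDensity, Real.norm_of_nonneg (by positivity)]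
  nlinarith

end LinePotential

theorem momentDensity_nonneg (u : ℝ → ℝ) (x : ℝ) : 0 ≤ momentDensity u x := by
  unfold momentDensity; positivity

/-- The uniform bound of the modified eigenfunctions. -/
noncomputable def potBound (u : ℝ → ℝ) : ℝ := 2 * Real.exp (2 * ∫ x, momentDensity u x)

theorem potBound_pos (u : ℝ → ℝ) : 0 < potBound u := by unfold potBound; positivity

/-! ### The Jost solution `ψ(x, k) = e^{ikx} m(x, k)` -/

/-- The kernel of the integral equation of `m`. -/
noncomputable def jostKer (u : ℝ → ℝ) (k : ℂ) (x ξ : ℝ) : ℂ :=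
  if 0 ≤ x ∧ x < ξ then -kerD k (ξ - x) * (u ξ : ℂ) else 0

/-- The modified Jost function `m(x, k) = e^{-ikx} ψ(x, k)`. -/
noncomputable def jostM (u : ℝ → ℝ) (k : ℂ) (x : ℝ) : ℂ := volterraSol (jostKer u) (fun _ _ => 1) k x

/-- The closed upper half plane. -/
def upper : Set ℂ := {k : ℂ | 0 ≤ k.im}

/-- The open upper half plane. -/
def upperO : Set ℂ := {k : ℂ | 0 < k.im}

theorem isOpen_upperO : IsOpen upperO := isOpen_lt continuous_const Complex.continuous_im

theorem upperO_subset : upperO ⊆ upper := fun k hk => (show 0 < k.im from hk).le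

/-- The weight contracted by the backward equation. -/
noncomputable def jostE (u : ℝ → ℝ) (x : ℝ) : ℝ := Real.exp (2 * ∫ t in Ioi x, momentDensity u t)

/-- The majorant of the backward kernel. -/
noncomputable def jostW (u : ℝ → ℝ) (x ξ : ℝ) : ℝ :=
  if 0 ≤ x ∧ x < ξ then momentDensity u ξ else 0

theorem one_le_jostE (u : ℝ → ℝ) (x : ℝ) : 1 ≤ jostE u x := by
  rw [jostE, Real.one_le_exp_iff]
  have : 0 ≤ ∫ t in Ioi x, momentDensity u t := integral_nonneg fun t => momentDensity_nonneg u t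
  linarith

theorem measurableSet_back : MeasurableSet {p : ℝ × ℝ | 0 ≤ p.1 ∧ p.1 < p.2} :=
  (measurableSet_le measurable_const measurable_fst).inter
    (measurableSet_lt measurable_fst measurable_snd)

variable {u : ℝ → ℝ}

/-- For `0 ≤ x < ξ` and `Im k ≥ 0`, `|D(ξ - x)| ≤ ξ - x ≤ ξ`, so the first moment density majorizes
the kernel independently of `x` and `k`. The cutoff `0 ≤ x` is what makes `ξ - x ≤ ξ` true. -/
theorem jostVolterra (hu : LinePotential u) :
    VolterraBound upper (jostKer u) (jostW u) (jostE u) := by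
  have hind : ∀ x, (fun ξ => jostW u x ξ * jostE u ξ) =
      fun ξ => (if 0 ≤ x then (Ioi x).indicator (fun ξ => momentDensity u ξ * jostE u ξ) ξ
        else 0) := by
    intro x
    funext ξ
    by_cases h1 : 0 ≤ x <;> by_cases h2 : x < ξ <;> simp [jostW, h1, h2]
  have hi := fun x => integral_Ioi_mul_exp_le hu.continuous_moment (momentDensity_nonneg u)
    hu.integrable_moment x
  refine ⟨?_, ?_, ?_, ?_⟩
  · intro k _
    refine Measurable.ite measurableSet_back ?_ measurable_const
    have : Continuous fun p : ℝ × ℝ => -kerD k (p.2 - p.1) * (u p.2 : ℂ) := by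
      have h1 := continuous_kerD_right k
      have h2 := hu.continuous
      fun_prop
    exact this.measurable
  · intro k hk x ξ
    by_cases h : 0 ≤ x ∧ x < ξ
    · simp only [jostKer, jostW, h, and_self, if_true]
      rw [norm_mul, norm_neg, Complex.norm_real, Real.norm_eq_abs, momentDensity]
      refine mul_le_mul_of_nonneg_right ?_ (abs_nonneg _)
      refine (norm_kerD_le hk (by linarith [h.2])).trans ?_
      linarith [h.1, le_abs_self ξ]
    · simp [jostKer, jostW, h]
  · intro x
    rw [hind]
    split_ifs
    · exact (hi x).1.integrable_indicator measurableSet_Ioi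
    · exact integrable_zero _ _ _
  · intro x
    rw [hind]
    split_ifs
    · rw [integral_indicator measurableSet_Ioi]
      exact (hi x).2
    · rw [integral_zero]
      have : 0 < jostE u x := Real.exp_pos _
      positivity

theorem jost_source (u : ℝ → ℝ) : ∀ k ∈ upper, ∀ x : ℝ, ‖(1 : ℂ)‖ ≤ 1 * jostE u x := by
  intro k _ x
  rw [norm_one, one_mul]
  exact one_le_jostE u x

theorem jostE_le (hu : LinePotential u) (x : ℝ) : 2 * jostE u x ≤ potBound u := by
  unfold jostE potBound
  refine mul_le_mul_of_nonneg_left (Real.exp_le_exp.2 ?_) zero_le_two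
  refine mul_le_mul_of_nonneg_left ?_ zero_le_two
  exact setIntegral_le_integral hu.integrable_moment
    (Filter.Eventually.of_forall (momentDensity_nonneg u))

theorem norm_jostM_le (hu : LinePotential u) {k : ℂ} (hk : k ∈ upper) (x : ℝ) :
    ‖jostM u k x‖ ≤ potBound u := by
  have := (jostVolterra hu).sol_bound (h := fun _ _ => 1) zero_le_one (jost_source u) hk x
  rw [mul_one] at this
  exact this.trans (jostE_le hu x)

theorem measurable_jostM (hu : LinePotential u) {k : ℂ} (hk : k ∈ upper) :
    Measurable (jostM u k) :=
  (jostVolterra hu).sol_measurable zero_le_one (jost_source u) (fun _ _ => measurable_const) hk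

theorem jostKer_integral {k : ℂ} {x : ℝ} (hx : 0 ≤ x) (d : ℝ → ℂ) :
    ∫ ξ, jostKer u k x ξ * d ξ = -∫ ξ in Ioi x, kerD k (ξ - x) * (u ξ : ℂ) * d ξ := by
  rw [← integral_neg, ← integral_indicator measurableSet_Ioi]
  congr 1
  funext ξ
  by_cases h : x < ξ <;> simp [jostKer, hx, h]

theorem jostM_eq (hu : LinePotential u) {k : ℂ} (hk : k ∈ upper) {x : ℝ} (hx : 0 ≤ x) :
    jostM u k x = 1 - ∫ ξ in Ioi x, kerD k (ξ - x) * (u ξ : ℂ) * jostM u k ξ := by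
  have := (jostVolterra hu).sol_eq (h := fun _ _ => 1) zero_le_one (jost_source u)
    (fun _ _ => measurable_const) hk x
  rw [jostKer_integral hx] at this
  rw [sub_eq_add_neg]
  exact this

/-- The difference of two bounded solutions, extended by zero to `x < 0`, solves the homogeneous
equation on the whole line because the kernel vanishes there; `VolterraBound.eq_zero` applies. -/
theorem jostM_unique (hu : LinePotential u) {k : ℂ} (hk : k ∈ upper) {d : ℝ → ℂ} {C : ℝ}
    (hdm : AEStronglyMeasurable d (volume.restrict (Ioi 0)))
    (hd : ∀ x, 0 ≤ x → ‖d x‖ ≤ C)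
    (heq : ∀ x, 0 ≤ x → d x = 1 - ∫ ξ in Ioi x, kerD k (ξ - x) * (u ξ : ℂ) * d ξ) {x : ℝ}
    (hx : 0 ≤ x) : d x = jostM u k x := by
  have hC : 0 ≤ C := (norm_nonneg _).trans (hd 0 le_rfl)
  have hint : ∀ {e : ℝ → ℂ} {B : ℝ}, AEStronglyMeasurable e (volume.restrict (Ioi 0)) →
      (∀ x, 0 ≤ x → ‖e x‖ ≤ B) → ∀ x, 0 ≤ x →
      IntegrableOn (fun ξ => kerD k (ξ - x) * (u ξ : ℂ) * e ξ) (Ioi x) := by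
    intro e B hem he x hx
    have hcont : Continuous fun ξ => kerD k (ξ - x) * (u ξ : ℂ) := by
      have h1 := continuous_kerD_right k
      have h2 := hu.continuous
      fun_prop
    refine Integrable.mono' ((hu.integrable_moment.const_mul B).integrableOn (s := Ioi x))
      (hcont.aestronglyMeasurable.mul (hem.mono_measure
        (Measure.restrict_mono_set _ (Ioi_subset_Ioi hx)))) ?_
    refine (ae_restrict_iff' measurableSet_Ioi).2 (Filter.Eventually.of_forall fun ξ hξ => ?_)
    have hξ' : x < ξ := hξ
    rw [norm_mul, norm_mul, mul_comm, Complex.norm_real, Real.norm_eq_abs, momentDensity]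
    refine mul_le_mul (he ξ (hx.trans hξ'.le)) (mul_le_mul_of_nonneg_right ?_ (abs_nonneg _))
      (by positivity) ((norm_nonneg _).trans (he 0 le_rfl))
    refine (norm_kerD_le hk (by linarith)).trans ?_
    linarith [le_abs_self ξ]
  have hz := (jostVolterra hu).eq_zero hk (d := fun x => if 0 ≤ x then d x - jostM u k x else 0)
    (C := C + potBound u) (by have := potBound_pos u; positivity) (fun x => ?_) (fun x => ?_) x
  · simp only [hx, if_true] at hz
    exact sub_eq_zero.1 hz
  · have h1 := one_le_jostE u x
    have h0 : 0 ≤ C + potBound u := by have := potBound_pos u; positivity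
    split_ifs with h
    · have h2 : ‖d x - jostM u k x‖ ≤ C + potBound u :=
        (norm_sub_le _ _).trans (add_le_add (hd x h) (norm_jostM_le hu hk x))
      nlinarith
    · rw [norm_zero]; positivity
  · by_cases h : 0 ≤ x
    · rw [jostKer_integral h]
      simp only [h, if_true]
      rw [heq x h, jostM_eq hu hk h, sub_sub_sub_cancel_left, ← integral_sub
        (hint (measurable_jostM hu hk).aestronglyMeasurable
          (fun x _ => norm_jostM_le hu hk x) x h) (hint hdm hd x h), ← integral_neg]
      refine setIntegral_congr_fun measurableSet_Ioi fun ξ hξ => ?_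
      have hξ' : 0 ≤ ξ := h.trans (le_of_lt hξ)
      simp only [hξ', if_true]
      ring
    · simp [h, jostKer]

theorem continuousOn_jostM_left (hu : LinePotential u) (x : ℝ) :
    ContinuousOn (fun k => jostM u k x) upper := by
  refine (jostVolterra hu).sol_continuousOn zero_le_one (jost_source u)
    (fun _ _ => measurable_const) ?_ (fun _ => continuousOn_const) x
  intro x ξ
  by_cases h : 0 ≤ x ∧ x < ξ
  · simp only [jostKer, h, and_self, if_true]
    exact ((continuous_kerD_left _).neg.mul continuous_const).continuousOn
  · simp only [jostKer, h, if_false]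
    exact continuousOn_const

theorem differentiableOn_jostM_left (hu : LinePotential u) (x : ℝ) :
    DifferentiableOn ℂ (fun k => jostM u k x) upperO := by
  refine (jostVolterra hu).sol_differentiableOn zero_le_one (jost_source u)
    (fun _ _ => measurable_const) isOpen_upperO upperO_subset ?_
    (fun _ => differentiableOn_const _) x
  intro x ξ
  by_cases h : 0 ≤ x ∧ x < ξ
  · simp only [jostKer, h, and_self, if_true]
    exact (differentiableOn_kerD _).neg.mul (differentiableOn_const _)
  · simp only [jostKer, h, if_false]
    exact differentiableOn_const _

theorem neg_conj_mem_upper {k : ℂ} (hk : k ∈ upper) : -conj k ∈ upper := by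
  simpa [upper] using hk

/-- Conjugation turns the kernel at `k` into the kernel at `-conj k`, as `u` is real, and uniqueness
does the rest. In particular `m` is real on the imaginary axis. -/
theorem conj_jostM (hu : LinePotential u) {k : ℂ} (hk : k ∈ upper) {x : ℝ} (hx : 0 ≤ x) :
    conj (jostM u k x) = jostM u (-conj k) x := by
  refine jostM_unique hu (neg_conj_mem_upper hk) (d := fun x => conj (jostM u k x))
    (C := potBound u) ?_ ?_ ?_ hx
  · exact (Complex.continuous_conj.measurable.comp (measurable_jostM hu hk)).aestronglyMeasurable
  · intro x _
    rw [RCLike.norm_conj]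
    exact norm_jostM_le hu hk x
  · intro x hx
    rw [jostM_eq hu hk hx, map_sub, map_one, ← integral_conj]
    congr 2
    funext ξ
    rw [map_mul, map_mul, conj_kerD, Complex.conj_ofReal]

theorem integrable_pot_mul (hu : LinePotential u) {e : ℝ → ℂ} {B : ℝ}
    (hem : AEStronglyMeasurable e (volume.restrict (Ioi 0)))
    (he : ∀ x, 0 < x → ‖e x‖ ≤ B * (1 + |x|)) :
    IntegrableOn (fun ξ => (u ξ : ℂ) * e ξ) (Ioi 0) := by
  refine Integrable.mono' ((hu.integrable.const_mul B).integrableOn (s := Ioi 0))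
    ((Complex.continuous_ofReal.comp hu.continuous).aestronglyMeasurable.mul hem) ?_
  refine (ae_restrict_iff' measurableSet_Ioi).2 (Filter.Eventually.of_forall fun ξ hξ => ?_)
  rw [norm_mul, Complex.norm_real, Real.norm_eq_abs]
  have := mul_le_mul_of_nonneg_left (he ξ hξ) (abs_nonneg (u ξ))
  linarith

/-- `∫_x^∞ u m`. -/
noncomputable def jostN (u : ℝ → ℝ) (k : ℂ) (x : ℝ) : ℂ := ∫ ξ in Ioi x, (u ξ : ℂ) * jostM u k ξ

/-- The derivative `m_x(x, k)`. -/
noncomputable def jostDM (u : ℝ → ℝ) (k : ℂ) (x : ℝ) : ℂ :=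
  jostN u k x + 2 * Complex.I * k * (1 - jostM u k x)

theorem integrable_u_jostM (hu : LinePotential u) {k : ℂ} (hk : k ∈ upper) :
    IntegrableOn (fun ξ => (u ξ : ℂ) * jostM u k ξ) (Ioi 0) := by
  refine integrable_pot_mul hu (B := potBound u) (measurable_jostM hu hk).aestronglyMeasurable ?_
  intro x _
  have h1 := norm_jostM_le hu hk x
  have h2 := potBound_pos u
  have h3 := abs_nonneg x
  nlinarith

theorem integrable_D_u_jostM (hu : LinePotential u) {k : ℂ} (hk : k ∈ upper) :
    IntegrableOn (fun ξ => (u ξ : ℂ) * (kerD k ξ * jostM u k ξ)) (Ioi 0) := by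
  refine integrable_pot_mul hu (B := potBound u) ((continuous_kerD_right
    k).aestronglyMeasurable.mul (measurable_jostM hu hk).aestronglyMeasurable) ?_
  intro x hx
  rw [norm_mul]
  have h1 := norm_jostM_le hu hk x
  have h2 := potBound_pos u
  have h3 := norm_kerD_le hk hx.le
  have h4 := le_abs_self x
  calc ‖kerD k x‖ * ‖jostM u k x‖ ≤ x * potBound u :=
        mul_le_mul h3 h1 (norm_nonneg _) hx.le
    _ ≤ _ := by nlinarith

/-- Separates `x` from the integration variable, so that continuity and differentiability of `m` in
`x` follow from those of primitives. -/
theorem jostM_split (hu : LinePotential u) {k : ℂ} (hk : k ∈ upper) {x : ℝ} (hx : 0 ≤ x) :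
    jostM u k x = 1 - Complex.exp (-(2 * Complex.I * k * x)) *
      ((∫ ξ in Ioi x, (u ξ : ℂ) * (kerD k ξ * jostM u k ξ)) - kerD k x * jostN u k x) := by
  rw [jostM_eq hu hk hx, jostN, ← integral_const_mul, ← integral_sub
    ((integrable_D_u_jostM hu hk).mono_set (Ioi_subset_Ioi hx))
    (((integrable_u_jostM hu hk).mono_set (Ioi_subset_Ioi hx)).const_mul _),
    ← integral_const_mul]
  congr 2
  funext ξ
  rw [kerD_sub]
  ring

theorem continuousOn_jostM (hu : LinePotential u) {k : ℂ} (hk : k ∈ upper) :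
    ContinuousOn (jostM u k) (Ici 0) := by
  refine ContinuousOn.congr ?_ fun x hx => jostM_split hu hk hx
  refine continuousOn_const.sub (ContinuousOn.mul (by fun_prop) ?_)
  exact (continuousOn_integral_Ioi (integrable_D_u_jostM hu hk)).sub
    ((continuous_kerD_right k).continuousOn.mul
      (continuousOn_integral_Ioi (integrable_u_jostM hu hk)))

theorem hasDerivAt_cexp_mul (c : ℂ) (x : ℝ) :
    HasDerivAt (fun x : ℝ => Complex.exp (c * x)) (c * Complex.exp (c * x)) x := by
  have := ((Complex.ofRealCLM.hasDerivAt (x := x)).const_mul c).cexp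
  simpa [mul_comm] using this

theorem hasDerivWithinAt_jostN (hu : LinePotential u) {k : ℂ} (hk : k ∈ upper) {x : ℝ}
    (hx : 0 ≤ x) :
    HasDerivWithinAt (jostN u k) (-((u x : ℂ) * jostM u k x)) (Ici 0) x :=
  hasDerivWithinAt_integral_Ioi ((Complex.continuous_ofReal.comp hu.continuous).continuousOn.mul
    (continuousOn_jostM hu hk)) (integrable_u_jostM hu hk) hx

theorem hasDerivWithinAt_jostM (hu : LinePotential u) {k : ℂ} (hk : k ∈ upper) {x : ℝ}
    (hx : 0 ≤ x) : HasDerivWithinAt (jostM u k) (jostDM u k x) (Ici 0) x := by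
  have h1 := hasDerivWithinAt_integral_Ioi (g := fun ξ => (u ξ : ℂ) * (kerD k ξ * jostM u k ξ))
    ((Complex.continuous_ofReal.comp hu.continuous).continuousOn.mul
    ((continuous_kerD_right k).continuousOn.mul (continuousOn_jostM hu hk)))
    (integrable_D_u_jostM hu hk) hx
  have h2 := ((kerD_hasDerivAt k x).hasDerivWithinAt (s := Ici 0)).mul
    (hasDerivWithinAt_jostN hu hk hx)
  have h3 := (hasDerivAt_cexp_mul (-(2 * Complex.I * k)) x).hasDerivWithinAt (s := Ici 0)
  have h4 := (h3.mul (h1.sub h2)).const_sub 1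
  have h5 : HasDerivWithinAt (jostM u k) _ (Ici 0) x := h4.congr
    (fun y hy => by rw [jostM_split hu hk hy]; simp) (by rw [jostM_split hu hk hx]; simp)
  refine h5.congr_deriv ?_
  have hs := jostM_split hu hk hx
  have he : Complex.exp (-(2 * Complex.I * k) * x) * Complex.exp (2 * Complex.I * k * x) = 1 := by
    rw [← Complex.exp_add]; simp
  simp only [neg_mul] at he ⊢
  simp only [Pi.sub_apply, Pi.mul_apply]
  rw [jostDM]
  generalize Complex.exp (-(2 * Complex.I * k * x)) = e1 at *
  generalize Complex.exp (2 * Complex.I * k * x) = e2 at *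
  linear_combination (2 * Complex.I * k) * hs + jostN u k x * he

theorem hasDerivWithinAt_jostDM (hu : LinePotential u) {k : ℂ} (hk : k ∈ upper) {x : ℝ}
    (hx : 0 ≤ x) : HasDerivWithinAt (jostDM u k)
      (-((u x : ℂ) * jostM u k x) - 2 * Complex.I * k * jostDM u k x) (Ici 0) x :=
  ((hasDerivWithinAt_jostN hu hk hx).add (((hasDerivWithinAt_jostM hu hk hx).const_sub
    1).const_mul (2 * Complex.I * k))).congr_deriv (by ring)

theorem norm_jostM_sub_one_le (hu : LinePotential u) {k : ℂ} (hk : k ∈ upper) {x : ℝ}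
    (hx : 0 ≤ x) : ‖jostM u k x - 1‖ ≤ potBound u * ∫ ξ in Ioi x, momentDensity u ξ := by
  rw [jostM_eq hu hk hx, sub_sub_cancel_left, norm_neg, ← integral_const_mul]
  refine norm_integral_le_of_norm_le (hu.integrable_moment.integrableOn.const_mul _) ?_
  refine (ae_restrict_iff' measurableSet_Ioi).2 (Filter.Eventually.of_forall fun ξ hξ => ?_)
  have hξ' : x < ξ := hξ
  rw [norm_mul, norm_mul, mul_comm, Complex.norm_real, Real.norm_eq_abs, momentDensity]
  refine mul_le_mul (norm_jostM_le hu hk ξ) (mul_le_mul_of_nonneg_right ?_ (abs_nonneg _))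
    (by positivity) (potBound_pos u).le
  refine (norm_kerD_le hk (by linarith)).trans ?_
  linarith [le_abs_self ξ]

/-- The factor `|k|` is absorbed by `|k| |D| ≤ 1`, which leaves an `L¹` tail of `u`. This yields `m
= 1 + O(1/k)` uniformly in `x`. -/
theorem norm_mul_jostM_sub_one_le (hu : LinePotential u) {k : ℂ} (hk : k ∈ upper) {x : ℝ}
    (hx : 0 ≤ x) : ‖k‖ * ‖jostM u k x - 1‖ ≤ potBound u * ∫ ξ in Ioi x, |u ξ| := by
  rw [jostM_eq hu hk hx, sub_sub_cancel_left, norm_neg, ← integral_const_mul, ← norm_mul,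
    ← integral_const_mul]
  refine norm_integral_le_of_norm_le (hu.integrable_abs.integrableOn.const_mul _) ?_
  refine (ae_restrict_iff' measurableSet_Ioi).2 (Filter.Eventually.of_forall fun ξ hξ => ?_)
  have hξ' : x < ξ := hξ
  have h1 := norm_mul_kerD_le hk (t := ξ - x) (by linarith)
  have h2 := norm_jostM_le hu hk ξ
  rw [norm_mul, norm_mul, norm_mul, Complex.norm_real, Real.norm_eq_abs]
  calc ‖k‖ * (‖kerD k (ξ - x)‖ * |u ξ| * ‖jostM u k ξ‖)
      = (‖k‖ * ‖kerD k (ξ - x)‖) * (|u ξ| * ‖jostM u k ξ‖) := by ring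
    _ ≤ 1 * (|u ξ| * potBound u) := by gcongr
    _ = _ := by ring

theorem norm_jostN_le (hu : LinePotential u) {k : ℂ} (hk : k ∈ upper) (x : ℝ) :
    ‖jostN u k x‖ ≤ potBound u * ∫ ξ in Ioi x, |u ξ| := by
  rw [jostN, ← integral_const_mul]
  refine norm_integral_le_of_norm_le (hu.integrable_abs.integrableOn.const_mul _) ?_
  refine Filter.Eventually.of_forall fun ξ => ?_
  rw [norm_mul, Complex.norm_real, Real.norm_eq_abs, mul_comm]
  exact mul_le_mul_of_nonneg_right (norm_jostM_le hu hk ξ) (abs_nonneg _)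

/-- The term `2ik(1 - m)` does not grow with `k`, since `k (m - 1)` is already controlled by the
tail of `u`. -/
theorem norm_jostDM_le (hu : LinePotential u) {k : ℂ} (hk : k ∈ upper) {x : ℝ}
    (hx : 0 ≤ x) : ‖jostDM u k x‖ ≤ 3 * (potBound u * ∫ ξ in Ioi x, |u ξ|) := by
  have h1 := norm_jostN_le hu hk x
  have h2 := norm_mul_jostM_sub_one_le hu hk hx
  have h3 : ‖2 * Complex.I * k * (1 - jostM u k x)‖ = 2 * (‖k‖ * ‖jostM u k x - 1‖) := by
    rw [norm_mul, norm_mul, norm_mul, norm_sub_rev 1]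
    simp [mul_assoc]
  refine (norm_add_le _ _).trans ?_
  rw [h3]; linarith

theorem continuousOn_jostDM_left (hu : LinePotential u) {x : ℝ} (hx : 0 ≤ x) :
    ContinuousOn (fun k => jostDM u k x) upper := by
  have h1 := continuousOn_jostM_left hu x
  refine ContinuousOn.add ?_ (by fun_prop)
  refine continuousOn_of_dominated (bound := fun ξ => potBound u * |u ξ|) ?_ ?_
    (hu.integrable_abs.integrableOn.const_mul _) ?_
  · intro k hk
    exact ((integrable_u_jostM hu hk).mono_set (Ioi_subset_Ioi hx)).aestronglyMeasurable
  · intro k hk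
    refine Filter.Eventually.of_forall fun ξ => ?_
    rw [norm_mul, Complex.norm_real, Real.norm_eq_abs, mul_comm]
    exact mul_le_mul_of_nonneg_right (norm_jostM_le hu hk ξ) (abs_nonneg _)
  · exact Filter.Eventually.of_forall fun ξ =>
      continuousOn_const.mul (continuousOn_jostM_left hu ξ)

end QuarterPlane

namespace QuarterPlane

/-! ### Solutions of `v'' + (u + k²) v = 0` on the half line -/

/-- `v` solves `v'' + (u + k²) v = 0` on `[0, ∞)`, with first derivative `v'`. -/
structure IsODE (u : ℝ → ℝ) (k : ℂ) (v v' : ℝ → ℂ) : Prop where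
  deriv : ∀ x, 0 ≤ x → HasDerivWithinAt v (v' x) (Ici 0) x
  deriv' : ∀ x, 0 ≤ x → HasDerivWithinAt v' (-((u x : ℂ) + k ^ 2) * v x) (Ici 0) x

namespace IsODE

variable {u : ℝ → ℝ} {k : ℂ} {v v' w w' : ℝ → ℂ}

theorem continuousOn (h : IsODE u k v v') : ContinuousOn v (Ici 0) := fun x hx =>
  (h.deriv x hx).continuousWithinAt

theorem continuousOn' (h : IsODE u k v v') : ContinuousOn v' (Ici 0) := fun x hx =>
  (h.deriv' x hx).continuousWithinAt

theorem hasDerivAt (h : IsODE u k v v') {x : ℝ} (hx : 0 < x) : HasDerivAt v (v' x) x :=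
  (h.deriv x hx.le).hasDerivAt (Ici_mem_nhds hx)

theorem hasDerivAt' (h : IsODE u k v v') {x : ℝ} (hx : 0 < x) :
    HasDerivAt v' (-((u x : ℂ) + k ^ 2) * v x) x :=
  (h.deriv' x hx.le).hasDerivAt (Ici_mem_nhds hx)

theorem derivWithin_zero (h : IsODE u k v v') : derivWithin v (Ici 0) 0 = v' 0 :=
  (h.deriv 0 le_rfl).derivWithin (uniqueDiffOn_Ici 0 0 self_mem_Ici)

theorem of_sq_eq (h : IsODE u k v v') {k₁ : ℂ} (hk : k₁ ^ 2 = k ^ 2) : IsODE u k₁ v v' :=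
  ⟨h.deriv, fun x hx => by rw [hk]; exact h.deriv' x hx⟩

theorem combine (h : IsODE u k v v') (g : IsODE u k w w') (a b : ℂ) :
    IsODE u k (fun x => a * v x + b * w x) (fun x => a * v' x + b * w' x) :=
  ⟨fun x hx => ((h.deriv x hx).const_mul a).add ((g.deriv x hx).const_mul b),
    fun x hx => (((h.deriv' x hx).const_mul a).add ((g.deriv' x hx).const_mul b)).congr_deriv
      (by ring)⟩

theorem conjugate (h : IsODE u k v v') :
    IsODE u (-conj k) (fun x => conj (v x)) (fun x => conj (v' x)) := by
  have hc : ∀ {f : ℝ → ℂ} {f' : ℂ} {x : ℝ}, HasDerivWithinAt f f' (Ici 0) x →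
      HasDerivWithinAt (fun x => (starRingEnd ℂ) (f x)) ((starRingEnd ℂ) f') (Ici 0) x := by
    intro f f' x hf
    exact (Complex.conjCLE.toContinuousLinearMap.hasFDerivAt.comp_hasDerivWithinAt x hf)
  refine ⟨fun x hx => hc (h.deriv x hx), fun x hx => (hc (h.deriv' x hx)).congr_deriv ?_⟩
  simp

/-- Derivative of the Wronskian of solutions at two spectral parameters. -/
theorem hasDerivWithinAt_wronskian {k₁ : ℂ} (h : IsODE u k v v') (g : IsODE u k₁ w w') {x : ℝ}
    (hx : 0 ≤ x) : HasDerivWithinAt (fun x => v x * w' x - v' x * w x)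
      ((k ^ 2 - k₁ ^ 2) * (v x * w x)) (Ici 0) x :=
  (((h.deriv x hx).mul (g.deriv' x hx)).sub ((h.deriv' x hx).mul (g.deriv x hx))).congr_deriv
    (by ring)

/-- The integrated Lagrange identity. With equal parameters it gives constancy of the Wronskian,
with conjugate ones the self-adjointness argument, and with two imaginary ones the Sturm comparison.
-/
theorem wronskian_sub {k₁ : ℂ} (h : IsODE u k v v') (g : IsODE u k₁ w w') {a x : ℝ}
    (ha : 0 ≤ a) (hx : a ≤ x) :
    (v x * w' x - v' x * w x) - (v a * w' a - v' a * w a) =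
      (k ^ 2 - k₁ ^ 2) * ∫ ξ in a..x, v ξ * w ξ := by
  have hIcc : Icc a x ⊆ Ici 0 := fun y hy => ha.trans hy.1
  rw [← intervalIntegral.integral_const_mul]
  refine (intervalIntegral.integral_eq_sub_of_hasDerivAt_of_le hx
    (f := fun x => v x * w' x - v' x * w x) ?_ ?_ ?_).symm
  · exact ((h.continuousOn.mul g.continuousOn').sub (h.continuousOn'.mul g.continuousOn)).mono hIcc
  · intro y hy
    exact (hasDerivWithinAt_wronskian h g (ha.trans hy.1.le)).hasDerivAt
      (Ici_mem_nhds (ha.trans_lt hy.1))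
  · refine ContinuousOn.intervalIntegrable_of_Icc hx ?_
    exact (continuousOn_const.mul (h.continuousOn.mul g.continuousOn)).mono hIcc

theorem wronskian_eq (h : IsODE u k v v') (g : IsODE u k w w') {x : ℝ} (hx : 0 ≤ x) :
    v x * w' x - v' x * w x = v 0 * w' 0 - v' 0 * w 0 := by
  have := wronskian_sub h g le_rfl hx
  rw [sub_self, zero_mul, sub_eq_zero] at this
  exact this

theorem eq_of_initial (hu : Continuous u) (h : IsODE u k v v') (g : IsODE u k w w')
    (h0 : v 0 = w 0) (h1 : v' 0 = w' 0) {x : ℝ} (hx : 0 ≤ x) : v x = w x ∧ v' x = w' x := by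
  obtain ⟨C, hC⟩ := (isCompact_Icc (a := (0 : ℝ)) (b := x)).exists_bound_of_continuousOn
    hu.continuousOn
  have hC0 : 0 ≤ C := (norm_nonneg _).trans (hC 0 ⟨le_rfl, hx⟩)
  -- Lipschitz constant, in the max norm, of the first order system `(v, v')' = (v', -(u + k²) v)`:
  -- the first component has constant `1`, the second `C + |k|²`, where `C` bounds `u` on `[0, x]`.
  set K : NNReal := ⟨max 1 (C + ‖k‖ ^ 2), le_max_of_le_left zero_le_one⟩ with hK
  have hL : ∀ t ∈ Ico 0 x, LipschitzOnWith K
      (fun p : ℂ × ℂ => ((p.2, -((u t : ℂ) + k ^ 2) * p.1) : ℂ × ℂ)) univ := by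
    intro t ht
    refine LipschitzOnWith.of_dist_le_mul fun p _ q _ => ?_
    rw [Prod.dist_eq, Prod.dist_eq]
    simp only [dist_eq_norm]
    have hKv : (K : ℝ) = max 1 (C + ‖k‖ ^ 2) := rfl
    rw [hKv]
    set M := max ‖p.1 - q.1‖ ‖p.2 - q.2‖
    have hM : 0 ≤ M := le_max_of_le_left (norm_nonneg _)
    refine max_le ?_ ?_
    · calc ‖p.2 - q.2‖ ≤ 1 * M := by rw [one_mul]; exact le_max_right _ _
        _ ≤ _ := mul_le_mul_of_nonneg_right (le_max_left _ _) hM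
    · rw [← mul_sub, norm_mul, norm_neg]
      refine mul_le_mul ?_ (le_max_left _ _) (norm_nonneg _) (le_max_of_le_left zero_le_one)
      refine (norm_add_le _ _).trans (le_max_of_le_right ?_)
      rw [norm_pow, Complex.norm_real]
      exact add_le_add (hC t ⟨ht.1, ht.2.le⟩) le_rfl
  have key := ODE_solution_unique_of_mem_Icc_right (s := fun _ => univ) hL
    (f := fun x => (v x, v' x)) (g := fun x => (w x, w' x))
    ((h.continuousOn.prodMk h.continuousOn').mono fun y hy => hy.1)
    (fun t ht => ((h.deriv t ht.1).prodMk (h.deriv' t ht.1)).mono (Ici_subset_Ici.2 ht.1))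
    (fun _ _ => mem_univ _)
    ((g.continuousOn.prodMk g.continuousOn').mono fun y hy => hy.1)
    (fun t ht => ((g.deriv t ht.1).prodMk (g.deriv' t ht.1)).mono (Ici_subset_Ici.2 ht.1))
    (fun _ _ => mem_univ _) (by simp [h0, h1])
  have := key ⟨hx, le_rfl⟩
  exact ⟨congrArg Prod.fst this, congrArg Prod.snd this⟩

end IsODE

variable {u : ℝ → ℝ}

theorem jost_isODE (hu : LinePotential u) {k : ℂ} (hk : k ∈ upper) :
    IsODE u k (fun x => Complex.exp (Complex.I * k * x) * jostM u k x)
      (fun x => Complex.exp (Complex.I * k * x) *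
        (Complex.I * k * jostM u k x + jostDM u k x)) := by
  refine ⟨fun x hx => ?_, fun x hx => ?_⟩
  · exact ((hasDerivAt_cexp_mul (Complex.I * k) x).hasDerivWithinAt.mul
      (hasDerivWithinAt_jostM hu hk hx)).congr_deriv (by ring)
  · refine ((hasDerivAt_cexp_mul (Complex.I * k) x).hasDerivWithinAt.mul
      (((hasDerivWithinAt_jostM hu hk hx).const_mul (Complex.I * k)).add
        (hasDerivWithinAt_jostDM hu hk hx))).congr_deriv ?_
    simp only [Pi.add_apply]
    linear_combination (Complex.exp (Complex.I * k * x) * jostM u k x * k ^ 2) * Complex.I_sq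

/-! ### Solutions given by forward integral equations -/

/-- The forward integral equation of `n = e^{ikx} v`, for a solution `v` with
`n(0) = α`, `n'(0) = β`. -/
def IsForward (u : ℝ → ℝ) (k α β : ℂ) (n : ℝ → ℂ) : Prop :=
  ∀ x, 0 ≤ x → n x = α + β * kerD k x - ∫ ξ in (0 : ℝ)..x, kerD k (x - ξ) * ((u ξ : ℂ) * n ξ)

/-- The derivative of a solution of the forward integral equation. -/
noncomputable def forwardDN (u : ℝ → ℝ) (k β : ℂ) (n : ℝ → ℂ) (x : ℝ) : ℂ :=
  Complex.exp (2 * Complex.I * k * x) *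
    (β - ∫ ξ in (0 : ℝ)..x, Complex.exp (-(2 * Complex.I * k * ξ)) * ((u ξ : ℂ) * n ξ))

namespace IsForward

variable {k α β : ℂ} {n : ℝ → ℂ}

theorem apply_zero (h : IsForward u k α β n) : n 0 = α := by
  have := h 0 le_rfl
  simpa using this

theorem split (hu : Continuous u) (h : IsForward u k α β n) (hn : ContinuousOn n (Ici 0))
    {x : ℝ} (hx : 0 ≤ x) :
    n x = α + β * kerD k x -
      (kerD k x * (∫ ξ in (0 : ℝ)..x, Complex.exp (-(2 * Complex.I * k * ξ)) * ((u ξ : ℂ) * n ξ))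
      - ∫ ξ in (0 : ℝ)..x, Complex.exp (-(2 * Complex.I * k * ξ)) *
        (kerD k ξ * ((u ξ : ℂ) * n ξ))) := by
  have hI : Icc 0 x ⊆ Ici 0 := fun y hy => hy.1
  have hun : ContinuousOn (fun ξ : ℝ => Complex.exp (-(2 * Complex.I * k * ξ)) *
      ((u ξ : ℂ) * n ξ)) (Icc 0 x) :=
    ContinuousOn.mul (by fun_prop)
      ((Complex.continuous_ofReal.comp hu).continuousOn.mul (hn.mono hI))
  have hun2 : ContinuousOn (fun ξ : ℝ => Complex.exp (-(2 * Complex.I * k * ξ)) *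
      (kerD k ξ * ((u ξ : ℂ) * n ξ))) (Icc 0 x) :=
    ContinuousOn.mul (by fun_prop) ((continuous_kerD_right k).continuousOn.mul
      ((Complex.continuous_ofReal.comp hu).continuousOn.mul (hn.mono hI)))
  rw [h x hx, ← intervalIntegral.integral_const_mul, ← intervalIntegral.integral_sub
    ((hun.intervalIntegrable_of_Icc hx).const_mul _) (hun2.intervalIntegrable_of_Icc hx)]
  congr 1
  refine intervalIntegral.integral_congr fun ξ _ => ?_
  simp only [kerD_sub]
  ring

theorem hasDerivWithinAt (hu : Continuous u) (h : IsForward u k α β n)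
    (hn : ContinuousOn n (Ici 0)) {x : ℝ} (hx : 0 ≤ x) :
    HasDerivWithinAt n (forwardDN u k β n x) (Ici 0) x := by
  have hun := (Complex.continuous_ofReal.comp hu).continuousOn.mul hn
  have h1 := hasDerivWithinAt_integral_zero
    (g := fun ξ : ℝ => Complex.exp (-(2 * Complex.I * k * ξ)) * ((u ξ : ℂ) * n ξ))
    (ContinuousOn.mul (by fun_prop) hun) hx
  have h2 := hasDerivWithinAt_integral_zero
    (g := fun ξ : ℝ => Complex.exp (-(2 * Complex.I * k * ξ)) * (kerD k ξ * ((u ξ : ℂ) * n ξ)))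
    (ContinuousOn.mul (by fun_prop) ((continuous_kerD_right k).continuousOn.mul hun)) hx
  have h3 := (kerD_hasDerivAt k x).hasDerivWithinAt (s := Ici 0)
  have h4 := ((h3.const_mul β).const_add α).sub ((h3.mul h1).sub h2)
  refine (h4.congr (fun y hy => h.split hu hn hy) (h.split hu hn hx)).congr_deriv ?_
  rw [forwardDN]
  ring

theorem hasDerivWithinAt_forwardDN (hu : Continuous u) (hn : ContinuousOn n (Ici 0)) {x : ℝ}
    (hx : 0 ≤ x) : HasDerivWithinAt (forwardDN u k β n)
      (2 * Complex.I * k * forwardDN u k β n x - (u x : ℂ) * n x) (Ici 0) x := by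
  have hun := (Complex.continuous_ofReal.comp hu).continuousOn.mul hn
  have h1 := hasDerivWithinAt_integral_zero
    (g := fun ξ : ℝ => Complex.exp (-(2 * Complex.I * k * ξ)) * ((u ξ : ℂ) * n ξ))
    (ContinuousOn.mul (by fun_prop) hun) hx
  refine ((hasDerivAt_cexp_mul (2 * Complex.I * k) x).hasDerivWithinAt.mul
    (h1.const_sub β)).congr_deriv ?_
  have he : Complex.exp (2 * Complex.I * k * x) * Complex.exp (-(2 * Complex.I * k * x)) = 1 := by
    rw [← Complex.exp_add]; simp
  rw [forwardDN]
  linear_combination (-((u x : ℂ) * n x)) * he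

theorem isODE (hu : Continuous u) (h : IsForward u k α β n) (hn : ContinuousOn n (Ici 0)) :
    IsODE u k (fun x => Complex.exp (-(Complex.I * k) * x) * n x)
      (fun x => Complex.exp (-(Complex.I * k) * x) *
        (-(Complex.I * k) * n x + forwardDN u k β n x)) := by
  refine ⟨fun x hx => ?_, fun x hx => ?_⟩
  · exact ((hasDerivAt_cexp_mul (-(Complex.I * k)) x).hasDerivWithinAt.mul
      (h.hasDerivWithinAt hu hn hx)).congr_deriv (by ring)
  · refine ((hasDerivAt_cexp_mul (-(Complex.I * k)) x).hasDerivWithinAt.mul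
      (((h.hasDerivWithinAt hu hn hx).const_mul (-(Complex.I * k))).add
        (hasDerivWithinAt_forwardDN hu hn hx))).congr_deriv ?_
    simp only [Pi.add_apply]
    linear_combination (Complex.exp (-(Complex.I * k) * x) * n x * k ^ 2) * Complex.I_sq

theorem forwardDN_zero : forwardDN u k β n 0 = β := by simp [forwardDN]

/-- A solution of at most linear growth is continuous. -/
theorem continuousOn (hu : LinePotential u) (hk : k ∈ upper) (h : IsForward u k α β n)
    (hm : AEStronglyMeasurable n (volume.restrict (Ioi 0))) {B : ℝ}
    (hB : ∀ x, 0 < x → ‖n x‖ ≤ B * (1 + |x|)) : ContinuousOn n (Ici 0) := by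
  have hint := integrable_pot_mul hu hm hB
  -- Since `D(0) = 0`, the kernel can be continued by `D(max (x - ξ) 0)`. The domain of integration
  -- no longer depends on `x`, and dominated convergence applies.
  have heq : ∀ x ∈ Ici (0 : ℝ), n x = α + β * kerD k x -
      ∫ ξ in Ioi (0 : ℝ), kerD k (max (x - ξ) 0) * ((u ξ : ℂ) * n ξ) := by
    intro x hx
    rw [h x hx, intervalIntegral.integral_of_le hx]
    congr 1
    refine (setIntegral_congr_fun measurableSet_Ioc fun ξ hξ => ?_).trans
      (setIntegral_eq_of_subset_of_forall_sdiff_eq_zero measurableSet_Ioi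
        (fun ξ hξ => hξ.1) fun ξ hξ => ?_).symm
    · simp only [max_eq_left (sub_nonneg.2 hξ.2)]
    · have : x - ξ ≤ 0 := by
        by_contra hc
        exact hξ.2 ⟨hξ.1, by linarith⟩
      simp [max_eq_right this]
  refine ContinuousOn.congr (ContinuousOn.sub ?_ ?_) heq
  · have := continuous_kerD_right k
    fun_prop
  intro x hx
  have hcont : ContinuousOn (fun x => ∫ ξ in Ioi (0 : ℝ), kerD k (max (x - ξ) 0) *
      ((u ξ : ℂ) * n ξ)) (Icc 0 (x + 1)) := by
    refine continuousOn_of_dominated (bound := fun ξ => (x + 1) * ‖(u ξ : ℂ) * n ξ‖) ?_ ?_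
      (hint.norm.const_mul _) ?_
    · intro y _
      have hc : Continuous fun ξ => kerD k (max (y - ξ) 0) := by
        have := continuous_kerD_right k
        fun_prop
      exact hc.aestronglyMeasurable.mul hint.aestronglyMeasurable
    · intro y hy
      refine (ae_restrict_iff' measurableSet_Ioi).2 (Filter.Eventually.of_forall fun ξ hξ => ?_)
      rw [norm_mul]
      refine mul_le_mul_of_nonneg_right ?_ (norm_nonneg _)
      refine (norm_kerD_le hk (le_max_right _ _)).trans (max_le ?_ ?_)
      · have : 0 < ξ := hξ
        linarith [hy.2]
      · have : (0 : ℝ) ≤ x := hx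
        linarith
    · refine Filter.Eventually.of_forall fun ξ => ?_
      have := continuous_kerD_right k
      fun_prop
  refine (hcont x ⟨hx, by linarith⟩).mono_of_mem_nhdsWithin ?_
  rw [mem_nhdsWithin]
  exact ⟨Iio (x + 1), isOpen_Iio, by simp, fun y hy => ⟨hy.2, le_of_lt hy.1⟩⟩

end IsForward

/-! ### Forward Volterra kernels. -/

theorem measurableSet_fwd : MeasurableSet {p : ℝ × ℝ | 0 < p.2 ∧ p.2 ≤ p.1} :=
  (measurableSet_lt measurable_const measurable_snd).inter
    (measurableSet_le measurable_snd measurable_fst)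

/-- Restriction of a kernel to `0 < ξ ≤ x`. -/
noncomputable def fwdKer (K : ℂ → ℝ → ℝ → ℂ) (k : ℂ) (x ξ : ℝ) : ℂ :=
  if 0 < ξ ∧ ξ ≤ x then K k x ξ else 0

/-- The majorant of a forward kernel. -/
noncomputable def fwdW (w : ℝ → ℝ) (x ξ : ℝ) : ℝ := if 0 < ξ ∧ ξ ≤ x then w ξ else 0

/-- The weight contracted by a forward equation. -/
noncomputable def fwdE (w : ℝ → ℝ) (x : ℝ) : ℝ := Real.exp (2 * ∫ t in (0 : ℝ)..x, w t)

theorem forwardVolterra {S : Set ℂ} {K : ℂ → ℝ → ℝ → ℂ} {w : ℝ → ℝ} (hw : Continuous w)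
    (hK : ∀ k ∈ S, Measurable (Function.uncurry (K k)))
    (hb : ∀ k ∈ S, ∀ x ξ, 0 < ξ → ξ ≤ x → ‖K k x ξ‖ ≤ w ξ) :
    VolterraBound S (fwdKer K) (fwdW w) (fwdE w) := by
  have hind : ∀ x, (fun ξ => fwdW w x ξ * fwdE w ξ) =
      (Ioc 0 x).indicator (fun ξ => w ξ * fwdE w ξ) := by
    intro x
    funext ξ
    by_cases h1 : 0 < ξ ∧ ξ ≤ x <;> simp [fwdW, indicator, h1]
  refine ⟨?_, ?_, ?_, ?_⟩
  · intro k hk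
    exact Measurable.ite measurableSet_fwd (hK k hk) measurable_const
  · intro k hk x ξ
    by_cases h : 0 < ξ ∧ ξ ≤ x
    · simp only [fwdKer, fwdW, h, and_self, if_true]
      exact hb k hk x ξ h.1 h.2
    · simp [fwdKer, fwdW, h]
  · intro x
    rw [hind]
    rcases le_total 0 x with hx | hx
    · exact (integral_Ioc_mul_exp_le hw hx).1.integrable_indicator measurableSet_Ioc
    · rw [Ioc_eq_empty (not_lt.2 hx), indicator_empty]
      exact integrable_zero _ _ _
  · intro x
    rw [hind]
    rcases le_total 0 x with hx | hx
    · rw [integral_indicator measurableSet_Ioc]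
      exact (integral_Ioc_mul_exp_le hw hx).2
    · rw [Ioc_eq_empty (not_lt.2 hx), indicator_empty, integral_zero]
      have : 0 < fwdE w x := Real.exp_pos _
      positivity

theorem one_le_fwdE {w : ℝ → ℝ} (h0 : ∀ x, 0 ≤ w x) {x : ℝ} (hx : 0 ≤ x) : 1 ≤ fwdE w x := by
  rw [fwdE, Real.one_le_exp_iff]
  have := intervalIntegral.integral_nonneg (μ := volume) hx fun t _ => h0 t
  linarith

theorem fwdE_le {w : ℝ → ℝ} (h0 : ∀ x, 0 ≤ w x) (hi : Integrable w) {x : ℝ} (hx : 0 ≤ x) :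
    fwdE w x ≤ Real.exp (2 * ∫ t, w t) := by
  refine Real.exp_le_exp.2 (mul_le_mul_of_nonneg_left ?_ zero_le_two)
  rw [intervalIntegral.integral_of_le hx]
  exact setIntegral_le_integral hi (Filter.Eventually.of_forall h0)

theorem fwdKer_integral {K : ℂ → ℝ → ℝ → ℂ} {k : ℂ} {x : ℝ} (hx : 0 ≤ x) (d : ℝ → ℂ) :
    ∫ ξ, fwdKer K k x ξ * d ξ = ∫ ξ in (0 : ℝ)..x, K k x ξ * d ξ := by
  rw [intervalIntegral.integral_of_le hx, ← integral_indicator measurableSet_Ioc]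
  congr 1
  funext ξ
  by_cases h : 0 < ξ ∧ ξ ≤ x <;> simp [fwdKer, indicator, h]

/-! ### The solution with `s(0) = 0`, `s'(0) = 1` -/

/-- The kernel of the equation of `s e^{ikx} / x`. -/
noncomputable def dirKer (u : ℝ → ℝ) (k : ℂ) (x ξ : ℝ) : ℂ :=
  -kerD k (x - ξ) * ((ξ / x : ℝ) : ℂ) * (u ξ : ℂ)

/-- The inhomogeneity of the equation of `s e^{ikx} / x`. -/
noncomputable def dirSource (k : ℂ) (x : ℝ) : ℂ := if 0 < x then kerD k x / x else 0

/-- `n(x, k) = e^{ikx} s(x, k)`, where `s` is the solution with `s(0) = 0`, `s'(0) = 1`. -/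
noncomputable def dirN (u : ℝ → ℝ) (k : ℂ) (x : ℝ) : ℂ :=
  x * volterraSol (fwdKer (dirKer u)) dirSource k x

/-- The unknown is divided by `x` because `n` itself grows linearly near `k = 0`. The quotient
introduces `ξ/x`, and `|D(x - ξ)| ξ/x ≤ ξ` brings back the first moment density, uniformly in `k`.
-/
theorem dirVolterra (hu : LinePotential u) :
    VolterraBound upper (fwdKer (dirKer u)) (fwdW (momentDensity u))
      (fwdE (momentDensity u)) := by
  refine forwardVolterra hu.continuous_moment ?_ ?_
  · intro k _
    have h1 : Measurable (kerD k) := (continuous_kerD_right k).measurable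
    have h2 : Measurable u := hu.continuous.measurable
    unfold dirKer Function.uncurry
    fun_prop
  · intro k hk x ξ h0 h1
    rw [dirKer, norm_mul, norm_mul, norm_neg, Complex.norm_real, Complex.norm_real,
      Real.norm_eq_abs, Real.norm_eq_abs, momentDensity]
    refine mul_le_mul_of_nonneg_right ?_ (abs_nonneg _)
    have hx : 0 < x := h0.trans_le h1
    have h2 := norm_kerD_le hk (sub_nonneg.2 h1)
    rw [abs_of_nonneg (by positivity), abs_of_pos h0]
    calc ‖kerD k (x - ξ)‖ * (ξ / x) ≤ x * (ξ / x) :=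
          mul_le_mul_of_nonneg_right (h2.trans (by linarith)) (by positivity)
      _ = ξ := by field_simp

theorem dir_source_bound (u : ℝ → ℝ) :
    ∀ k ∈ upper, ∀ x : ℝ, ‖dirSource k x‖ ≤ 1 * fwdE (momentDensity u) x := by
  intro k hk x
  rw [one_mul, dirSource]
  split_ifs with hx
  · refine le_trans ?_ (one_le_fwdE (momentDensity_nonneg u) hx.le)
    rw [norm_div, Complex.norm_real, Real.norm_of_nonneg hx.le, div_le_one hx]
    exact norm_kerD_le hk hx.le
  · rw [norm_zero]
    exact (Real.exp_pos _).le

theorem measurable_dirSource (k : ℂ) : Measurable (dirSource k) :=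
  Measurable.ite measurableSet_Ioi ((continuous_kerD_right k).measurable.div
    Complex.continuous_ofReal.measurable) measurable_const

theorem measurable_dirN (hu : LinePotential u) {k : ℂ} (hk : k ∈ upper) :
    Measurable (dirN u k) :=
  Complex.continuous_ofReal.measurable.mul ((dirVolterra hu).sol_measurable zero_le_one
    (dir_source_bound u) (fun k _ => measurable_dirSource k) hk)

theorem norm_dirN_le (hu : LinePotential u) {k : ℂ} (hk : k ∈ upper) {x : ℝ} (hx : 0 ≤ x) :
    ‖dirN u k x‖ ≤ potBound u * x := by
  rw [dirN, norm_mul, Complex.norm_real, Real.norm_of_nonneg hx, mul_comm]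
  refine mul_le_mul_of_nonneg_right ?_ hx
  refine ((dirVolterra hu).sol_bound zero_le_one (dir_source_bound u) hk x).trans ?_
  rw [mul_one, potBound]
  exact mul_le_mul_of_nonneg_left (fwdE_le (momentDensity_nonneg u) hu.integrable_moment hx)
    zero_le_two

theorem dirN_isForward (hu : LinePotential u) {k : ℂ} (hk : k ∈ upper) :
    IsForward u k 0 1 (dirN u k) := by
  intro x hx
  rcases hx.eq_or_lt with rfl | hx0
  · simp [dirN]
  have h := (dirVolterra hu).sol_eq zero_le_one (dir_source_bound u)
    (fun k _ => measurable_dirSource k) hk x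
  rw [fwdKer_integral hx] at h
  have hxc : (x : ℂ) ≠ 0 := by exact_mod_cast hx0.ne'
  rw [dirN, h, dirSource, if_pos hx0, mul_add, mul_div_cancel₀ _ hxc, zero_add, one_mul,
    sub_eq_add_neg, ← intervalIntegral.integral_neg, ← intervalIntegral.integral_const_mul]
  congr 1
  refine intervalIntegral.integral_congr fun ξ _ => ?_
  simp only [dirKer, dirN]
  push_cast
  field_simp

theorem continuousOn_dirN (hu : LinePotential u) {k : ℂ} (hk : k ∈ upper) :
    ContinuousOn (dirN u k) (Ici 0) := by
  refine (dirN_isForward hu hk).continuousOn hu hk (measurable_dirN hu hk).aestronglyMeasurable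
    (B := potBound u) fun x hx => (norm_dirN_le hu hk hx.le).trans ?_
  refine mul_le_mul_of_nonneg_left ?_ (potBound_pos u).le
  linarith [le_abs_self x]

theorem continuousOn_dirN_left (hu : LinePotential u) (x : ℝ) :
    ContinuousOn (fun k => dirN u k x) upper := by
  refine continuousOn_const.mul ((dirVolterra hu).sol_continuousOn zero_le_one
    (dir_source_bound u) (fun k _ => measurable_dirSource k) ?_ ?_ x)
  · intro x ξ
    unfold fwdKer dirKer
    split_ifs
    · have := continuous_kerD_left (x - ξ)
      fun_prop
    · exact continuousOn_const
  · intro x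
    unfold dirSource
    split_ifs
    · exact ((continuous_kerD_left x).div_const _).continuousOn
    · exact continuousOn_const

theorem differentiableOn_dirN_left (hu : LinePotential u) (x : ℝ) :
    DifferentiableOn ℂ (fun k => dirN u k x) upperO := by
  refine (differentiableOn_const _).mul ((dirVolterra hu).sol_differentiableOn zero_le_one
    (dir_source_bound u) (fun k _ => measurable_dirSource k) isOpen_upperO upperO_subset ?_ ?_ x)
  · intro x ξ
    unfold fwdKer dirKer
    split_ifs
    · exact ((differentiableOn_kerD (x - ξ)).neg.mul_const _).mul_const _
    · exact differentiableOn_const _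
  · intro x
    unfold dirSource
    split_ifs
    · exact (differentiableOn_kerD x).div_const _
    · exact differentiableOn_const _

/-- A bound of `|k n|` and of `|n'|`. -/
noncomputable def dirBound (u : ℝ → ℝ) : ℝ := 1 + potBound u * ∫ x, momentDensity u x

theorem one_le_dirBound (u : ℝ → ℝ) : 1 ≤ dirBound u := by
  have h1 := (potBound_pos u).le
  have h2 : 0 ≤ ∫ x, momentDensity u x := integral_nonneg (momentDensity_nonneg u)
  have := mul_nonneg h1 h2
  rw [dirBound]; linarith

theorem norm_u_mul_dirN_le (hu : LinePotential u) {k : ℂ} (hk : k ∈ upper) {x : ℝ} (hx : 0 ≤ x) :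
    ‖(u x : ℂ) * dirN u k x‖ ≤ potBound u * momentDensity u x := by
  rw [norm_mul, Complex.norm_real, Real.norm_eq_abs, momentDensity, abs_of_nonneg hx]
  have := mul_le_mul_of_nonneg_left (norm_dirN_le hu hk hx) (abs_nonneg (u x))
  linarith

theorem norm_integral_dirN_le (hu : LinePotential u) {k : ℂ} (hk : k ∈ upper) {x : ℝ}
    (hx : 0 ≤ x) {e : ℝ → ℂ} (he : ∀ ξ ∈ Ioc 0 x, ‖e ξ‖ ≤ 1) :
    ‖∫ ξ in (0 : ℝ)..x, e ξ * ((u ξ : ℂ) * dirN u k ξ)‖ ≤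
      potBound u * ∫ x, momentDensity u x := by
  rw [intervalIntegral.integral_of_le hx, ← integral_const_mul]
  refine (norm_integral_le_of_norm_le ((hu.integrable_moment.const_mul (potBound u)).integrableOn
    (s := Ioc 0 x)) ?_).trans (setIntegral_le_integral (hu.integrable_moment.const_mul _)
      (Filter.Eventually.of_forall fun ξ =>
        mul_nonneg (potBound_pos u).le (momentDensity_nonneg u ξ)))
  refine (ae_restrict_iff' measurableSet_Ioc).2 (Filter.Eventually.of_forall fun ξ hξ => ?_)
  rw [norm_mul]
  calc ‖e ξ‖ * ‖(u ξ : ℂ) * dirN u k ξ‖ ≤ 1 * (potBound u * momentDensity u ξ) :=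
        mul_le_mul (he ξ hξ) (norm_u_mul_dirN_le hu hk hξ.1.le) (norm_nonneg _) zero_le_one
    _ = _ := one_mul _

/-- Multiplying the equation by `k` replaces `D` by a kernel of norm at most `1`, while `|u n|` is
dominated by the first moment density through the linear bound of `n`. So `k n` is bounded uniformly
in `x` and `k`. -/
theorem norm_mul_dirN_le (hu : LinePotential u) {k : ℂ} (hk : k ∈ upper) {x : ℝ} (hx : 0 ≤ x) :
    ‖k‖ * ‖dirN u k x‖ ≤ dirBound u := by
  rw [← norm_mul, dirN_isForward hu hk x hx, zero_add, one_mul, mul_sub,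
    ← intervalIntegral.integral_const_mul, dirBound]
  refine (norm_sub_le _ _).trans (add_le_add ?_ ?_)
  · rw [norm_mul]; exact norm_mul_kerD_le hk hx
  · simp only [← mul_assoc k]
    refine norm_integral_dirN_le hu hk hx fun ξ hξ => ?_
    rw [norm_mul]
    exact norm_mul_kerD_le hk (sub_nonneg.2 hξ.2)

/-- `n_x(x, k)`. -/
noncomputable def dirDN (u : ℝ → ℝ) (k : ℂ) (x : ℝ) : ℂ := forwardDN u k 1 (dirN u k) x

theorem dirDN_eq (u : ℝ → ℝ) (k : ℂ) (x : ℝ) :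
    dirDN u k x = Complex.exp (2 * Complex.I * k * x) -
      ∫ ξ in (0 : ℝ)..x, Complex.exp (2 * Complex.I * k * (x - ξ : ℝ)) *
        ((u ξ : ℂ) * dirN u k ξ) := by
  rw [dirDN, forwardDN, mul_sub, mul_one, ← intervalIntegral.integral_const_mul]
  congr 1
  refine intervalIntegral.integral_congr fun ξ _ => ?_
  rw [← mul_assoc, ← Complex.exp_add]
  congr 2
  push_cast
  ring

theorem norm_dirDN_le (hu : LinePotential u) {k : ℂ} (hk : k ∈ upper) {x : ℝ} (hx : 0 ≤ x) :
    ‖dirDN u k x‖ ≤ dirBound u := by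
  rw [dirDN_eq, dirBound]
  refine (norm_sub_le _ _).trans (add_le_add (norm_exp_two_le hk hx) ?_)
  exact norm_integral_dirN_le hu hk hx fun ξ hξ => norm_exp_two_le hk (sub_nonneg.2 hξ.2)

/-- The solution `s(x, k)` with `s(0) = 0`, `s'(0) = 1`. -/
noncomputable def dirS (u : ℝ → ℝ) (k : ℂ) (x : ℝ) : ℂ :=
  Complex.exp (-(Complex.I * k) * x) * dirN u k x

/-- The derivative `s_x(x, k)`. -/
noncomputable def dirDS (u : ℝ → ℝ) (k : ℂ) (x : ℝ) : ℂ :=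
  Complex.exp (-(Complex.I * k) * x) * (-(Complex.I * k) * dirN u k x + dirDN u k x)

theorem dirS_isODE (hu : LinePotential u) {k : ℂ} (hk : k ∈ upper) :
    IsODE u k (dirS u k) (dirDS u k) :=
  (dirN_isForward hu hk).isODE hu.continuous (continuousOn_dirN hu hk)

theorem dirS_zero (u : ℝ → ℝ) (k : ℂ) : dirS u k 0 = 0 := by simp [dirS, dirN]

theorem dirDS_zero (u : ℝ → ℝ) (k : ℂ) : dirDS u k 0 = 1 := by
  simp [dirDS, dirN, dirDN, IsForward.forwardDN_zero]

end QuarterPlane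

namespace QuarterPlane

variable {u : ℝ → ℝ}

/-! ### Identification of the eigenfunctions -/

/-- The bridge between the equations with `sin(k(x - ξ))/k` that define `ψ`, `φ` and their
regularized forms, which stay meaningful at `k = 0`. -/
theorem kerD_eq_sin {k : ℂ} (hk : k ≠ 0) (t : ℝ) :
    kerD k t = 1 / k * Complex.sin (k * t) * Complex.exp (Complex.I * k * t) := by
  have h1 := exp_eq_kerD k t
  have h2 : Complex.exp (2 * Complex.I * k * t) =
      Complex.exp (Complex.I * k * t) * Complex.exp (Complex.I * k * t) := by
    rw [← Complex.exp_add]; ring_nf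
  have h3 : Complex.exp (-(Complex.I * k * t)) * Complex.exp (Complex.I * k * t) = 1 := by
    rw [← Complex.exp_add]; simp
  have h4 : Complex.sin (k * t) =
      (Complex.exp (-(Complex.I * k * t)) - Complex.exp (Complex.I * k * t)) * Complex.I / 2 := by
    rw [Complex.sin]; ring_nf
  have hkk : 2 * Complex.I * k ≠ 0 := by simp [hk]
  apply mul_left_cancel₀ hkk
  rw [h2] at h1
  rw [h4]
  generalize Complex.exp (Complex.I * k * t) = e at *
  generalize Complex.exp (-(Complex.I * k * t)) = e' at *
  have h5 : 2 * Complex.I * k * (1 / k * ((e' - e) * Complex.I / 2) * e) =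
      Complex.I ^ 2 * (e' * e - e * e) := by
    field_simp
  rw [h5]
  linear_combination (-1 : ℂ) * h1 - (Complex.I ^ 2) * h3 + (e * e - 1) * Complex.I_sq

theorem norm_exp_I_mul_le {k : ℂ} (hk : k ∈ upper) {x : ℝ} (hx : 0 ≤ x) :
    ‖Complex.exp (Complex.I * k * x)‖ ≤ 1 := by
  rw [Complex.norm_exp, Real.exp_le_one_iff]
  have : 0 ≤ k.im := hk
  simp
  positivity

theorem jost_isJost (hu : LinePotential u) {k : ℂ} (hk : k ∈ upper) (hk0 : k ≠ 0) :
    IsJost u k (fun x => Complex.exp (Complex.I * k * x) * jostM u k x) := by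
  refine ⟨(jost_isODE hu hk).continuousOn, ⟨potBound u, fun x _ => ?_⟩, fun x hx => ?_⟩
  · rw [← mul_assoc, ← Complex.exp_add]
    simpa using norm_jostM_le hu hk x
  · rw [jostM_eq hu hk hx, mul_sub, mul_one, sub_eq_add_neg, ← integral_const_mul,
      ← integral_const_mul, ← integral_neg]
    congr 2
    funext ξ
    rw [kerD_eq_sin hk0]
    have h1 : Complex.sin (k * ((ξ - x : ℝ) : ℂ)) = -Complex.sin (k * ((x : ℂ) - ξ)) := by
      rw [← Complex.sin_neg]; push_cast; ring_nf
    have h2 : Complex.exp (Complex.I * k * ξ) =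
        Complex.exp (Complex.I * k * x) * Complex.exp (Complex.I * k * ((ξ - x : ℝ) : ℂ)) := by
      rw [← Complex.exp_add]; push_cast; ring_nf
    rw [h1, h2]
    ring

/-- Removing the factor `e^{ikx}` turns the defining equation into that of `m`, and the boundedness
clause is exactly the class in which `m` is unique. This identifies the function chosen by
`Classical.epsilon`. -/
theorem isJost_unique (hu : LinePotential u) {k : ℂ} (hk : k ∈ upper) (hk0 : k ≠ 0)
    {ψ : ℝ → ℂ} (h : IsJost u k ψ) {x : ℝ} (hx : 0 ≤ x) :
    ψ x = Complex.exp (Complex.I * k * x) * jostM u k x := by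
  obtain ⟨C, hC⟩ := h.bounded
  have hc : ContinuousOn (fun x : ℝ => Complex.exp (-(Complex.I * k * x)) * ψ x) (Ici 0) :=
    ContinuousOn.mul (by fun_prop) h.continuousOn
  have key := jostM_unique hu hk (d := fun x : ℝ => Complex.exp (-(Complex.I * k * x)) * ψ x)
    (C := C) ((hc.mono Ioi_subset_Ici_self).aestronglyMeasurable measurableSet_Ioi)
    (fun x hx => hC x hx) ?_ hx
  · rw [← key, ← mul_assoc, ← Complex.exp_add]
    simp
  · intro x hx
    rw [h.equation x hx, mul_add, ← Complex.exp_add, neg_add_cancel, Complex.exp_zero,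
      sub_eq_add_neg, ← integral_const_mul, ← integral_const_mul, ← integral_neg]
    congr 2
    funext ξ
    rw [kerD_eq_sin hk0]
    have h1 : Complex.sin (k * ((ξ - x : ℝ) : ℂ)) = -Complex.sin (k * ((x : ℂ) - ξ)) := by
      rw [← Complex.sin_neg]; push_cast; ring_nf
    have h2 : Complex.exp (-(Complex.I * k * x)) =
        Complex.exp (Complex.I * k * ((ξ - x : ℝ) : ℂ)) * Complex.exp (-(Complex.I * k * ξ)) := by
      rw [← Complex.exp_add]; push_cast; ring_nf
    rw [h1, h2]
    ring

theorem psi_isJost (hu : LinePotential u) {k : ℂ} (hk : k ∈ upper) (hk0 : k ≠ 0) :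
    IsJost u k (fun x => psi u x k) :=
  Classical.epsilon_spec (p := IsJost u k) ⟨_, jost_isJost hu hk hk0⟩

theorem psi_eq (hu : LinePotential u) {k : ℂ} (hk : k ∈ upper) (hk0 : k ≠ 0) {x : ℝ}
    (hx : 0 ≤ x) : psi u x k = Complex.exp (Complex.I * k * x) * jostM u k x :=
  isJost_unique hu hk hk0 (psi_isJost hu hk hk0) hx

theorem psi_zero (hu : LinePotential u) {k : ℂ} (hk : k ∈ upper) (hk0 : k ≠ 0) :
    psi u 0 k = jostM u k 0 := by
  rw [psi_eq hu hk hk0 le_rfl]; simp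

theorem psiX_eq (hu : LinePotential u) {k : ℂ} (hk : k ∈ upper) (hk0 : k ≠ 0) :
    psiX u k = Complex.I * k * jostM u k 0 + jostDM u k 0 := by
  have h := (jost_isODE hu hk).derivWithin_zero
  have hc : EqOn (fun x => psi u x k) (fun x => Complex.exp (Complex.I * k * x) * jostM u k x)
      (Ici 0) := fun x hx => psi_eq hu hk hk0 hx
  rw [psiX, derivWithin_congr hc (hc self_mem_Ici), h]
  simp

theorem IsRegular.isForward {k : ℂ} (hk0 : k ≠ 0) {φ : ℝ → ℂ} (h : IsRegular u k φ) :
    IsForward u k 1 0 (fun x => Complex.exp (Complex.I * k * x) * φ x) := by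
  intro x hx
  beta_reduce
  rw [h.equation x hx, mul_sub, ← Complex.exp_add, add_neg_cancel, Complex.exp_zero, zero_mul,
    add_zero, ← intervalIntegral.integral_const_mul, ← intervalIntegral.integral_const_mul]
  congr 1
  refine intervalIntegral.integral_congr fun ξ _ => ?_
  simp only [kerD_eq_sin hk0]
  have h2 : Complex.exp (Complex.I * k * x) =
      Complex.exp (Complex.I * k * ((x - ξ : ℝ) : ℂ)) * Complex.exp (Complex.I * k * ξ) := by
    rw [← Complex.exp_add]; push_cast; ring_nf
  rw [h2]
  push_cast
  ring

theorem IsRegular.exists_isODE (hu : Continuous u) {k : ℂ} (hk0 : k ≠ 0) {φ : ℝ → ℂ}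
    (h : IsRegular u k φ) : ∃ φ', IsODE u k φ φ' ∧ φ 0 = 1 ∧ φ' 0 = -(Complex.I * k) := by
  have hf := h.isForward hk0
  have hc : ContinuousOn (fun x : ℝ => Complex.exp (Complex.I * k * x) * φ x) (Ici 0) :=
    ContinuousOn.mul (by fun_prop) h.continuousOn
  have ho := hf.isODE hu hc
  have heq : (fun x : ℝ => Complex.exp (-(Complex.I * k) * x) *
      (Complex.exp (Complex.I * k * x) * φ x)) = φ := by
    funext x
    rw [← mul_assoc, ← Complex.exp_add]
    simp
  rw [heq] at ho
  have h0 : φ 0 = 1 := by simpa using hf.apply_zero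
  refine ⟨_, ho, h0, ?_⟩
  simp [IsForward.forwardDN_zero, h0]

/-- Variation of constants: the `y`-derivative of `sin(k(x - y)) v' + k cos(k(x - y)) v` is minus
the integrand, and its values at `y = 0` and `y = x` give the free solution and `k v(x)`. -/
theorem isRegular_of_isODE (hu : Continuous u) {k : ℂ} (hk0 : k ≠ 0) {v v' : ℝ → ℂ}
    (h : IsODE u k v v') (h0 : v 0 = 1) (h1 : v' 0 = -(Complex.I * k)) : IsRegular u k v := by
  refine ⟨h.continuousOn, fun x hx => ?_⟩
  have hlin : ∀ y : ℝ, HasDerivAt (fun y : ℝ => k * ((x : ℂ) - y)) (-k) y := by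
    intro y
    exact (((Complex.ofRealCLM.hasDerivAt (x := y)).const_sub (x : ℂ)).const_mul k).congr_deriv
      (by simp)
  have hI : Icc 0 x ⊆ Ici 0 := fun y hy => hy.1
  have key := intervalIntegral.integral_eq_sub_of_hasDerivAt_of_le hx
    (f := fun y : ℝ => Complex.sin (k * ((x : ℂ) - y)) * v' y
      + k * (Complex.cos (k * ((x : ℂ) - y)) * v y))
    (f' := fun y : ℝ => -(Complex.sin (k * ((x : ℂ) - y)) * (u y : ℂ) * v y)) ?_ ?_ ?_
  · rw [intervalIntegral.integral_neg] at key
    simp only [sub_self, mul_zero, Complex.sin_zero, Complex.cos_zero, zero_mul, zero_add,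
      Complex.ofReal_zero, sub_zero, h0, h1] at key
    have h3 : Complex.exp (-(Complex.I * k * x)) =
        Complex.cos (k * x) - Complex.sin (k * x) * Complex.I := by
      have h5 := Complex.exp_mul_I (-(k * x))
      rw [Complex.cos_neg, Complex.sin_neg] at h5
      rw [show -(Complex.I * k * x) = -(k * x) * Complex.I by ring, h5]
      ring
    rw [h3]
    field_simp
    linear_combination -key
  · refine ContinuousOn.add (ContinuousOn.mul (by fun_prop) (h.continuousOn'.mono hI))
      (continuousOn_const.mul (ContinuousOn.mul (by fun_prop) (h.continuousOn.mono hI)))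
  · intro y hy
    have hs : HasDerivAt (fun y : ℝ => Complex.sin (k * ((x : ℂ) - y)))
        (Complex.cos (k * ((x : ℂ) - y)) * -k) y :=
      (Complex.hasDerivAt_sin _).comp y (hlin y)
    have hc : HasDerivAt (fun y : ℝ => Complex.cos (k * ((x : ℂ) - y)))
        (-Complex.sin (k * ((x : ℂ) - y)) * -k) y :=
      (Complex.hasDerivAt_cos _).comp y (hlin y)
    refine ((hs.mul (h.hasDerivAt' hy.1)).add
      ((hc.mul (h.hasDerivAt hy.1)).const_mul k)).congr_deriv ?_
    ring
  · refine ContinuousOn.intervalIntegrable_of_Icc hx ?_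
    have hc : Continuous (fun y : ℝ => Complex.sin (k * ((x : ℂ) - y)) * (u y : ℂ)) := by fun_prop
    exact (hc.continuousOn.mul (h.continuousOn.mono hI)).neg

/-- Only existence at one fixed `k ≠ 0` is needed, so the crude majorant `|u|/|k|` suffices and no
uniformity in `k` is sought. -/
theorem exists_forward_solution (hu : LinePotential u) {k : ℂ} (hk : k ∈ upper) (hk0 : k ≠ 0) :
    ∃ n : ℝ → ℂ, ContinuousOn n (Ici 0) ∧ IsForward u k 1 0 n := by
  have hkn : 0 < ‖k‖ := norm_pos_iff.2 hk0
  set w : ℝ → ℝ := fun ξ => ‖k‖⁻¹ * |u ξ| with hw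
  have hw0 : ∀ x, 0 ≤ w x := fun x => by positivity
  have hwi : Integrable w := hu.integrable_abs.const_mul _
  have hV : VolterraBound {k} (fwdKer fun k x ξ => -kerD k (x - ξ) * (u ξ : ℂ)) (fwdW w)
      (fwdE w) := by
    refine forwardVolterra (continuous_const.mul hu.continuous.abs) ?_ ?_
    · intro k _
      have h1 := continuous_kerD_right k
      have h2 := hu.continuous
      unfold Function.uncurry
      exact (by fun_prop : Continuous fun p : ℝ × ℝ =>
        -kerD k (p.1 - p.2) * (u p.2 : ℂ)).measurable
    · rintro k' rfl x ξ _ h1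
      rw [norm_mul, norm_neg, Complex.norm_real, Real.norm_eq_abs]
      refine mul_le_mul_of_nonneg_right ?_ (abs_nonneg _)
      have := norm_mul_kerD_le hk (sub_nonneg.2 h1)
      rw [inv_eq_one_div, le_div_iff₀ hkn]
      linarith
  -- The source is cut off at `x < 0`, where the forward weight need not be at least `1`.
  set h : ℂ → ℝ → ℂ := fun _ x => if 0 ≤ x then 1 else 0 with hh
  have hhb : ∀ k' ∈ ({k} : Set ℂ), ∀ x, ‖h k' x‖ ≤ 1 * fwdE w x := by
    intro k' _ x
    rw [one_mul, hh]
    simp only []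
    split_ifs with hx
    · rw [norm_one]; exact one_le_fwdE hw0 hx
    · rw [norm_zero]; exact (Real.exp_pos _).le
  have hhm : ∀ k' ∈ ({k} : Set ℂ), Measurable (h k') := fun k' _ =>
    Measurable.ite measurableSet_Ici measurable_const measurable_const
  have hfw : IsForward u k 1 0 (volterraSol (fwdKer fun k x ξ => -kerD k (x - ξ) * (u ξ : ℂ)) h k) := by
    intro x hx
    rw [hV.sol_eq zero_le_one hhb hhm rfl x, fwdKer_integral hx, zero_mul, add_zero,
      sub_eq_add_neg, ← intervalIntegral.integral_neg]
    congr 1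
    · simp [hh, hx]
    · refine intervalIntegral.integral_congr fun ξ _ => ?_
      ring
  refine ⟨_, hfw.continuousOn hu hk (hV.sol_measurable zero_le_one hhb hhm
    rfl).aestronglyMeasurable (B := 2 * Real.exp (2 * ∫ t, w t)) fun x hx => ?_, hfw⟩
  refine (hV.sol_bound zero_le_one hhb rfl x).trans ?_
  rw [mul_one]
  have h1 := fwdE_le hw0 hwi hx.le
  have h2 := abs_nonneg x
  have h3 := Real.exp_pos (2 * ∫ t, w t)
  nlinarith

theorem exists_isODE_regular (hu : LinePotential u) {k : ℂ} (hk0 : k ≠ 0) :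
    ∃ v v', IsODE u k v v' ∧ v 0 = 1 ∧ v' 0 = -(Complex.I * k) := by
  have hup : ∀ {k : ℂ}, k ∈ upper → k ≠ 0 →
      ∃ v v', IsODE u k v v' ∧ v 0 = 1 ∧ v' 0 = -(Complex.I * k) := by
    intro k hk hk0
    obtain ⟨n, hc, hn⟩ := exists_forward_solution hu hk hk0
    refine ⟨_, _, hn.isODE hu.continuous hc, ?_, ?_⟩
    · simp [hn.apply_zero]
    · simp [hn.apply_zero, IsForward.forwardDN_zero]
  by_cases hk : k ∈ upper
  · exact hup hk hk0
  · have hk' : -k ∈ upper := by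
      simp only [upper, mem_ofPred_eq, not_le, Complex.neg_im] at hk ⊢
      linarith
    obtain ⟨v, v', h, h0, h1⟩ := hup hk' (neg_ne_zero.2 hk0)
    -- For `k` in the lower half plane, the solution built at `-k` solves the same equation, which
    -- contains only `k²`, but has slope `ik` at `0`. Adding `-2ik s` corrects the slope and keeps
    -- the value.
    refine ⟨_, _, (h.combine (dirS_isODE hu hk') 1 (-(2 * Complex.I * k))).of_sq_eq (by ring),
      ?_, ?_⟩
    · simp [h0, dirS_zero]
    · simp only [h1, dirDS_zero]
      ring

theorem phi_isRegular (hu : LinePotential u) {k : ℂ} (hk0 : k ≠ 0) :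
    IsRegular u k (fun x => phi u x k) := by
  obtain ⟨v, v', h, h0, h1⟩ := exists_isODE_regular hu hk0
  exact Classical.epsilon_spec (p := IsRegular u k)
    ⟨_, isRegular_of_isODE hu.continuous hk0 h h0 h1⟩

theorem phi_eq_of_isODE (hu : LinePotential u) {k : ℂ} (hk0 : k ≠ 0) {v v' : ℝ → ℂ}
    (h : IsODE u k v v') (h0 : v 0 = 1) (h1 : v' 0 = -(Complex.I * k)) {x : ℝ} (hx : 0 ≤ x) :
    phi u x k = v x := by
  obtain ⟨φ', hφ, hφ0, hφ1⟩ := (phi_isRegular hu hk0).exists_isODE hu.continuous hk0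
  exact (hφ.eq_of_initial hu.continuous h (hφ0.trans h0.symm) (hφ1.trans h1.symm) hx).1

theorem phi_zero (hu : LinePotential u) {k : ℂ} (hk0 : k ≠ 0) : phi u 0 k = 1 := by
  obtain ⟨φ', _, hφ0, _⟩ := (phi_isRegular hu hk0).exists_isODE hu.continuous hk0
  exact hφ0

theorem phiX_eq (hu : LinePotential u) {k : ℂ} (hk0 : k ≠ 0) : phiX u k = -(Complex.I * k) := by
  obtain ⟨φ', hφ, _, hφ1⟩ := (phi_isRegular hu hk0).exists_isODE hu.continuous hk0
  rw [phiX, hφ.derivWithin_zero, hφ1]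

theorem aCoef_mul (hu : LinePotential u) {k : ℂ} (hk : k ∈ upper) (hk0 : k ≠ 0) :
    2 * Complex.I * k * aCoef u k = 2 * Complex.I * k * jostM u k 0 + jostDM u k 0 := by
  have : 2 * Complex.I * k ≠ 0 := by simp [hk0]
  rw [aCoef, mul_div_cancel₀ _ this, phi_zero hu hk0, phiX_eq hu hk0, psi_zero hu hk hk0,
    psiX_eq hu hk hk0]
  ring

/-- `φ - (φ(0)/ψ(0)) ψ` is a multiple of `s`. -/
theorem phi_eq (hu : LinePotential u) {k : ℂ} (hk : k ∈ upper) (hk0 : k ≠ 0)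
    (hm : jostM u k 0 ≠ 0) {x : ℝ} (hx : 0 ≤ x) :
    phi u x k = psi u x k / jostM u k 0
      - 2 * Complex.I * k * aCoef u k / jostM u k 0 * dirS u k x := by
  have h := (jost_isODE hu hk).combine (dirS_isODE hu hk) (1 / jostM u k 0)
    (-(2 * Complex.I * k * aCoef u k / jostM u k 0))
  rw [phi_eq_of_isODE hu hk0 h ?_ ?_ hx, psi_eq hu hk hk0 hx]
  · ring
  · simp [dirS_zero, hm]
  · rw [dirDS_zero, aCoef_mul hu hk hk0]
    simp only [Complex.ofReal_zero, mul_zero, Complex.exp_zero, one_mul, mul_one]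
    field_simp
    ring

/-! ### Reduction to potentials on the line -/

theorem isJost_congr {u₁ : ℝ → ℝ} (h : ∀ x, 0 ≤ x → u x = u₁ x) (k : ℂ) :
    IsJost u k = IsJost u₁ k := by
  have key : ∀ {u u₁ : ℝ → ℝ}, (∀ x, 0 ≤ x → u x = u₁ x) → ∀ ψ, IsJost u k ψ → IsJost u₁ k ψ := by
    intro u u₁ h ψ hψ
    refine ⟨hψ.continuousOn, hψ.bounded, fun x hx => ?_⟩
    rw [hψ.equation x hx]
    congr 2
    refine setIntegral_congr_fun measurableSet_Ioi fun ξ hξ => ?_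
    simp only [h ξ (hx.trans (le_of_lt hξ))]
  funext ψ
  exact propext ⟨key h ψ, key (fun x hx => (h x hx).symm) ψ⟩

theorem isRegular_congr {u₁ : ℝ → ℝ} (h : ∀ x, 0 ≤ x → u x = u₁ x) (k : ℂ) :
    IsRegular u k = IsRegular u₁ k := by
  have key : ∀ {u u₁ : ℝ → ℝ}, (∀ x, 0 ≤ x → u x = u₁ x) →
      ∀ φ, IsRegular u k φ → IsRegular u₁ k φ := by
    intro u u₁ h φ hφ
    refine ⟨hφ.continuousOn, fun x hx => ?_⟩
    rw [hφ.equation x hx]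
    congr 2
    refine intervalIntegral.integral_congr fun ξ hξ => ?_
    rw [uIcc_of_le hx] at hξ
    simp only [h ξ hξ.1]
  funext φ
  exact propext ⟨key h φ, key (fun x hx => (h x hx).symm) φ⟩

theorem psi_congr {u₁ : ℝ → ℝ} (h : ∀ x, 0 ≤ x → u x = u₁ x) : psi u = psi u₁ := by
  funext x k
  rw [psi, psi, isJost_congr h]

theorem phi_congr {u₁ : ℝ → ℝ} (h : ∀ x, 0 ≤ x → u x = u₁ x) : phi u = phi u₁ := by
  funext x k
  rw [phi, phi, isRegular_congr h]

/-- The even extension is continuous on the line, and `1 + |x| ≤ 2(1 + x²)` supplies the first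
moment. Nothing is lost: `ψ` and `φ` see the potential only on `[0, ∞)`. -/
theorem IsPotential.linePotential_abs (hu : IsPotential u) : LinePotential fun x => u |x| := by
  refine ⟨hu.continuousOn.comp_continuous continuous_abs fun x => abs_nonneg x, ?_⟩
  have hc : Continuous fun x => u |x| :=
    hu.continuousOn.comp_continuous continuous_abs fun x => abs_nonneg x
  have h0 : IntegrableOn (fun x : ℝ => (1 + |x| ^ 2) * abs (u |x|)) (Ioi 0) :=
    hu.integrable.congr_fun (fun x hx => by
      simp only [abs_of_pos (show (0 : ℝ) < x from hx)]) measurableSet_Ioi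
  have h1 : Integrable fun x : ℝ => (1 + |x| ^ 2) * abs (u |x|) := by
    rw [← integrableOn_univ, ← Iic_union_Ioi (a := (0 : ℝ))]
    refine IntegrableOn.union ?_ h0
    have h2 := (Measure.measurePreserving_neg (volume : Measure ℝ)).integrableOn_comp_preimage
      (Homeomorph.neg ℝ).measurableEmbedding (f := fun x : ℝ => (1 + |x| ^ 2) * abs (u |x|))
      (s := Ici 0)
    have h3 := h2.2 ((integrableOn_Ici_iff_integrableOn_Ioi).2 h0)
    have h4 : (Neg.neg ⁻¹' Ici (0 : ℝ)) = Iic 0 := by ext; simp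
    rw [h4] at h3
    exact h3.congr_fun (fun x _ => by simp) measurableSet_Iic
  refine (h1.const_mul 2).mono' ((by fun_prop : Continuous fun x : ℝ => 1 + |x|).mul
    hc.abs).aestronglyMeasurable (Filter.Eventually.of_forall fun x => ?_)
  have h2 := abs_nonneg (u |x|)
  have h3 := abs_nonneg x
  rw [Real.norm_of_nonneg (by positivity), ← mul_assoc]
  refine mul_le_mul_of_nonneg_right ?_ h2
  nlinarith [sq_nonneg (|x| - 1)]

end QuarterPlane

namespace QuarterPlane

open Filter Topology

variable {u : ℝ → ℝ}

/-! ### The Jost function `ψ(0, k)` has no zeros in the closed upper half plane -/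

/-- The `L¹` norm of the potential times the bound of `m`. -/
noncomputable def jostBound (u : ℝ → ℝ) : ℝ := potBound u * ∫ x, |u x|

theorem jostBound_nonneg (u : ℝ → ℝ) : 0 ≤ jostBound u :=
  mul_nonneg (potBound_pos u).le (integral_nonneg fun _ => abs_nonneg _)

theorem tail_le_jostBound (hu : LinePotential u) (x : ℝ) :
    potBound u * ∫ ξ in Ioi x, |u ξ| ≤ jostBound u :=
  mul_le_mul_of_nonneg_left (setIntegral_le_integral hu.integrable_abs
    (Eventually.of_forall fun _ => abs_nonneg _)) (potBound_pos u).le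

theorem norm_mul_jostM_sub_one_le' (hu : LinePotential u) {k : ℂ} (hk : k ∈ upper) {x : ℝ}
    (hx : 0 ≤ x) : ‖k‖ * ‖jostM u k x - 1‖ ≤ jostBound u :=
  (norm_mul_jostM_sub_one_le hu hk hx).trans (tail_le_jostBound hu x)

theorem norm_jostDM_le' (hu : LinePotential u) {k : ℂ} (hk : k ∈ upper) {x : ℝ}
    (hx : 0 ≤ x) : ‖jostDM u k x‖ ≤ 3 * jostBound u :=
  (norm_jostDM_le hu hk hx).trans (mul_le_mul_of_nonneg_left (tail_le_jostBound hu x) (by norm_num))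

theorem tendsto_jostM (hu : LinePotential u) {k : ℂ} (hk : k ∈ upper) :
    Tendsto (jostM u k) atTop (𝓝 1) := by
  have h := (tendsto_integral_Ioi_atTop hu.integrable_moment.integrableOn).const_mul (potBound u)
  rw [mul_zero] at h
  rw [tendsto_iff_norm_sub_tendsto_zero]
  refine squeeze_zero' (Eventually.of_forall fun x => norm_nonneg _) ?_ h
  filter_upwards [eventually_ge_atTop 0] with x hx using norm_jostM_sub_one_le hu hk hx

theorem tendsto_jostDM (hu : LinePotential u) {k : ℂ} (hk : k ∈ upper) :
    Tendsto (jostDM u k) atTop (𝓝 0) := by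
  have h := ((tendsto_integral_Ioi_atTop hu.integrable_abs.integrableOn).const_mul
    (potBound u)).const_mul 3
  rw [mul_zero, mul_zero] at h
  refine squeeze_zero_norm' ?_ h
  filter_upwards [eventually_ge_atTop 0] with x hx using norm_jostDM_le hu hk hx

theorem tendsto_exp_I_mul {k : ℂ} (hk : k ∈ upperO) :
    Tendsto (fun x : ℝ => Complex.exp (Complex.I * k * x)) atTop (𝓝 0) := by
  have hk' : 0 < k.im := hk
  rw [tendsto_zero_iff_norm_tendsto_zero]
  have : (fun x : ℝ => ‖Complex.exp (Complex.I * k * x)‖) = fun x => Real.exp (-(k.im * x)) := by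
    funext x
    rw [Complex.norm_exp]
    simp
  rw [this]
  exact Real.tendsto_exp_neg_atTop_nhds_zero.comp (tendsto_id.const_mul_atTop hk')

theorem conj_jostDM (hu : LinePotential u) {k : ℂ} (hk : k ∈ upper) {x : ℝ} (hx : 0 ≤ x) :
    conj (jostDM u k x) = jostDM u (-conj k) x := by
  rw [jostDM, jostDM, map_add, map_mul, map_sub, conj_jostM hu hk hx, jostN, jostN,
    ← integral_conj]
  congr 1
  · refine setIntegral_congr_fun measurableSet_Ioi fun ξ hξ => ?_
    simp only [map_mul, Complex.conj_ofReal, conj_jostM hu hk (hx.trans (le_of_lt hξ))]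
  · simp [Complex.conj_ofNat]

/-- The Wronskian of `s` and `ψ`. -/
theorem wronskian_dir_jost (hu : LinePotential u) {k : ℂ} (hk : k ∈ upper) {x : ℝ} (hx : 0 ≤ x) :
    dirN u k x * (2 * Complex.I * k * jostM u k x + jostDM u k x) - dirDN u k x * jostM u k x =
      -jostM u k 0 := by
  have h := (dirS_isODE hu hk).wronskian_eq (jost_isODE hu hk) hx
  rw [dirS_zero, dirDS_zero, dirS, dirDS] at h
  have he : Complex.exp (-(Complex.I * k) * x) * Complex.exp (Complex.I * k * x) = 1 := by
    rw [← Complex.exp_add]; simp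
  simp only [Complex.ofReal_zero, mul_zero, Complex.exp_zero, one_mul, zero_mul, zero_sub] at h
  generalize Complex.exp (-(Complex.I * k) * x) = e1 at *
  generalize Complex.exp (Complex.I * k * x) = e2 at *
  linear_combination h - (dirN u k x * (2 * Complex.I * k * jostM u k x + jostDM u k x)
    - dirDN u k x * jostM u k x) * he

/-- Vanishing Cauchy data at `0` would make the solution zero, whereas `m → 1` at infinity. -/
theorem jost_not_both_zero (hu : LinePotential u) {k : ℂ} (hk : k ∈ upper)
    (h0 : jostM u k 0 = 0) (h1 : jostDM u k 0 = 0) : False := by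
  have hz : IsODE u k (fun _ => 0) (fun _ => 0) :=
    ⟨fun x _ => hasDerivWithinAt_const _ _ _,
      fun x _ => (hasDerivWithinAt_const _ _ _).congr_deriv (by simp)⟩
  have hm : ∀ x, 0 ≤ x → jostM u k x = 0 := by
    intro x hx
    have := ((jost_isODE hu hk).eq_of_initial hu.continuous hz (by simp [h0])
      (by simp [h0, h1]) hx).1
    simpa using this
  have := tendsto_nhds_unique (tendsto_jostM hu hk) (tendsto_const_nhds.congr' (by
    filter_upwards [eventually_ge_atTop 0] with x hx using (hm x hx).symm))
  exact one_ne_zero this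

/-- For real `k`, `ψ` and its conjugate solve the same equation. Their constant Wronskian would
vanish at `x = 0`, but at infinity it tends to `-2ik ≠ 0`. -/
theorem jostM_zero_ne_of_real (hu : LinePotential u) {k : ℂ} (hk : k.im = 0) (hk0 : k ≠ 0) :
    jostM u k 0 ≠ 0 := by
  intro h0
  have hku : k ∈ upper := by rw [upper, mem_ofPred_eq, hk]
  have hkc : conj k = k := Complex.conj_eq_iff_im.2 hk
  have h := jost_isODE hu hku
  have hc := h.conjugate.of_sq_eq (k₁ := k) (by rw [hkc]; ring)
  have hW : ∀ x : ℝ, 0 ≤ x → jostM u k x * conj (Complex.I * k * jostM u k x + jostDM u k x)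
      - (Complex.I * k * jostM u k x + jostDM u k x) * conj (jostM u k x) = 0 := by
    intro x hx
    have hw := h.wronskian_eq hc hx
    have he : Complex.exp (Complex.I * k * x) * conj (Complex.exp (Complex.I * k * x)) = 1 := by
      rw [← Complex.exp_conj, ← Complex.exp_add]
      simp [hkc]
    simp only [map_mul, h0, map_zero, mul_zero, zero_mul, sub_zero] at hw
    linear_combination hw - (jostM u k x * conj (Complex.I * k * jostM u k x + jostDM u k x)
      - (Complex.I * k * jostM u k x + jostDM u k x) * conj (jostM u k x)) * he
  have hm := tendsto_jostM hu hku
  have hd := tendsto_jostDM hu hku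
  have h1 := (hm.const_mul (Complex.I * k)).add hd
  have hlim := (hm.mul ((Complex.continuous_conj.tendsto _).comp h1)).sub
    (h1.mul ((Complex.continuous_conj.tendsto _).comp hm))
  have := tendsto_nhds_unique hlim (tendsto_const_nhds.congr' (by
    filter_upwards [eventually_ge_atTop 0] with x hx using (hW x hx).symm))
  simp [hkc] at this
  apply hk0
  have h2 : Complex.I * k = 0 := by linear_combination (-1 / 2 : ℂ) * this
  simpa using h2

/-- The tail of the first moment controls `m - 1` independently of `k`, so one `X` serves all
spectral parameters. -/
theorem exists_half_lt_jostM (hu : LinePotential u) :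
    ∃ X : ℝ, 0 < X ∧ ∀ k ∈ upper, ∀ x, X ≤ x → ‖jostM u k x - 1‖ < 1 / 2 := by
  have h := (tendsto_integral_Ioi_atTop hu.integrable_moment.integrableOn).const_mul (potBound u)
  rw [mul_zero] at h
  obtain ⟨X, hX⟩ := eventually_atTop.1 (h.eventually (gt_mem_nhds (show (0 : ℝ) < 1 / 2 by norm_num)))
  refine ⟨max X 1, lt_max_of_lt_right one_pos, fun k hk x hx => ?_⟩
  exact (norm_jostM_sub_one_le hu hk (zero_le_one.trans ((le_max_right _ _).trans hx))).trans_lt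
    (hX x ((le_max_left _ _).trans hx))

/-- The Wronskian of two Jost solutions tends to zero if one of them decays. -/
theorem tendsto_wronskian {v v' w w' e₁ : ℝ → ℂ} {A B C D : ℝ}
    (h1 : ∀ x, 0 ≤ x → ‖v x‖ ≤ A) (h2 : ∀ x, 0 ≤ x → ‖v' x‖ ≤ B)
    (h3 : ∀ x, 0 ≤ x → ‖w x‖ ≤ C * ‖e₁ x‖) (h4 : ∀ x, 0 ≤ x → ‖w' x‖ ≤ D * ‖e₁ x‖)
    (he : Tendsto e₁ atTop (𝓝 0)) :
    Tendsto (fun x => v x * w' x - v' x * w x) atTop (𝓝 0) := by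
  have hl : Tendsto (fun x => (A * D + B * C) * ‖e₁ x‖) atTop (𝓝 0) := by
    have := (tendsto_zero_iff_norm_tendsto_zero.1 he).const_mul (A * D + B * C)
    rwa [mul_zero] at this
  refine squeeze_zero_norm' ?_ hl
  filter_upwards [eventually_ge_atTop 0] with x hx
  have hA : 0 ≤ A := (norm_nonneg _).trans (h1 x hx)
  have hB : 0 ≤ B := (norm_nonneg _).trans (h2 x hx)
  calc ‖v x * w' x - v' x * w x‖ ≤ ‖v x‖ * ‖w' x‖ + ‖v' x‖ * ‖w x‖ := by
        refine (norm_sub_le _ _).trans ?_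
        rw [norm_mul, norm_mul]
    _ ≤ A * (D * ‖e₁ x‖) + B * (C * ‖e₁ x‖) := by
        refine add_le_add ?_ ?_
        · exact mul_le_mul (h1 x hx) (h4 x hx) (norm_nonneg _) hA
        · exact mul_le_mul (h2 x hx) (h3 x hx) (norm_nonneg _) hB
    _ = _ := by ring

/-- A bound of `e^{-ikx} ψ_x`. -/
noncomputable def jostDBound (u : ℝ → ℝ) (k : ℂ) : ℝ := ‖k‖ * potBound u + 3 * jostBound u

theorem norm_jost_deriv_le (hu : LinePotential u) {k : ℂ} (hk : k ∈ upper) {x : ℝ} (hx : 0 ≤ x) :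
    ‖Complex.I * k * jostM u k x + jostDM u k x‖ ≤ jostDBound u k := by
  refine (norm_add_le _ _).trans (add_le_add ?_ (norm_jostDM_le' hu hk hx))
  rw [norm_mul, norm_mul, Complex.norm_I, one_mul]
  exact mul_le_mul_of_nonneg_left (norm_jostM_le hu hk x) (norm_nonneg _)

theorem norm_jost_le (hu : LinePotential u) {k : ℂ} (hk : k ∈ upper) {x : ℝ} (hx : 0 ≤ x) :
    ‖Complex.exp (Complex.I * k * x) * jostM u k x‖ ≤ potBound u := by
  rw [norm_mul]
  calc _ ≤ 1 * potBound u := mul_le_mul (norm_exp_I_mul_le hk hx) (norm_jostM_le hu hk x)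
        (norm_nonneg _) zero_le_one
    _ = _ := one_mul _

theorem norm_jostD_le (hu : LinePotential u) {k : ℂ} (hk : k ∈ upper) {x : ℝ} (hx : 0 ≤ x) :
    ‖Complex.exp (Complex.I * k * x) * (Complex.I * k * jostM u k x + jostDM u k x)‖ ≤
      jostDBound u k := by
  rw [norm_mul]
  calc _ ≤ 1 * jostDBound u k := mul_le_mul (norm_exp_I_mul_le hk hx)
        (norm_jost_deriv_le hu hk hx) (norm_nonneg _) zero_le_one
    _ = _ := one_mul _

theorem tendsto_wronskian_jost (hu : LinePotential u) {k k₁ : ℂ} (hk : k ∈ upper)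
    (hk₁ : k₁ ∈ upperO) : Tendsto (fun x : ℝ =>
      (Complex.exp (Complex.I * k * x) * jostM u k x) *
        (Complex.exp (Complex.I * k₁ * x) * (Complex.I * k₁ * jostM u k₁ x + jostDM u k₁ x)) -
      (Complex.exp (Complex.I * k * x) * (Complex.I * k * jostM u k x + jostDM u k x)) *
        (Complex.exp (Complex.I * k₁ * x) * jostM u k₁ x)) atTop (𝓝 0) := by
  refine tendsto_wronskian (e₁ := fun x : ℝ => Complex.exp (Complex.I * k₁ * x))
    (fun x hx => norm_jost_le hu hk hx) (fun x hx => norm_jostD_le hu hk hx)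
    (C := potBound u) (D := jostDBound u k₁) ?_ ?_ (tendsto_exp_I_mul hk₁)
  · intro x _
    rw [norm_mul, mul_comm]
    exact mul_le_mul_of_nonneg_right (norm_jostM_le hu (upperO_subset hk₁) x) (norm_nonneg _)
  · intro x hx
    rw [norm_mul, mul_comm]
    exact mul_le_mul_of_nonneg_right (norm_jost_deriv_le hu (upperO_subset hk₁) hx) (norm_nonneg _)

/-- Self-adjointness: a zero would make `ψ` an eigenfunction of the Dirichlet problem with the
non-real eigenvalue `k²`. The Wronskian with the conjugate vanishes at `0` and at infinity, forcing
`∫ |ψ|² = 0`, although `ψ(X) ≠ 0`. -/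
theorem jostM_zero_ne_of_re (hu : LinePotential u) {k : ℂ} (hk : k ∈ upperO) (hre : k.re ≠ 0) :
    jostM u k 0 ≠ 0 := by
  intro h0
  have hku := upperO_subset hk
  have hkc : -conj k ∈ upperO := by simpa [upperO] using hk
  obtain ⟨X, hX0, hX⟩ := exists_half_lt_jostM hu
  set ψ : ℝ → ℂ := fun x => Complex.exp (Complex.I * k * x) * jostM u k x with hψ
  have h := jost_isODE hu hku
  have hψc : ContinuousOn ψ (Ici 0) := h.continuousOn
  have hconj : ∀ x : ℝ, 0 ≤ x →
      Complex.exp (Complex.I * (-conj k) * x) * jostM u (-conj k) x = conj (ψ x) := by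
    intro x hx
    rw [hψ, ← conj_jostM hu hku hx, map_mul, ← Complex.exp_conj]
    simp
  have hc0 : jostM u (-conj k) 0 = 0 := by rw [← conj_jostM hu hku le_rfl, h0, map_zero]
  have hg := jost_isODE hu (upperO_subset hkc)
  have hlim : Tendsto (fun x : ℝ => (k ^ 2 - (-conj k) ^ 2) *
      ((∫ ξ in (0 : ℝ)..x, ‖ψ ξ‖ ^ 2 : ℝ) : ℂ)) atTop (𝓝 0) := by
    refine (tendsto_wronskian_jost hu hku hkc).congr' ?_
    filter_upwards [eventually_ge_atTop 0] with x hx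
    have := h.wronskian_sub hg le_rfl hx
    simp only [h0, hc0, mul_zero, zero_mul, sub_zero] at this
    refine this.trans ?_
    rw [← intervalIntegral.integral_ofReal]
    congr 1
    refine intervalIntegral.integral_congr fun ξ hξ => ?_
    rw [uIcc_of_le hx] at hξ
    rw [hconj ξ hξ.1]
    show ψ ξ * _ = _
    rw [Complex.mul_conj, Complex.normSq_eq_norm_sq]
  have hne : k ^ 2 - (-conj k) ^ 2 ≠ 0 := by
    have hk' : 0 < k.im := hk
    intro h
    have := congrArg Complex.im h
    simp [pow_two] at this
    have h3 : k.re * k.im = 0 := by linarith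
    rcases mul_eq_zero.1 h3 with h3 | h3
    · exact hre h3
    · exact hk'.ne' h3
  have hlim2 := hlim.const_mul (k ^ 2 - (-conj k) ^ 2)⁻¹
  simp only [inv_mul_cancel_left₀ hne, mul_zero] at hlim2
  have hlim3 : Tendsto (fun x => ∫ ξ in (0 : ℝ)..x, ‖ψ ξ‖ ^ 2) atTop (𝓝 0) := by
    have := (Complex.continuous_re.tendsto _).comp hlim2
    simpa [Function.comp_def] using this
  have hpos : 0 < ∫ ξ in (0 : ℝ)..X, ‖ψ ξ‖ ^ 2 := by
    refine intervalIntegral.integral_pos hX0 ((hψc.mono fun y hy => hy.1).norm.pow 2)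
      (fun x _ => by positivity) ⟨X, ⟨hX0.le, le_rfl⟩, ?_⟩
    have : ψ X ≠ 0 := by
      refine mul_ne_zero (Complex.exp_ne_zero _) fun hz => ?_
      have := hX k hku X le_rfl
      rw [hz] at this
      norm_num at this
    positivity
  have hge : ∀ x, X ≤ x → ∫ ξ in (0 : ℝ)..X, ‖ψ ξ‖ ^ 2 ≤ ∫ ξ in (0 : ℝ)..x, ‖ψ ξ‖ ^ 2 := by
    intro x hx
    refine intervalIntegral.integral_mono_interval le_rfl hX0.le hx
      (Eventually.of_forall fun _ => by positivity) ?_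
    exact ((hψc.mono fun y hy => hy.1).norm.pow 2).intervalIntegrable_of_Icc (hX0.le.trans hx)
  have := ge_of_tendsto hlim3 (by filter_upwards [eventually_ge_atTop X] with x hx using hge x hx)
  linarith

theorem neg_of_ne_zero {f : ℝ → ℝ} {a K : ℝ} (hf : ContinuousOn f (Ioi a))
    (hne : ∀ x, a < x → f x ≠ 0) (haK : a < K) (hK : f K < 0) {x : ℝ} (hx : a < x) : f x < 0 := by
  by_contra hc
  have hc : 0 ≤ f x := not_lt.1 hc
  have := isPreconnected_Ioi.intermediate_value (show K ∈ Ioi a from haK) (show x ∈ Ioi a from hx) hf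
    ⟨hK.le, hc⟩
  obtain ⟨y, hy, hy0⟩ := this
  exact hne y hy hy0

theorem I_mul_mem_upper {κ : ℝ} (hκ : 0 ≤ κ) : Complex.I * κ ∈ upper := by
  simpa [upper] using hκ

theorem neg_conj_I_mul (κ : ℝ) : -conj (Complex.I * κ) = Complex.I * κ := by simp

theorem jostM_I_mul (hu : LinePotential u) {κ : ℝ} (hκ : 0 ≤ κ) {x : ℝ} (hx : 0 ≤ x) :
    jostM u (Complex.I * κ) x = ((jostM u (Complex.I * κ) x).re : ℂ) := by
  have h := conj_jostM hu (I_mul_mem_upper hκ) hx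
  rw [neg_conj_I_mul] at h
  exact (Complex.conj_eq_iff_re.1 h).symm

theorem jostDM_I_mul (hu : LinePotential u) {κ : ℝ} (hκ : 0 ≤ κ) {x : ℝ} (hx : 0 ≤ x) :
    jostDM u (Complex.I * κ) x = ((jostDM u (Complex.I * κ) x).re : ℂ) := by
  have h := conj_jostDM hu (I_mul_mem_upper hκ) hx
  rw [neg_conj_I_mul] at h
  exact (Complex.conj_eq_iff_re.1 h).symm

theorem exp_I_mul_I (κ x : ℝ) :
    Complex.exp (Complex.I * (Complex.I * κ) * x) = (Real.exp (-(κ * x)) : ℂ) := by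
  rw [← mul_assoc, Complex.I_mul_I]
  push_cast
  ring_nf

/-- Under the hypothesis `a ≠ 0`, the Jost function does not vanish on the imaginary axis. -/
theorem jostM_zero_ne_of_imag (hu : LinePotential u)
    (ha : ∀ k ∈ upper, k ≠ 0 → aCoef u k ≠ 0) {κ : ℝ} (hκ : 0 ≤ κ) :
    jostM u (Complex.I * κ) 0 ≠ 0 := by
  intro hzero
  set b : ℝ → ℝ := fun κ => (jostM u (Complex.I * κ) 0).re with hb
  set d : ℝ → ℝ := fun κ => (jostDM u (Complex.I * κ) 0).re with hd
  have hbE : ∀ κ : ℝ, 0 ≤ κ → jostM u (Complex.I * κ) 0 = (b κ : ℂ) := fun κ h =>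
    jostM_I_mul hu h le_rfl
  have hdE : ∀ κ : ℝ, 0 ≤ κ → jostDM u (Complex.I * κ) 0 = (d κ : ℂ) := fun κ h =>
    jostDM_I_mul hu h le_rfl
  have hmap : MapsTo (fun κ : ℝ => Complex.I * (κ : ℂ)) (Ici 0) upper := fun κ h =>
    I_mul_mem_upper h
  have hbc : ContinuousOn b (Ici 0) := Complex.continuous_re.comp_continuousOn
    ((continuousOn_jostM_left hu 0).comp (by fun_prop) hmap)
  have hdc : ContinuousOn d (Ici 0) := Complex.continuous_re.comp_continuousOn
    ((continuousOn_jostDM_left hu le_rfl).comp (by fun_prop) hmap)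
  set B := jostBound u with hB
  have hB0 : 0 ≤ B := jostBound_nonneg u
  have hb1 : ∀ κ : ℝ, 0 ≤ κ → κ * |b κ - 1| ≤ B := by
    intro κ h
    have := norm_mul_jostM_sub_one_le' hu (I_mul_mem_upper h) le_rfl
    rw [hbE κ h, norm_mul, Complex.norm_I, one_mul, Complex.norm_real, Real.norm_of_nonneg h,
      ← Complex.ofReal_one, ← Complex.ofReal_sub, Complex.norm_real] at this
    exact this
  have hd1 : ∀ κ : ℝ, 0 ≤ κ → |d κ| ≤ 3 * B := by
    intro κ h
    have := norm_jostDM_le' hu (I_mul_mem_upper h) le_rfl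
    rwa [hdE κ h, Complex.norm_real] at this
  -- From `κ b ≥ κ - B` and `d ≤ 3B` one gets `d - 2κb ≤ 5B - 2κ`, which explains the threshold. The
  -- quantity `d - 2κb` is `2ik a(k)` at `k = iκ`.
  have hlarge : ∀ κ : ℝ, 5 * B + 1 ≤ κ → 0 < b κ ∧ d κ - 2 * κ * b κ < 0 := by
    intro κ h
    have h0 : 0 < κ := by linarith
    have h1 := hb1 κ h0.le
    have h2 := (abs_le.1 (hd1 κ h0.le)).2
    have h3 := neg_abs_le (b κ - 1)
    have h4 : -B ≤ κ * (b κ - 1) := by nlinarith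
    constructor
    · have : 0 < κ * b κ := by linarith
      exact pos_of_mul_pos_right this h0.le
    · linarith
  have hAne : ∀ κ : ℝ, 0 < κ → d κ - 2 * κ * b κ ≠ 0 := by
    intro κ h hz
    have hk0 : Complex.I * (κ : ℂ) ≠ 0 := by simp [h.ne']
    have h1 := aCoef_mul hu (I_mul_mem_upper h.le) hk0
    rw [hbE κ h.le, hdE κ h.le] at h1
    have h2 : 2 * Complex.I * (Complex.I * (κ : ℂ)) * (b κ : ℂ) + (d κ : ℂ) =
        ((d κ - 2 * κ * b κ : ℝ) : ℂ) := by
      push_cast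
      linear_combination (2 * (κ : ℂ) * b κ) * Complex.I_sq
    rw [h2, hz, Complex.ofReal_zero] at h1
    have := ha _ (I_mul_mem_upper h.le) hk0
    have h3 : 2 * Complex.I * (Complex.I * (κ : ℂ)) ≠ 0 := by simp [h.ne']
    exact (mul_ne_zero h3 this) h1
  have hAc : ContinuousOn (fun κ => d κ - 2 * κ * b κ) (Ici 0) :=
    hdc.sub (ContinuousOn.mul (by fun_prop) hbc)
  -- This is where `a ≠ 0` acts: a continuous real function without zeros on `(0, ∞)`, negative for
  -- large `κ`, is negative throughout.
  have hAneg : ∀ κ : ℝ, 0 < κ → d κ - 2 * κ * b κ < 0 := fun κ h =>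
    neg_of_ne_zero (hAc.mono Ioi_subset_Ici_self) hAne (by linarith : (0 : ℝ) < 5 * B + 1)
      (hlarge _ le_rfl).2 h
  have hAle : ∀ κ : ℝ, 0 ≤ κ → d κ - 2 * κ * b κ ≤ 0 := by
    intro κ h
    have h1 : Tendsto (fun κ => d κ - 2 * κ * b κ) (𝓝[>] κ) (𝓝 (d κ - 2 * κ * b κ)) :=
      (hAc κ h).mono_left (nhdsWithin_mono _ fun y (hy : κ < y) => h.trans hy.le)
    refine le_of_tendsto h1 ?_
    filter_upwards [self_mem_nhdsWithin] with y hy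
    exact (hAneg y (h.trans_lt hy)).le
  -- the largest zero
  have hZ : IsCompact (Icc 0 (5 * B + 1) ∩ b ⁻¹' {0}) :=
    isCompact_Icc.of_isClosed_subset ((hbc.mono fun y hy => hy.1).preimage_isClosed_of_isClosed
      isClosed_Icc isClosed_singleton) inter_subset_left
  have hκK : κ ≤ 5 * B + 1 := by
    by_contra hc
    have h1 := (hlarge κ (not_le.1 hc).le).1
    rw [hbE κ hκ, Complex.ofReal_eq_zero] at hzero
    linarith
  obtain ⟨κ₀, ⟨hκ₀, hbκ₀⟩, hmax⟩ := hZ.exists_isGreatest ⟨κ, ⟨hκ, hκK⟩, by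
    rw [hbE κ hκ, Complex.ofReal_eq_zero] at hzero; exact hzero⟩
  have hbκ₀ : b κ₀ = 0 := hbκ₀
  have hbpos : ∀ κ, κ₀ < κ → 0 < b κ := by
    intro κ h
    have := neg_of_ne_zero (f := fun κ => -b κ) (a := κ₀) (K := max (κ₀ + 1) (5 * B + 1))
      (hbc.neg.mono fun y (hy : κ₀ < y) => hκ₀.1.trans hy.le) ?_
      (lt_max_of_lt_left (by linarith)) (by
        have := (hlarge _ (le_max_right (κ₀ + 1) (5 * B + 1))).1
        linarith) h
    · simpa using this
    · intro x hx hbx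
      have hbx : b x = 0 := by simpa using hbx
      by_cases hxK : x ≤ 5 * B + 1
      · exact absurd (hmax ⟨⟨hκ₀.1.trans hx.le, hxK⟩, hbx⟩) (not_le.2 hx)
      · have := (hlarge x (not_le.1 hxK).le).1
        linarith
  -- At the zero `κ₀` of `b` the sign of `d - 2κb` becomes the sign of `d`; equality is excluded
  -- because both Cauchy data cannot vanish.
  have hdneg : d κ₀ < 0 := by
    have h1 := hAle κ₀ hκ₀.1
    rw [hbκ₀, mul_zero, sub_zero] at h1
    refine lt_of_le_of_ne h1 fun h2 => ?_
    exact jost_not_both_zero hu (I_mul_mem_upper hκ₀.1) (by rw [hbE κ₀ hκ₀.1, hbκ₀]; simp)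
      (by rw [hdE κ₀ hκ₀.1, h2]; simp)
  obtain ⟨X, hX0, hX⟩ := exists_half_lt_jostM hu
  set p : ℝ → ℝ → ℝ := fun κ x => Real.exp (-(κ * x)) * (jostM u (Complex.I * κ) x).re with hp
  have hpE : ∀ κ x : ℝ, 0 ≤ κ → 0 ≤ x →
      Complex.exp (Complex.I * (Complex.I * κ) * x) * jostM u (Complex.I * κ) x = (p κ x : ℂ) := by
    intro κ x h hx
    rw [exp_I_mul_I, jostM_I_mul hu h hx, hp]
    push_cast
    rfl
  have hpc : ∀ κ, 0 ≤ κ → ContinuousOn (p κ) (Ici 0) := by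
    intro κ h
    refine ContinuousOn.mul (by fun_prop) ?_
    exact Complex.continuous_re.comp_continuousOn (continuousOn_jostM hu (I_mul_mem_upper h))
  have hppos : ∀ κ x : ℝ, 0 ≤ κ → X ≤ x → 0 < p κ x := by
    intro κ x h hx
    refine mul_pos (Real.exp_pos _) ?_
    have h1 := (Complex.abs_re_le_norm _).trans_lt (hX _ (I_mul_mem_upper h) x hx)
    rw [Complex.sub_re, Complex.one_re, abs_lt] at h1
    linarith [h1.1]
  have hIc : ContinuousOn (fun κ => ∫ x in Ioc 0 X, p κ₀ x * p κ x) (Ici 0) := by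
    refine continuousOn_of_dominated (bound := fun x => |p κ₀ x| * potBound u) ?_ ?_ ?_ ?_
    · intro κ h
      exact (((hpc κ₀ hκ₀.1).mul (hpc κ h)).mono fun y hy => hy.1.le).aestronglyMeasurable
        measurableSet_Ioc
    · intro κ h
      refine (ae_restrict_iff' measurableSet_Ioc).2 (Eventually.of_forall fun x hx => ?_)
      rw [norm_mul, Real.norm_eq_abs]
      refine mul_le_mul_of_nonneg_left ?_ (abs_nonneg _)
      have h1 := norm_jost_le hu (I_mul_mem_upper h) hx.1.le
      rwa [hpE κ x h hx.1.le, Complex.norm_real] at h1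
    · refine (ContinuousOn.integrableOn_Icc ?_).mono_set Ioc_subset_Icc_self
      exact (((hpc κ₀ hκ₀.1).mono fun y hy => hy.1).abs).mul continuousOn_const
    · refine (ae_restrict_iff' measurableSet_Ioc).2 (Eventually.of_forall fun x hx => ?_)
      refine continuousOn_const.mul (ContinuousOn.mul (by fun_prop) ?_)
      exact Complex.continuous_re.comp_continuousOn
        ((continuousOn_jostM_left hu x).comp (by fun_prop) hmap)
  have hI0 : 0 < ∫ x in Ioc 0 X, p κ₀ x * p κ₀ x := by
    rw [← intervalIntegral.integral_of_le hX0.le]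
    refine intervalIntegral.integral_pos hX0
      (((hpc κ₀ hκ₀.1).mul (hpc κ₀ hκ₀.1)).mono fun y hy => hy.1)
      (fun x _ => mul_self_nonneg _) ⟨X, ⟨hX0.le, le_rfl⟩, ?_⟩
    exact mul_pos (hppos _ _ hκ₀.1 le_rfl) (hppos _ _ hκ₀.1 le_rfl)
  -- At `κ = κ₀` the integrand is a square, so the integral over `(0, X]` is positive and stays so
  -- for `κ` slightly larger. Beyond `X` both factors are positive for every `κ`, so no sign can be
  -- lost there.
  have hev : ∀ᶠ κ in 𝓝[>] κ₀, 0 < ∫ x in Ioc 0 X, p κ₀ x * p κ x :=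
    ((hIc κ₀ hκ₀.1).mono_left (nhdsWithin_mono _ fun y (hy : κ₀ < y) =>
      hκ₀.1.trans hy.le)).eventually (lt_mem_nhds hI0)
  obtain ⟨κ₂, hI2, hκ₂⟩ := (hev.and self_mem_nhdsWithin).exists
  have hκ₂ : κ₀ < κ₂ := hκ₂
  have hκ₂0 : 0 < κ₂ := hκ₀.1.trans_lt hκ₂
  have hk₂ : Complex.I * (κ₂ : ℂ) ∈ upperO := by simpa [upperO] using hκ₂0
  have hlim := (Complex.continuous_re.tendsto _).comp
    (tendsto_wronskian_jost hu (I_mul_mem_upper hκ₀.1) hk₂)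
  rw [Complex.zero_re] at hlim
  have hc : 0 < -d κ₀ * b κ₂ := mul_pos (by linarith) (hbpos κ₂ hκ₂)
  -- Since `b(κ₀) = 0`, the Wronskian starts at `-d(κ₀) b(κ₂) > 0`, and by time `x` it has gained
  -- `(κ₂² - κ₀²) ∫ p p ≥ 0`. It would have to tend to `0` while staying above a positive constant.
  have hge := ge_of_tendsto hlim (b := -d κ₀ * b κ₂) (by
    filter_upwards [eventually_ge_atTop X] with x hx
    have hx0 : 0 ≤ x := hX0.le.trans hx
    have hw := (jost_isODE hu (I_mul_mem_upper hκ₀.1)).wronskian_sub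
      (jost_isODE hu (upperO_subset hk₂)) le_rfl hx0
    rw [sub_eq_iff_eq_add] at hw
    have hint : ∫ ξ in (0 : ℝ)..x,
        (Complex.exp (Complex.I * (Complex.I * κ₀) * ξ) * jostM u (Complex.I * κ₀) ξ) *
        (Complex.exp (Complex.I * (Complex.I * κ₂) * ξ) * jostM u (Complex.I * κ₂) ξ) =
        ((∫ ξ in (0 : ℝ)..x, p κ₀ ξ * p κ₂ ξ : ℝ) : ℂ) := by
      rw [← intervalIntegral.integral_ofReal]
      refine intervalIntegral.integral_congr fun ξ hξ => ?_
      rw [uIcc_of_le hx0] at hξ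
      simp only [hpE _ _ hκ₀.1 hξ.1, hpE _ _ hκ₂0.le hξ.1, Complex.ofReal_mul]
    rw [hint] at hw
    simp only [Function.comp_apply]
    rw [hw, hbE κ₀ hκ₀.1, hdE κ₀ hκ₀.1, hbE κ₂ hκ₂0.le, hbκ₀]
    have hsplit : ∫ ξ in (0 : ℝ)..x, p κ₀ ξ * p κ₂ ξ =
        (∫ ξ in (0 : ℝ)..X, p κ₀ ξ * p κ₂ ξ) + ∫ ξ in X..x, p κ₀ ξ * p κ₂ ξ := by
      have hcc := (hpc κ₀ hκ₀.1).mul (hpc κ₂ hκ₂0.le)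
      exact (intervalIntegral.integral_add_adjacent_intervals
        ((hcc.mono fun y hy => hy.1).intervalIntegrable_of_Icc hX0.le)
        ((hcc.mono fun y hy => hX0.le.trans hy.1).intervalIntegrable_of_Icc hx)).symm
    have htail : 0 ≤ ∫ ξ in X..x, p κ₀ ξ * p κ₂ ξ :=
      intervalIntegral.integral_nonneg hx fun ξ hξ =>
        (mul_pos (hppos _ _ hκ₀.1 hξ.1) (hppos _ _ hκ₂0.le hξ.1)).le
    have hIpos : 0 ≤ ∫ ξ in (0 : ℝ)..x, p κ₀ ξ * p κ₂ ξ := by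
      rw [hsplit, intervalIntegral.integral_of_le hX0.le]
      linarith
    have hfin : ((Complex.I * (κ₀ : ℂ)) ^ 2 - (Complex.I * (κ₂ : ℂ)) ^ 2) *
        ((∫ ξ in (0 : ℝ)..x, p κ₀ ξ * p κ₂ ξ : ℝ) : ℂ) =
        (((κ₂ ^ 2 - κ₀ ^ 2) * ∫ ξ in (0 : ℝ)..x, p κ₀ ξ * p κ₂ ξ : ℝ) : ℂ) := by
      push_cast
      rw [mul_pow, mul_pow, Complex.I_sq]
      ring
    rw [hfin]
    have hsq : 0 ≤ (κ₂ ^ 2 - κ₀ ^ 2) * ∫ ξ in (0 : ℝ)..x, p κ₀ ξ * p κ₂ ξ := by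
      refine mul_nonneg ?_ hIpos
      nlinarith [hκ₀.1]
    simp only [Complex.ofReal_zero, mul_zero, Complex.exp_zero, one_mul, zero_mul, zero_add,
      zero_sub, Complex.add_re, Complex.neg_re, ← Complex.ofReal_mul, Complex.ofReal_re]
    linarith)
  linarith

theorem jostM_zero_ne (hu : LinePotential u) (ha : ∀ k ∈ upper, k ≠ 0 → aCoef u k ≠ 0) {k : ℂ}
    (hk : k ∈ upper) : jostM u k 0 ≠ 0 := by
  by_cases hre : k.re = 0
  · have : k = Complex.I * (k.im : ℂ) := by
      apply Complex.ext <;> simp [hre]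
    rw [this]
    exact jostM_zero_ne_of_imag hu ha hk
  · rcases (show 0 ≤ k.im from hk).eq_or_lt with him | him
    · exact jostM_zero_ne_of_real hu him.symm fun h => hre (by simp [h])
    · exact jostM_zero_ne_of_re hu him hre

/-- For `|k| > 2 jostBound u + 1` the estimate `m = 1 + O(1/k)` gives `|m| ≥ 1/2`. The remaining
half disc is compact and contains no zero, `k = 0` included. -/
theorem exists_le_norm_jostM_zero (hu : LinePotential u)
    (ha : ∀ k ∈ upper, k ≠ 0 → aCoef u k ≠ 0) :
    ∃ c : ℝ, 0 < c ∧ ∀ k ∈ upper, c ≤ ‖jostM u k 0‖ := by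
  set K : ℝ := 2 * jostBound u + 1 with hK
  have hB := jostBound_nonneg u
  have hcl : IsClosed upper := isClosed_le continuous_const Complex.continuous_im
  have hcomp : IsCompact (upper ∩ Metric.closedBall 0 K) :=
    (isCompact_closedBall (0 : ℂ) K).inter_left hcl
  have hne : (upper ∩ Metric.closedBall 0 K).Nonempty :=
    ⟨0, by simp [upper], by simp only [Metric.mem_closedBall, dist_self]; linarith⟩
  obtain ⟨k₀, hk₀, hmin⟩ := hcomp.exists_isMinOn hne
    (((continuousOn_jostM_left hu 0).mono inter_subset_left).norm)
  have hpos : 0 < ‖jostM u k₀ 0‖ := norm_pos_iff.2 (jostM_zero_ne hu ha hk₀.1)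
  refine ⟨min ‖jostM u k₀ 0‖ (1 / 2), lt_min hpos (by norm_num), fun k hk => ?_⟩
  by_cases hkK : ‖k‖ ≤ K
  · exact (min_le_left _ _).trans (hmin ⟨hk, by simpa using hkK⟩)
  · refine (min_le_right _ _).trans ?_
    have h1 := norm_mul_jostM_sub_one_le' hu hk le_rfl
    have h2 : K < ‖k‖ := not_le.1 hkK
    have h3 : ‖jostM u k 0 - 1‖ ≤ 1 / 2 := by
      by_contra hc
      have hc := not_le.1 hc
      nlinarith
    have h4 := norm_sub_norm_le (1 : ℂ) (1 - jostM u k 0)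
    rw [sub_sub_cancel, norm_one, norm_sub_rev] at h4
    linarith

end QuarterPlane

namespace QuarterPlane

open Filter Topology

/-! ### Regularity and decay of the solution of the boundary value problem -/

/-- The closed quarter plane. -/
def quarter : Set (ℝ × ℝ) := Ici 0 ×ˢ Ici 0

theorem uniqueDiffOn_quarter : UniqueDiffOn ℝ quarter :=
  (uniqueDiffOn_Ici 0).prod (uniqueDiffOn_Ici 0)

variable {u : ℝ → ℝ} {β γ₁ γ₂ : ℝ} {f g : ℝ → ℝ} {q : ℝ → ℝ → ℝ}

namespace IsSolution

theorem continuousOn (hq : IsSolution u β γ₁ γ₂ f g q) :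
    ContinuousOn (Function.uncurry q) quarter :=
  hq.contDiffOn_closed.continuousOn

theorem hasFDerivWithinAt (hq : IsSolution u β γ₁ γ₂ f g q) {p : ℝ × ℝ} (hp : p ∈ quarter) :
    HasFDerivWithinAt (Function.uncurry q) (fderivWithin ℝ (Function.uncurry q) quarter p)
      quarter p :=
  ((hq.contDiffOn_closed.differentiableOn one_ne_zero) p hp).hasFDerivWithinAt

theorem hasDerivWithinAt_x (hq : IsSolution u β γ₁ γ₂ f g q) {x y : ℝ} (hx : 0 ≤ x)
    (hy : 0 ≤ y) : HasDerivWithinAt (fun s => q s y)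
      (fderivWithin ℝ (Function.uncurry q) quarter (x, y) (1, 0)) (Ici 0) x :=
  (hq.hasFDerivWithinAt (p := (x, y)) ⟨hx, hy⟩).comp_hasDerivWithinAt x
    (f := fun s : ℝ => (s, y)) ((hasDerivWithinAt_id _ _).prodMk (hasDerivWithinAt_const _ _ _))
    fun _ hs => ⟨hs, hy⟩

theorem hasDerivWithinAt_y (hq : IsSolution u β γ₁ γ₂ f g q) {x y : ℝ} (hx : 0 ≤ x)
    (hy : 0 ≤ y) : HasDerivWithinAt (fun t => q x t)
      (fderivWithin ℝ (Function.uncurry q) quarter (x, y) (0, 1)) (Ici 0) y :=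
  (hq.hasFDerivWithinAt (p := (x, y)) ⟨hx, hy⟩).comp_hasDerivWithinAt y
    (f := fun t : ℝ => (x, t)) ((hasDerivWithinAt_const _ _ _).prodMk (hasDerivWithinAt_id _ _))
    fun _ ht => ⟨hx, ht⟩

theorem partialX_eq (hq : IsSolution u β γ₁ γ₂ f g q) {x y : ℝ} (hx : 0 ≤ x) (hy : 0 ≤ y) :
    partialX q x y = fderivWithin ℝ (Function.uncurry q) quarter (x, y) (1, 0) :=
  (hq.hasDerivWithinAt_x hx hy).derivWithin (uniqueDiffOn_Ici 0 x hx)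

theorem partialY_eq (hq : IsSolution u β γ₁ γ₂ f g q) {x y : ℝ} (hx : 0 ≤ x) (hy : 0 ≤ y) :
    partialY q x y = fderivWithin ℝ (Function.uncurry q) quarter (x, y) (0, 1) :=
  (hq.hasDerivWithinAt_y hx hy).derivWithin (uniqueDiffOn_Ici 0 y hy)

theorem continuousOn_fderivWithin (hq : IsSolution u β γ₁ γ₂ f g q) :
    ContinuousOn (fderivWithin ℝ (Function.uncurry q) quarter) quarter :=
  ContDiffOn.continuousOn_fderivWithin hq.contDiffOn_closed uniqueDiffOn_quarter le_rfl

theorem continuousOn_partialX (hq : IsSolution u β γ₁ γ₂ f g q) :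
    ContinuousOn (Function.uncurry (partialX q)) quarter :=
  (hq.continuousOn_fderivWithin.clm_apply continuousOn_const).congr
    fun _ hp => hq.partialX_eq hp.1 hp.2

theorem continuousOn_partialY (hq : IsSolution u β γ₁ γ₂ f g q) :
    ContinuousOn (Function.uncurry (partialY q)) quarter :=
  (hq.continuousOn_fderivWithin.clm_apply continuousOn_const).congr
    fun _ hp => hq.partialY_eq hp.1 hp.2

theorem differentiableAt_fderiv (hq : IsSolution u β γ₁ γ₂ f g q) {x y : ℝ} (hx : 0 < x)
    (hy : 0 < y) : DifferentiableAt ℝ (fderiv ℝ (Function.uncurry q)) (x, y) := by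
  have h : ContDiffAt ℝ 2 (Function.uncurry q) (x, y) :=
    hq.contDiffOn_interior.contDiffAt (prod_mem_nhds (Ioi_mem_nhds hx) (Ioi_mem_nhds hy))
  exact (h.fderiv_right (m := 1) (by norm_num)).differentiableAt one_ne_zero

theorem fderivWithin_eventuallyEq (_ : IsSolution u β γ₁ γ₂ f g q) {x y : ℝ} (hx : 0 < x)
    (hy : 0 < y) : fderivWithin ℝ (Function.uncurry q) quarter =ᶠ[𝓝 (x, y)]
      fderiv ℝ (Function.uncurry q) := by
  have hm : (Ioi (0 : ℝ) ×ˢ Ioi (0 : ℝ)) ∈ 𝓝 (x, y) :=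
    prod_mem_nhds (Ioi_mem_nhds hx) (Ioi_mem_nhds hy)
  filter_upwards [hm] with p hp
  exact fderivWithin_of_mem_nhds (prod_mem_nhds (Ici_mem_nhds hp.1) (Ici_mem_nhds hp.2))

theorem quarter_mem_nhds {x y : ℝ} (hx : 0 < x) (hy : 0 < y) : quarter ∈ 𝓝 (x, y) :=
  prod_mem_nhds (Ici_mem_nhds hx) (Ici_mem_nhds hy)

theorem differentiableAt_partialX (hq : IsSolution u β γ₁ γ₂ f g q) {x y : ℝ} (hx : 0 < x)
    (hy : 0 < y) : DifferentiableAt ℝ (Function.uncurry (partialX q)) (x, y) := by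
  have h := (hq.differentiableAt_fderiv hx hy).clm_apply
    (differentiableAt_const ((1, 0) : ℝ × ℝ))
  refine h.congr_of_eventuallyEq ?_
  filter_upwards [hq.fderivWithin_eventuallyEq hx hy, quarter_mem_nhds hx hy] with p hp hpq
  rw [← hp]
  exact hq.partialX_eq hpq.1 hpq.2

theorem differentiableAt_partialY (hq : IsSolution u β γ₁ γ₂ f g q) {x y : ℝ} (hx : 0 < x)
    (hy : 0 < y) : DifferentiableAt ℝ (Function.uncurry (partialY q)) (x, y) := by
  have h := (hq.differentiableAt_fderiv hx hy).clm_apply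
    (differentiableAt_const ((0, 1) : ℝ × ℝ))
  refine h.congr_of_eventuallyEq ?_
  filter_upwards [hq.fderivWithin_eventuallyEq hx hy, quarter_mem_nhds hx hy] with p hp hpq
  rw [← hp]
  exact hq.partialY_eq hpq.1 hpq.2

theorem hasDerivAt_x (hq : IsSolution u β γ₁ γ₂ f g q) {x y : ℝ} (hx : 0 < x) (hy : 0 ≤ y) :
    HasDerivAt (fun s => q s y) (partialX q x y) x := by
  rw [hq.partialX_eq hx.le hy]
  exact (hq.hasDerivWithinAt_x hx.le hy).hasDerivAt (Ici_mem_nhds hx)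

theorem hasDerivAt_y (hq : IsSolution u β γ₁ γ₂ f g q) {x y : ℝ} (hx : 0 ≤ x) (hy : 0 < y) :
    HasDerivAt (fun t => q x t) (partialY q x y) y := by
  rw [hq.partialY_eq hx hy.le]
  exact (hq.hasDerivWithinAt_y hx hy.le).hasDerivAt (Ici_mem_nhds hy)

theorem hasDerivAt_partialX (hq : IsSolution u β γ₁ γ₂ f g q) {x y : ℝ} (hx : 0 < x)
    (hy : 0 < y) :
    HasDerivAt (fun s => partialX q s y) (iteratedDeriv 2 (fun s => q s y) x) x := by
  have hd : DifferentiableAt ℝ (fun s => partialX q s y) x :=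
    (hq.differentiableAt_partialX hx hy).comp x (f := fun s : ℝ => (s, y)) (by fun_prop)
  have : iteratedDeriv 2 (fun s => q s y) x = deriv (fun s => partialX q s y) x := by
    rw [iteratedDeriv_succ, iteratedDeriv_one]
    refine EventuallyEq.deriv_eq ?_
    filter_upwards [Ioi_mem_nhds hx] with s hs using (hq.hasDerivAt_x hs hy.le).deriv
  rw [this]
  exact hd.hasDerivAt

theorem hasDerivAt_partialY (hq : IsSolution u β γ₁ γ₂ f g q) {x y : ℝ} (hx : 0 < x)
    (hy : 0 < y) :
    HasDerivAt (fun t => partialY q x t) (iteratedDeriv 2 (fun t => q x t) y) y := by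
  have hd : DifferentiableAt ℝ (fun t => partialY q x t) y :=
    (hq.differentiableAt_partialY hx hy).comp y (f := fun t : ℝ => (x, t)) (by fun_prop)
  have : iteratedDeriv 2 (fun t => q x t) y = deriv (fun t => partialY q x t) y := by
    rw [iteratedDeriv_succ, iteratedDeriv_one]
    refine EventuallyEq.deriv_eq ?_
    filter_upwards [Ioi_mem_nhds hy] with t ht using (hq.hasDerivAt_y hx.le ht).deriv
  rw [this]
  exact hd.hasDerivAt

end IsSolution

/-! ### Green's identity on rectangles. -/

theorem hasDerivAt_exp_neg_mul (κ : ℂ) (y : ℝ) :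
    HasDerivAt (fun y : ℝ => Complex.exp (-(κ * y))) (-κ * Complex.exp (-(κ * y))) y := by
  simpa using hasDerivAt_cexp_mul (-κ) y

/-- Green's identity on a rectangle in the closed quarter plane. -/
theorem green_rectangle (hq : IsSolution u β γ₁ γ₂ f g q) {k κ : ℂ} (hκ : κ ^ 2 = k ^ 2)
    {v v' : ℝ → ℂ} (hv : IsODE u k v v') {a b Y : ℝ} (ha : 0 ≤ a) (hab : a ≤ b) (hY : 0 ≤ Y) :
    (∫ y in (0 : ℝ)..Y, Complex.exp (-(κ * y)) * (v b * partialX q b y - v' b * q b y)) -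
      (∫ y in (0 : ℝ)..Y, Complex.exp (-(κ * y)) * (v a * partialX q a y - v' a * q a y)) =
    (∫ x in a..b, v x * (partialY q x 0 + κ * q x 0)) -
      ∫ x in a..b, v x * (Complex.exp (-(κ * Y)) * (partialY q x Y + κ * q x Y)) := by
  set F : ℝ × ℝ → ℂ := fun p => Complex.exp (-(κ * p.2)) *
    (v p.1 * (Function.uncurry (partialX q) p : ℝ) - v' p.1 * (Function.uncurry q p : ℝ)) with hF
  set G : ℝ × ℝ → ℂ := fun p => v p.1 * (Complex.exp (-(κ * p.2)) *
    ((Function.uncurry (partialY q) p : ℝ) + κ * (Function.uncurry q p : ℝ))) with hG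
  have hsub : Icc (a, 0) (b, Y) ⊆ quarter := fun p hp => ⟨ha.trans hp.1.1, hp.1.2⟩
  have hv1 : ContinuousOn (fun p : ℝ × ℝ => v p.1) quarter :=
    hv.continuousOn.comp continuousOn_fst fun p hp => hp.1
  have hv2 : ContinuousOn (fun p : ℝ × ℝ => v' p.1) quarter :=
    hv.continuousOn'.comp continuousOn_fst fun p hp => hp.1
  have hof : ∀ {h : ℝ × ℝ → ℝ}, ContinuousOn h quarter →
      ContinuousOn (fun p => (h p : ℂ)) quarter := fun h =>
    Complex.continuous_ofReal.comp_continuousOn h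
  have hexp : Continuous (fun p : ℝ × ℝ => Complex.exp (-(κ * p.2))) := by fun_prop
  have hFc : ContinuousOn F quarter := hexp.continuousOn.mul
    ((hv1.mul (hof hq.continuousOn_partialX)).sub (hv2.mul (hof hq.continuousOn)))
  have hGc : ContinuousOn G quarter := hv1.mul (hexp.continuousOn.mul
    ((hof hq.continuousOn_partialY).add (continuousOn_const.mul (hof hq.continuousOn))))
  have hofd : ∀ {h : ℝ × ℝ → ℝ} {p : ℝ × ℝ}, DifferentiableAt ℝ h p →
      DifferentiableAt ℝ (fun p => (h p : ℂ)) p := fun h =>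
    Complex.ofRealCLM.differentiableAt.comp _ h
  have hdiff : ∀ p ∈ Ioo a b ×ˢ Ioo 0 Y, DifferentiableAt ℝ F p ∧ DifferentiableAt ℝ G p := by
    rintro ⟨x, y⟩ ⟨hx, hy⟩
    have hx0 : 0 < x := ha.trans_lt hx.1
    have hy0 : 0 < y := hy.1
    have d1 : DifferentiableAt ℝ (fun p : ℝ × ℝ => v p.1) (x, y) :=
      (hv.hasDerivAt hx0).differentiableAt.comp (x, y) differentiableAt_fst
    have d2 : DifferentiableAt ℝ (fun p : ℝ × ℝ => v' p.1) (x, y) :=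
      (hv.hasDerivAt' hx0).differentiableAt.comp (x, y) differentiableAt_fst
    have d3 := hofd (hq.differentiableAt_partialX hx0 hy0)
    have d4 := hofd (hq.differentiableAt_partialY hx0 hy0)
    have d5 := hofd ((hq.hasFDerivWithinAt (p := (x, y)) ⟨hx0.le, hy0.le⟩).hasFDerivAt
      (IsSolution.quarter_mem_nhds hx0 hy0)).differentiableAt
    have d6 : DifferentiableAt ℝ (fun p : ℝ × ℝ => Complex.exp (-(κ * p.2))) (x, y) :=
      DifferentiableAt.comp (g := fun y : ℝ => Complex.exp (-(κ * y))) (f := Prod.snd) (x, y)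
        (hasDerivAt_exp_neg_mul κ y).differentiableAt differentiableAt_snd
    exact ⟨d6.mul ((d1.mul d3).sub (d2.mul d5)), d1.mul (d6.mul (d4.add (d5.const_mul κ)))⟩
  classical
  -- The derivatives are set to zero off the open rectangle. The divergence then vanishes
  -- identically, and no integrability of second derivatives up to the boundary has to be checked.
  set F' : ℝ × ℝ → ℝ × ℝ →L[ℝ] ℂ := fun p => if p ∈ Ioo a b ×ˢ Ioo 0 Y then fderiv ℝ F p else 0
  set G' : ℝ × ℝ → ℝ × ℝ →L[ℝ] ℂ := fun p => if p ∈ Ioo a b ×ˢ Ioo 0 Y then fderiv ℝ G p else 0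
  have hdiv : ∀ p, F' p (1, 0) + G' p (0, 1) = 0 := by
    rintro ⟨x, y⟩
    by_cases hp : (x, y) ∈ Ioo a b ×ˢ Ioo 0 Y
    · simp only [F', G', if_pos hp]
      have hx0 : 0 < x := ha.trans_lt hp.1.1
      have hy0 : 0 < y := hp.2.1
      have h1 : HasDerivAt (fun s => F (s, y)) (fderiv ℝ F (x, y) (1, 0)) x :=
        (hdiff _ hp).1.hasFDerivAt.comp_hasDerivAt x (f := fun s : ℝ => (s, y))
          ((hasDerivAt_id x).prodMk (hasDerivAt_const x y))
      have h2 : HasDerivAt (fun t => G (x, t)) (fderiv ℝ G (x, y) (0, 1)) y :=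
        (hdiff _ hp).2.hasFDerivAt.comp_hasDerivAt y (f := fun t : ℝ => (x, t))
          ((hasDerivAt_const y x).prodMk (hasDerivAt_id y))
      have h3 := ((((hv.hasDerivAt hx0).mul (hq.hasDerivAt_partialX hx0 hy0).ofReal_comp).sub
        ((hv.hasDerivAt' hx0).mul (hq.hasDerivAt_x hx0 hy0.le).ofReal_comp)).const_mul
          (Complex.exp (-(κ * y))))
      have h4 := ((hasDerivAt_exp_neg_mul κ y).mul
        ((hq.hasDerivAt_partialY hx0 hy0).ofReal_comp.add
          ((hq.hasDerivAt_y hx0.le hy0).ofReal_comp.const_mul κ))).const_mul (v x)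
      rw [h1.unique h3, h2.unique h4]
      have hpde := congrArg (fun r : ℝ => (r : ℂ)) (hq.pde x y hx0 hy0)
      push_cast at hpde
      simp only [Pi.add_apply]
      linear_combination (Complex.exp (-(κ * y)) * v x) * hpde
        - (Complex.exp (-(κ * y)) * v x * q x y) * hκ
    · simp only [F', G', if_neg hp, zero_apply, add_zero]
  have key := integral_divergence_prod_Icc_of_hasFDerivAt_of_le F G F' G' (a, 0) (b, Y)
    ⟨hab, hY⟩ (hFc.mono hsub) (hGc.mono hsub)
    (fun p hp => by simp only [F', if_pos (show p ∈ Ioo a b ×ˢ Ioo 0 Y from hp)]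
                    exact (hdiff p hp).1.hasFDerivAt)
    (fun p hp => by simp only [G', if_pos (show p ∈ Ioo a b ×ˢ Ioo 0 Y from hp)]
                    exact (hdiff p hp).2.hasFDerivAt)
    (by simp only [hdiv]; exact integrableOn_zero)
  simp only [hdiv, integral_zero] at key
  simp only [hF, hG, Function.uncurry_apply_pair, Complex.ofReal_zero, mul_zero, neg_zero,
    Complex.exp_zero, one_mul] at key
  linear_combination (-1 : ℂ) * key

/-! ### Decay -/

/-- `h` is dominated by an integrable function of one variable times a function of the other
variable that tends to zero. -/
def DecaysBy (P ω : ℝ → ℝ) (h : ℝ → ℝ → ℝ) : Prop :=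
  ∀ x y, 0 ≤ x → 0 ≤ y → |h x y| ≤ P x * ω y ∧ |h x y| ≤ P y * ω x

/-- Majorants of the solution and of its first derivatives. -/
structure Majorants (q : ℝ → ℝ → ℝ) (P ω : ℝ → ℝ) : Prop where
  integrable : IntegrableOn P (Ioi 0)
  nonneg : ∀ x, 0 ≤ x → 0 ≤ P x
  bounded : ∃ B, ∀ x, 0 ≤ x → P x ≤ B
  nonneg' : ∀ x, 0 ≤ x → 0 ≤ ω x
  le_one : ∀ x, 0 ≤ x → ω x ≤ 1
  tendsto : Tendsto ω atTop (𝓝 0)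
  decay : DecaysBy P ω q
  decayX : DecaysBy P ω (partialX q)
  decayY : DecaysBy P ω (partialY q)

theorem IsSolution.exists_majorants (hq : IsSolution u β γ₁ γ₂ f g q) :
    ∃ P ω, Majorants q P ω := by
  obtain ⟨C, δ, hδ, hC⟩ := hq.decay
  have hC0 : 0 ≤ C := by
    have := (hC 0 0 le_rfl le_rfl).1
    simp only [add_zero, Real.one_rpow, mul_one] at this
    exact (abs_nonneg _).trans this
  -- The exponent `1 + δ` is split as `(1 + δ/2) + δ/2`: the first part is integrable in one
  -- variable, the second tends to zero in the other.
  have key : ∀ x y : ℝ, 0 ≤ x → 0 ≤ y → (1 + x + y) ^ (-(1 + δ)) ≤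
      (x + 1) ^ (-(1 + δ / 2)) * (1 + y) ^ (-(δ / 2)) := by
    intro x y hx hy
    rw [show -(1 + δ) = -(1 + δ / 2) + -(δ / 2) by ring, Real.rpow_add (by linarith)]
    refine mul_le_mul ?_ ?_ (by positivity) (by positivity)
    · exact Real.rpow_le_rpow_of_nonpos (by linarith) (by linarith) (by linarith)
    · exact Real.rpow_le_rpow_of_nonpos (by linarith) (by linarith) (by linarith)
  have hdec : ∀ h : ℝ → ℝ → ℝ, (∀ x y : ℝ, 0 ≤ x → 0 ≤ y → |h x y| ≤ C * (1 + x + y) ^ (-(1 + δ))) →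
      DecaysBy (fun x => C * (x + 1) ^ (-(1 + δ / 2))) (fun y => (1 + y) ^ (-(δ / 2))) h := by
    intro h hh x y hx hy
    constructor
    · rw [mul_assoc]
      exact (hh x y hx hy).trans (mul_le_mul_of_nonneg_left (key x y hx hy) hC0)
    · rw [mul_assoc]
      refine (hh x y hx hy).trans (mul_le_mul_of_nonneg_left ?_ hC0)
      rw [show 1 + x + y = 1 + y + x by ring]
      exact key y x hy hx
  refine ⟨fun x => C * (x + 1) ^ (-(1 + δ / 2)), fun y => (1 + y) ^ (-(δ / 2)), ?_, ?_, ⟨C, ?_⟩,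
    ?_, ?_, ?_, hdec _ fun x y hx hy => (hC x y hx hy).1,
    hdec _ fun x y hx hy => (hC x y hx hy).2.1, hdec _ fun x y hx hy => (hC x y hx hy).2.2⟩
  · exact (integrableOn_add_rpow_Ioi_of_lt (by linarith) (by norm_num)).const_mul C
  · intro x hx; positivity
  · intro x hx
    have := Real.rpow_le_one_of_one_le_of_nonpos (x := x + 1) (z := -(1 + δ / 2)) (by linarith)
      (by linarith)
    nlinarith
  · intro x hx; positivity
  · intro x hx
    exact Real.rpow_le_one_of_one_le_of_nonpos (by linarith) (by linarith)
  · exact (tendsto_rpow_neg_atTop (by positivity)).comp (tendsto_atTop_add_const_left _ 1 tendsto_id)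

/-- Laplace transform in the second variable. -/
noncomputable def laplaceY (h : ℝ → ℝ → ℝ) (κ : ℂ) (x : ℝ) : ℂ :=
  ∫ y in Ioi (0 : ℝ), Complex.exp (-(κ * y)) * (h x y : ℂ)

theorem norm_exp_neg_mul_le {κ : ℂ} (hκ : 0 ≤ κ.re) {y : ℝ} (hy : 0 ≤ y) :
    ‖Complex.exp (-(κ * y))‖ ≤ 1 := by
  rw [Complex.norm_exp, Real.exp_le_one_iff]
  simp
  positivity

theorem continuousOn_right {h : ℝ → ℝ → ℝ} (hc : ContinuousOn (Function.uncurry h) quarter)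
    {x : ℝ} (hx : 0 ≤ x) : ContinuousOn (fun y => h x y) (Ici 0) :=
  hc.comp (f := fun y : ℝ => (x, y)) (by fun_prop) fun _ hy => ⟨hx, hy⟩

theorem continuousOn_left {h : ℝ → ℝ → ℝ} (hc : ContinuousOn (Function.uncurry h) quarter)
    {y : ℝ} (hy : 0 ≤ y) : ContinuousOn (fun x => h x y) (Ici 0) :=
  hc.comp (f := fun x : ℝ => (x, y)) (by fun_prop) fun _ hx => ⟨hx, hy⟩

/-- A bounded continuous weight times a dominated function is integrable. -/
theorem integrableOn_mul_of_dominated {e : ℝ → ℂ} {h : ℝ → ℝ} {P : ℝ → ℝ} {A : ℝ}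
    (hP : IntegrableOn P (Ioi 0)) (he : ContinuousOn e (Ioi 0)) (hA : ∀ y, 0 < y → ‖e y‖ ≤ A)
    (hh : ContinuousOn h (Ioi 0)) (hb : ∀ y, 0 < y → |h y| ≤ P y) :
    IntegrableOn (fun y => e y * (h y : ℂ)) (Ioi 0) := by
  refine Integrable.mono' (hP.const_mul A) ((he.mul
    (Complex.continuous_ofReal.comp_continuousOn hh)).aestronglyMeasurable measurableSet_Ioi) ?_
  refine (ae_restrict_iff' measurableSet_Ioi).2 (Eventually.of_forall fun y hy => ?_)
  rw [norm_mul, Complex.norm_real, Real.norm_eq_abs]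
  exact mul_le_mul (hA y hy) (hb y hy) (abs_nonneg _) ((norm_nonneg _).trans (hA y hy))

theorem DecaysBy.le_right {P ω : ℝ → ℝ} {h : ℝ → ℝ → ℝ} (hd : DecaysBy P ω h)
    (hM : Majorants q P ω) {x y : ℝ} (hx : 0 ≤ x) (hy : 0 ≤ y) : |h x y| ≤ P y :=
  (hd x y hx hy).2.trans (mul_le_of_le_one_right (hM.nonneg y hy) (hM.le_one x hx))

theorem DecaysBy.le_left {P ω : ℝ → ℝ} {h : ℝ → ℝ → ℝ} (hd : DecaysBy P ω h)
    (hM : Majorants q P ω) {x y : ℝ} (hx : 0 ≤ x) (hy : 0 ≤ y) : |h x y| ≤ P x :=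
  (hd x y hx hy).1.trans (mul_le_of_le_one_right (hM.nonneg x hx) (hM.le_one y hy))

theorem continuous_exp_neg_mul (κ : ℂ) : Continuous fun y : ℝ => Complex.exp (-(κ * y)) := by
  fun_prop

theorem integrableOn_laplaceY {P ω : ℝ → ℝ} {h : ℝ → ℝ → ℝ} (hM : Majorants q P ω)
    (hd : DecaysBy P ω h) (hc : ContinuousOn (Function.uncurry h) quarter) {κ : ℂ}
    (hκ : 0 ≤ κ.re) {x : ℝ} (hx : 0 ≤ x) :
    IntegrableOn (fun y : ℝ => Complex.exp (-(κ * y)) * (h x y : ℂ)) (Ioi 0) :=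
  integrableOn_mul_of_dominated hM.integrable (continuous_exp_neg_mul κ).continuousOn
    (fun _ hy => norm_exp_neg_mul_le hκ hy.le)
    ((continuousOn_right hc hx).mono Ioi_subset_Ici_self) fun _ hy => hd.le_right hM hx hy.le

theorem norm_laplaceY_le {P ω : ℝ → ℝ} {h : ℝ → ℝ → ℝ} (hM : Majorants q P ω)
    (hd : DecaysBy P ω h) {κ : ℂ} (hκ : 0 ≤ κ.re) {x : ℝ} (hx : 0 ≤ x) :
    ‖laplaceY h κ x‖ ≤ (∫ y in Ioi (0 : ℝ), P y) * ω x := by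
  rw [← integral_mul_const]
  refine norm_integral_le_of_norm_le (hM.integrable.mul_const _) ?_
  refine (ae_restrict_iff' measurableSet_Ioi).2 (Eventually.of_forall fun y hy => ?_)
  have hy0 : (0 : ℝ) ≤ y := le_of_lt hy
  rw [norm_mul, Complex.norm_real, Real.norm_eq_abs]
  calc _ ≤ 1 * (P y * ω x) := mul_le_mul (norm_exp_neg_mul_le hκ hy0) (hd x y hx hy0).2
        (abs_nonneg _) zero_le_one
    _ = _ := one_mul _

theorem tendsto_laplaceY {P ω : ℝ → ℝ} {h : ℝ → ℝ → ℝ} (hM : Majorants q P ω)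
    (hd : DecaysBy P ω h) {κ : ℂ} (hκ : 0 ≤ κ.re) : Tendsto (laplaceY h κ) atTop (𝓝 0) := by
  have := hM.tendsto.const_mul (∫ y in Ioi (0 : ℝ), P y)
  rw [mul_zero] at this
  refine squeeze_zero_norm' ?_ this
  filter_upwards [eventually_ge_atTop 0] with x hx using norm_laplaceY_le hM hd hκ hx

/-- Green's identity on a vertical strip. -/
theorem green_strip (hq : IsSolution u β γ₁ γ₂ f g q) {k κ : ℂ} (hκ : κ ^ 2 = k ^ 2)
    (hre : 0 ≤ κ.re) {v v' : ℝ → ℂ} (hv : IsODE u k v v') {a b : ℝ} (ha : 0 ≤ a) (hab : a ≤ b) :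
    (v b * laplaceY (partialX q) κ b - v' b * laplaceY q κ b) -
      (v a * laplaceY (partialX q) κ a - v' a * laplaceY q κ a) =
    ∫ x in a..b, v x * (partialY q x 0 + κ * q x 0) := by
  obtain ⟨P, ω, hM⟩ := hq.exists_majorants
  have hlim : ∀ c : ℝ, 0 ≤ c → Tendsto (fun Y : ℝ => ∫ y in (0 : ℝ)..Y,
      Complex.exp (-(κ * y)) * (v c * partialX q c y - v' c * q c y)) atTop
      (𝓝 (v c * laplaceY (partialX q) κ c - v' c * laplaceY q κ c)) := by
    intro c hc
    have i1 := integrableOn_laplaceY hM hM.decayX hq.continuousOn_partialX hre hc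
    have i2 := integrableOn_laplaceY hM hM.decay hq.continuousOn hre hc
    have heq : ∀ y : ℝ, Complex.exp (-(κ * y)) * (v c * partialX q c y - v' c * q c y) =
        v c * (Complex.exp (-(κ * y)) * (partialX q c y : ℂ)) -
          v' c * (Complex.exp (-(κ * y)) * (q c y : ℂ)) := fun y => by ring
    simp only [heq]
    rw [laplaceY, laplaceY, ← integral_const_mul, ← integral_const_mul,
      ← integral_sub (i1.const_mul _) (i2.const_mul _)]
    exact intervalIntegral_tendsto_integral_Ioi 0 ((i1.const_mul _).sub (i2.const_mul _)) tendsto_id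
  obtain ⟨A, hA⟩ := (isCompact_Icc (a := a) (b := b)).exists_bound_of_continuousOn
    (hv.continuousOn.mono fun y hy => ha.trans hy.1)
  have hA0 : 0 ≤ A := (norm_nonneg _).trans (hA a ⟨le_rfl, hab⟩)
  obtain ⟨B, hB⟩ := hM.bounded
  have hB0 : 0 ≤ B := (hM.nonneg 0 le_rfl).trans (hB 0 le_rfl)
  -- The top side disappears as `Y → ∞` through the decay of `q` and `q_y`, not through the
  -- exponential. This is why purely imaginary `κ` is allowed.
  have hrest : Tendsto (fun Y : ℝ => ∫ x in a..b, v x * (Complex.exp (-(κ * Y)) *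
      (partialY q x Y + κ * q x Y))) atTop (𝓝 0) := by
    have hl : Tendsto (fun Y => A * (B + ‖κ‖ * B) * ω Y * |b - a|) atTop (𝓝 0) := by
      have := (hM.tendsto.const_mul (A * (B + ‖κ‖ * B))).mul_const |b - a|
      rwa [mul_zero, zero_mul] at this
    refine squeeze_zero_norm' ?_ hl
    filter_upwards [eventually_ge_atTop 0] with Y hY
    refine intervalIntegral.norm_integral_le_of_norm_le_const fun x hx => ?_
    rw [uIoc_of_le hab] at hx
    have hx0 : 0 ≤ x := ha.trans hx.1.le
    have hω := hM.nonneg' Y hY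
    have e1 : |partialY q x Y| ≤ B * ω Y := (hM.decayY x Y hx0 hY).1.trans
      (mul_le_mul_of_nonneg_right (hB x hx0) hω)
    have e2 : |q x Y| ≤ B * ω Y := (hM.decay x Y hx0 hY).1.trans
      (mul_le_mul_of_nonneg_right (hB x hx0) hω)
    have e3 : ‖(partialY q x Y : ℂ) + κ * q x Y‖ ≤ (B + ‖κ‖ * B) * ω Y := by
      refine (norm_add_le _ _).trans ?_
      rw [norm_mul, Complex.norm_real, Complex.norm_real, Real.norm_eq_abs, Real.norm_eq_abs]
      have := mul_le_mul_of_nonneg_left e2 (norm_nonneg κ)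
      nlinarith
    rw [norm_mul, norm_mul, mul_assoc]
    refine mul_le_mul (hA x ⟨hx.1.le, hx.2⟩) ?_ (by positivity) hA0
    calc _ ≤ 1 * ((B + ‖κ‖ * B) * ω Y) := mul_le_mul (norm_exp_neg_mul_le hre hY) e3
          (norm_nonneg _) zero_le_one
      _ = _ := one_mul _
  have h1 := (hlim b (ha.trans hab)).sub (hlim a ha)
  have h2 := (tendsto_const_nhds (x := ∫ x in a..b, v x * (partialY q x 0 + κ * q x 0))).sub hrest
  rw [sub_zero] at h2
  refine tendsto_nhds_unique h1 (h2.congr' ?_)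
  filter_upwards [eventually_ge_atTop 0] with Y hY
  exact (green_rectangle hq hκ hv ha hab hY).symm

theorem integrableOn_mul_bottom {P ω : ℝ → ℝ} {h : ℝ → ℝ → ℝ} (hM : Majorants q P ω)
    (hd : DecaysBy P ω h) (hc : ContinuousOn (Function.uncurry h) quarter) {v : ℝ → ℂ}
    (hv : ContinuousOn v (Ici 0)) {A : ℝ} (hA : ∀ x, 0 ≤ x → ‖v x‖ ≤ A) :
    IntegrableOn (fun x => v x * (h x 0 : ℂ)) (Ioi 0) :=
  integrableOn_mul_of_dominated hM.integrable (hv.mono Ioi_subset_Ici_self)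
    (fun x hx => hA x hx.le) ((continuousOn_left hc le_rfl).mono Ioi_subset_Ici_self)
    fun _ hx => hd.le_left hM hx.le le_rfl

/-- Green's identity to the right of a vertical line, for a bounded solution `v`. -/
theorem green_half (hq : IsSolution u β γ₁ γ₂ f g q) {k κ : ℂ} (hκ : κ ^ 2 = k ^ 2)
    (hre : 0 ≤ κ.re) {v v' : ℝ → ℂ} (hv : IsODE u k v v') {A A' : ℝ}
    (hA : ∀ x, 0 ≤ x → ‖v x‖ ≤ A) (hA' : ∀ x, 0 ≤ x → ‖v' x‖ ≤ A') {a : ℝ} (ha : 0 ≤ a) :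
    v' a * laplaceY q κ a - v a * laplaceY (partialX q) κ a =
    ∫ x in Ioi a, v x * (partialY q x 0 + κ * q x 0) := by
  obtain ⟨P, ω, hM⟩ := hq.exists_majorants
  have i1 := integrableOn_mul_bottom hM hM.decayY hq.continuousOn_partialY hv.continuousOn hA
  have i2 := integrableOn_mul_bottom hM hM.decay hq.continuousOn hv.continuousOn hA
  have hint : IntegrableOn (fun x => v x * (partialY q x 0 + κ * q x 0)) (Ioi a) := by
    refine IntegrableOn.mono_set ?_ (Ioi_subset_Ioi ha)
    refine (i1.add (i2.const_mul κ)).congr_fun (fun x _ => ?_) measurableSet_Ioi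
    simp only [Pi.add_apply]
    ring
  have hz : ∀ {w : ℝ → ℂ} {h : ℝ → ℝ → ℝ} {D : ℝ}, (∀ x, 0 ≤ x → ‖w x‖ ≤ D) → DecaysBy P ω h →
      Tendsto (fun x => w x * laplaceY h κ x) atTop (𝓝 0) := by
    intro w h D hD hd
    have hl := ((tendsto_zero_iff_norm_tendsto_zero.1 (tendsto_laplaceY hM hd hre)).const_mul D)
    rw [mul_zero] at hl
    refine squeeze_zero_norm' ?_ hl
    filter_upwards [eventually_ge_atTop 0] with x hx
    rw [norm_mul]
    exact mul_le_mul_of_nonneg_right (hD x hx) (norm_nonneg _)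
  have h1 := (((hz hA hM.decayX).sub (hz hA' hM.decay)).sub_const
    (v a * laplaceY (partialX q) κ a - v' a * laplaceY q κ a))
  have h2 := intervalIntegral_tendsto_integral_Ioi a hint tendsto_id
  have := tendsto_nhds_unique h1 (h2.congr' (by
    filter_upwards [eventually_ge_atTop a] with b hb
    exact (green_strip hq hκ hre hv ha hb).symm))
  rw [← this]
  ring

theorem g0_eq_laplaceY (q : ℝ → ℝ → ℝ) (k : ℂ) : g0 q k = laplaceY q (-k) 0 := by
  simp [g0, expTransform, laplaceY]

end QuarterPlane

namespace QuarterPlane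

open Filter Topology

variable {u : ℝ → ℝ} {β γ₁ γ₂ : ℝ} {f g : ℝ → ℝ} {q : ℝ → ℝ → ℝ}

/-! ### Nonvanishing denominators -/

theorem psi_zero_ne (hu : LinePotential u) (ha : ∀ k ∈ upper, k ≠ 0 → aCoef u k ≠ 0) {k : ℂ}
    (hk : k ∈ upper) (hk0 : k ≠ 0) : psi u 0 k ≠ 0 := by
  rw [psi_zero hu hk hk0]
  exact jostM_zero_ne hu ha hk

theorem eq_I_mul_im {k : ℂ} (hre : k.re = 0) : k = Complex.I * (k.im : ℂ) := by
  apply Complex.ext <;> simp [hre]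

theorem ne_zero_of_im_pos {k : ℂ} (him : 0 < k.im) : k ≠ 0 := by
  rintro rfl
  simp at him

theorem DFun_eq (hu : LinePotential u) {k : ℂ} (hk : k ∈ upper) (hk0 : k ≠ 0) :
    DFun u β γ₂ k = Complex.I * k * jostM u k 0 + jostDM u k 0
      + (γ₂ - β * k) * jostM u k 0 := by
  rw [DFun, psiX_eq hu hk hk0, psi_zero hu hk hk0]

/-- On the imaginary axis `m` and `m_x` at `0` are real and so is `ik`. The imaginary part of `D` is
therefore `-β Im k · m(0)`, a product of nonzero factors. -/
theorem DFun_ne (hu : LinePotential u) (ha : ∀ k ∈ upper, k ≠ 0 → aCoef u k ≠ 0) (hβ : β ≠ 0)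
    {k : ℂ} (hre : k.re = 0) (him : 0 < k.im) : DFun u β γ₂ k ≠ 0 := by
  rw [DFun_eq hu him.le (ne_zero_of_im_pos him)]
  have hm := jostM_zero_ne hu ha (k := k) him.le
  rw [eq_I_mul_im hre] at hm ⊢
  rw [jostM_I_mul hu him.le le_rfl] at hm ⊢
  rw [jostDM_I_mul hu him.le le_rfl]
  intro h
  have := congrArg Complex.im h
  simp at this
  rcases this with h | h
  · rcases h with h | h
    · exact hβ h
    · exact him.ne' h
  · exact hm (by rw [h]; simp)

theorem sub_ofReal_ne {k : ℂ} (him : 0 < k.im) (γ : ℝ) : k - γ ≠ 0 := by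
  intro h
  have := congrArg Complex.im h
  simp at this
  exact him.ne' this

/-! ### Boundary data -/

namespace IsSolution

theorem f_eq (hq : IsSolution u β γ₁ γ₂ f g q) {x : ℝ} (hx : 0 < x) :
    (f x : ℂ) = partialY q x 0 + γ₁ * q x 0 := by
  rw [← hq.boundary_bottom x hx]
  push_cast
  ring

theorem g_eq (hq : IsSolution u β γ₁ γ₂ f g q) {y : ℝ} (hy : 0 < y) :
    (g y : ℂ) = partialX q 0 y + β * partialY q 0 y + γ₂ * q 0 y := by
  rw [← hq.boundary_left y hy]
  push_cast
  ring

variable {v : ℝ → ℂ} {A : ℝ}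

theorem integrableOn_q_mul (hq : IsSolution u β γ₁ γ₂ f g q) (hv : ContinuousOn v (Ici 0))
    (hA : ∀ x, 0 ≤ x → ‖v x‖ ≤ A) : IntegrableOn (fun x => (q x 0 : ℂ) * v x) (Ioi 0) := by
  obtain ⟨P, ω, hM⟩ := hq.exists_majorants
  simp only [mul_comm _ (v _)]
  exact integrableOn_mul_bottom hM hM.decay hq.continuousOn hv hA

theorem integrableOn_qy_mul (hq : IsSolution u β γ₁ γ₂ f g q) (hv : ContinuousOn v (Ici 0))
    (hA : ∀ x, 0 ≤ x → ‖v x‖ ≤ A) :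
    IntegrableOn (fun x => (partialY q x 0 : ℂ) * v x) (Ioi 0) := by
  obtain ⟨P, ω, hM⟩ := hq.exists_majorants
  simp only [mul_comm _ (v _)]
  exact integrableOn_mul_bottom hM hM.decayY hq.continuousOn_partialY hv hA

theorem integrableOn_f_mul (hq : IsSolution u β γ₁ γ₂ f g q) (hv : ContinuousOn v (Ici 0))
    (hA : ∀ x, 0 ≤ x → ‖v x‖ ≤ A) : IntegrableOn (fun x => (f x : ℂ) * v x) (Ioi 0) := by
  refine ((hq.integrableOn_qy_mul hv hA).add ((hq.integrableOn_q_mul hv hA).const_mul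
    (γ₁ : ℂ))).congr_fun (fun x hx => ?_) measurableSet_Ioi
  simp only [Pi.add_apply, hq.f_eq hx]
  ring

theorem integral_f_mul (hq : IsSolution u β γ₁ γ₂ f g q)
    (h1 : IntegrableOn (fun x => (partialY q x 0 : ℂ) * v x) (Ioi 0))
    (h2 : IntegrableOn (fun x => (q x 0 : ℂ) * v x) (Ioi 0)) :
    ∫ x in Ioi (0 : ℝ), (f x : ℂ) * v x = (∫ x in Ioi (0 : ℝ), (partialY q x 0 : ℂ) * v x)
      + γ₁ * ∫ x in Ioi (0 : ℝ), (q x 0 : ℂ) * v x := by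
  rw [← integral_const_mul, ← integral_add h1 (h2.const_mul _)]
  refine setIntegral_congr_fun measurableSet_Ioi fun x hx => ?_
  simp only [hq.f_eq hx]
  ring

theorem integrableOn_exp_q (hq : IsSolution u β γ₁ γ₂ f g q) {k : ℂ} (hk : k.re ≤ 0) :
    IntegrableOn (fun y : ℝ => Complex.exp (k * y) * (q 0 y : ℂ)) (Ioi 0) := by
  obtain ⟨P, ω, hM⟩ := hq.exists_majorants
  simpa using integrableOn_laplaceY hM hM.decay hq.continuousOn (κ := -k) (by simpa using hk) le_rfl

theorem integrableOn_exp_qx (hq : IsSolution u β γ₁ γ₂ f g q) {k : ℂ} (hk : k.re ≤ 0) :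
    IntegrableOn (fun y : ℝ => Complex.exp (k * y) * (partialX q 0 y : ℂ)) (Ioi 0) := by
  obtain ⟨P, ω, hM⟩ := hq.exists_majorants
  simpa using integrableOn_laplaceY hM hM.decayX hq.continuousOn_partialX (κ := -k)
    (by simpa using hk) le_rfl

theorem integrableOn_exp_qy (hq : IsSolution u β γ₁ γ₂ f g q) {k : ℂ} (hk : k.re ≤ 0) :
    IntegrableOn (fun y : ℝ => Complex.exp (k * y) * (partialY q 0 y : ℂ)) (Ioi 0) := by
  obtain ⟨P, ω, hM⟩ := hq.exists_majorants
  simpa using integrableOn_laplaceY hM hM.decayY hq.continuousOn_partialY (κ := -k)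
    (by simpa using hk) le_rfl

theorem integrableOn_exp_g (hq : IsSolution u β γ₁ γ₂ f g q) {k : ℂ} (hk : k.re ≤ 0) :
    IntegrableOn (fun y : ℝ => Complex.exp (k * y) * (g y : ℂ)) (Ioi 0) := by
  refine (((hq.integrableOn_exp_qx hk).add ((hq.integrableOn_exp_qy hk).const_mul (β : ℂ))).add
    ((hq.integrableOn_exp_q hk).const_mul (γ₂ : ℂ))).congr_fun (fun y hy => ?_) measurableSet_Ioi
  simp only [Pi.add_apply, hq.g_eq hy]
  ring

theorem expTransform_g (hq : IsSolution u β γ₁ γ₂ f g q) {k : ℂ} (hk : k.re ≤ 0) :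
    expTransform g k = laplaceY (partialX q) (-k) 0 + β * laplaceY (partialY q) (-k) 0
      + γ₂ * laplaceY q (-k) 0 := by
  simp only [expTransform, laplaceY, neg_mul, neg_neg]
  have i12 : IntegrableOn (fun y : ℝ => Complex.exp (k * y) * (partialX q 0 y : ℂ)
      + β * (Complex.exp (k * y) * (partialY q 0 y : ℂ))) (Ioi 0) :=
    (hq.integrableOn_exp_qx hk).add ((hq.integrableOn_exp_qy hk).const_mul _)
  rw [← integral_const_mul, ← integral_const_mul, ← integral_add (hq.integrableOn_exp_qx hk)
    ((hq.integrableOn_exp_qy hk).const_mul _),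
    ← integral_add i12 ((hq.integrableOn_exp_q hk).const_mul _)]
  refine setIntegral_congr_fun measurableSet_Ioi fun y hy => ?_
  simp only [hq.g_eq hy]
  ring

/-- The Laplace transform of `q_y`. -/
theorem laplaceY_partialY (hq : IsSolution u β γ₁ γ₂ f g q) {κ : ℂ} (hκ : 0 ≤ κ.re) {x : ℝ}
    (hx : 0 ≤ x) : laplaceY (partialY q) κ x = -(q x 0 : ℂ) + κ * laplaceY q κ x := by
  obtain ⟨P, ω, hM⟩ := hq.exists_majorants
  have i1 := integrableOn_laplaceY hM hM.decayY hq.continuousOn_partialY hκ hx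
  have i2 := integrableOn_laplaceY hM hM.decay hq.continuousOn hκ hx
  have hc : ContinuousWithinAt (fun y : ℝ => Complex.exp (-(κ * y)) * (q x y : ℂ)) (Ici 0) 0 :=
    ((continuous_exp_neg_mul κ).continuousOn.mul (Complex.continuous_ofReal.comp_continuousOn
      (continuousOn_right hq.continuousOn hx))) 0 self_mem_Ici
  have hd : ∀ y ∈ Ioi (0 : ℝ), HasDerivAt (fun y : ℝ => Complex.exp (-(κ * y)) * (q x y : ℂ))
      (Complex.exp (-(κ * y)) * (partialY q x y : ℂ)
        - κ * (Complex.exp (-(κ * y)) * (q x y : ℂ))) y := by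
    intro y hy
    exact ((hasDerivAt_exp_neg_mul κ y).mul (hq.hasDerivAt_y hx hy).ofReal_comp).congr_deriv
      (by ring)
  have hl : Tendsto (fun y : ℝ => Complex.exp (-(κ * y)) * (q x y : ℂ)) atTop (𝓝 0) := by
    have := hM.tendsto.const_mul (P x)
    rw [mul_zero] at this
    refine squeeze_zero_norm' ?_ this
    filter_upwards [eventually_ge_atTop 0] with y hy
    rw [norm_mul, Complex.norm_real, Real.norm_eq_abs]
    calc _ ≤ 1 * (P x * ω y) := mul_le_mul (norm_exp_neg_mul_le hκ hy) (hM.decay x y hx hy).1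
          (abs_nonneg _) zero_le_one
      _ = _ := one_mul _
  have key := integral_Ioi_of_hasDerivAt_of_tendsto hc hd (i1.sub (i2.const_mul κ)) hl
  rw [integral_sub i1 (i2.const_mul κ), integral_const_mul] at key
  simp only [Complex.ofReal_zero, mul_zero, neg_zero, Complex.exp_zero, one_mul] at key
  rw [laplaceY, laplaceY]
  linear_combination key

end IsSolution

/-! ### Integrability against the eigenfunctions -/

theorem norm_psi_le (hu : LinePotential u) {k : ℂ} (hk : k ∈ upper) (hk0 : k ≠ 0) {x : ℝ}
    (hx : 0 ≤ x) : ‖psi u x k‖ ≤ potBound u := by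
  rw [psi_eq hu hk hk0 hx]
  exact norm_jost_le hu hk hx

theorem norm_dirS_le_of_real (hu : LinePotential u) {k : ℂ} (hk : k.im = 0) (hk0 : k ≠ 0) {x : ℝ}
    (hx : 0 ≤ x) : ‖dirS u k x‖ ≤ dirBound u / ‖k‖ := by
  have h1 := norm_mul_dirN_le hu (show k ∈ upper from hk.ge) hx
  rw [dirS, norm_mul, Complex.norm_exp, le_div_iff₀ (norm_pos_iff.2 hk0)]
  have : (-(Complex.I * k) * (x : ℂ)).re = 0 := by simp [hk]
  rw [this, Real.exp_zero, one_mul, mul_comm]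
  exact h1

theorem norm_dirDS_le_of_real (hu : LinePotential u) {k : ℂ} (hk : k.im = 0) {x : ℝ}
    (hx : 0 ≤ x) : ‖dirDS u k x‖ ≤ 2 * dirBound u := by
  have hku : k ∈ upper := hk.ge
  have h1 := norm_mul_dirN_le hu hku hx
  have h2 := norm_dirDN_le hu hku hx
  rw [dirDS, norm_mul, Complex.norm_exp]
  have : (-(Complex.I * k) * (x : ℂ)).re = 0 := by simp [hk]
  rw [this, Real.exp_zero, one_mul]
  refine (norm_add_le _ _).trans ?_
  rw [norm_mul, norm_neg, norm_mul, Complex.norm_I, one_mul]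
  linarith

/-- For real `k` both `ψ` and `s` are bounded, and `φ` is a combination of them. Hence the
`φ`-transforms converge on the real axis. -/
theorem norm_phi_le_of_real (hu : LinePotential u) {k : ℂ}
    (hk : k.im = 0) (hk0 : k ≠ 0) : ∃ A, ∀ x, 0 ≤ x → ‖phi u x k‖ ≤ A := by
  have hku : k ∈ upper := hk.ge
  refine ⟨potBound u / ‖jostM u k 0‖ + ‖2 * Complex.I * k * aCoef u k / jostM u k 0‖ *
    (dirBound u / ‖k‖), fun x hx => ?_⟩
  rw [phi_eq hu hku hk0 (jostM_zero_ne_of_real hu hk hk0) hx]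
  refine (norm_sub_le _ _).trans (add_le_add ?_ ?_)
  · rw [norm_div]
    exact div_le_div_of_nonneg_right (norm_psi_le hu hku hk0 hx) (norm_nonneg _)
  · rw [norm_mul]
    exact mul_le_mul_of_nonneg_left (norm_dirS_le_of_real hu hk hk0 hx) (norm_nonneg _)

/-! ### The Riemann-Hilbert problem -/

theorem g0_analytic (hq : IsSolution u β γ₁ γ₂ f g q) :
    AnalyticOnNhd ℂ (g0 q) {k : ℂ | k.re < 0} := by
  obtain ⟨P, ω, hM⟩ := hq.exists_majorants
  have hopen : IsOpen {k : ℂ | k.re < 0} := isOpen_lt Complex.continuous_re continuous_const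
  refine DifferentiableOn.analyticOnNhd ?_ hopen
  refine differentiableOn_integral_of_dominated hopen (bound := P) ?_ ?_ ?_ hM.integrable
  · intro k hk
    exact (hq.integrableOn_exp_q (le_of_lt (show k.re < 0 from hk))).aestronglyMeasurable
  · exact Eventually.of_forall fun y => by fun_prop
  · refine (ae_restrict_iff' measurableSet_Ioi).2 (Eventually.of_forall fun y hy k hk => ?_)
    have hk' : k.re < 0 := hk
    have h1 := norm_exp_neg_mul_le (κ := -k) (by simpa using hk'.le) (le_of_lt hy)
    rw [neg_mul, neg_neg] at h1
    rw [norm_mul, Complex.norm_real, Real.norm_eq_abs]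
    calc _ ≤ 1 * P y := mul_le_mul h1 (hM.decay.le_right hM le_rfl (le_of_lt hy))
          (abs_nonneg _) zero_le_one
      _ = _ := one_mul _

theorem g0_continuousOn (hq : IsSolution u β γ₁ γ₂ f g q) :
    ContinuousOn (g0 q) {k : ℂ | k.re ≤ 0} := by
  obtain ⟨P, ω, hM⟩ := hq.exists_majorants
  refine continuousOn_of_dominated (bound := P) ?_ ?_ hM.integrable ?_
  · intro k hk
    exact (hq.integrableOn_exp_q hk).aestronglyMeasurable
  · intro k hk
    refine (ae_restrict_iff' measurableSet_Ioi).2 (Eventually.of_forall fun y hy => ?_)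
    have hk' : k.re ≤ 0 := hk
    have h1 := norm_exp_neg_mul_le (κ := -k) (by simpa using hk') (le_of_lt hy)
    rw [neg_mul, neg_neg] at h1
    rw [norm_mul, Complex.norm_real, Real.norm_eq_abs]
    calc _ ≤ 1 * P y := mul_le_mul h1 (hM.decay.le_right hM le_rfl (le_of_lt hy))
          (abs_nonneg _) zero_le_one
      _ = _ := one_mul _
  · exact Eventually.of_forall fun y => by fun_prop

/-- An integration by parts in `y` expresses `k g₀(k)` through `q(0,0)` and the transform of `q_y`,
both bounded on the closed half plane. -/
theorem exists_norm_g0_le (hq : IsSolution u β γ₁ γ₂ f g q) :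
    ∃ C, ∀ k : ℂ, k.re ≤ 0 → ‖g0 q k‖ ≤ C ∧ ‖k‖ * ‖g0 q k‖ ≤ C := by
  obtain ⟨P, ω, hM⟩ := hq.exists_majorants
  have hI : 0 ≤ ∫ y in Ioi (0 : ℝ), P y :=
    setIntegral_nonneg measurableSet_Ioi fun y hy => hM.nonneg y (le_of_lt hy)
  have hle : ∀ {h : ℝ → ℝ → ℝ}, DecaysBy P ω h → ∀ {κ : ℂ}, 0 ≤ κ.re →
      ‖laplaceY h κ 0‖ ≤ ∫ y in Ioi (0 : ℝ), P y := fun hd κ hκ =>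
    (norm_laplaceY_le hM hd hκ le_rfl).trans (mul_le_of_le_one_right hI (hM.le_one 0 le_rfl))
  refine ⟨|q 0 0| + ∫ y in Ioi (0 : ℝ), P y, fun k hk => ?_⟩
  have hk' : 0 ≤ (-k).re := by simpa using hk
  rw [g0_eq_laplaceY]
  refine ⟨(hle hM.decay hk').trans (by linarith [abs_nonneg (q 0 0)]), ?_⟩
  have h1 := hq.laplaceY_partialY hk' le_rfl
  have h2 : -k * laplaceY q (-k) 0 = (q 0 0 : ℂ) + laplaceY (partialY q) (-k) 0 := by
    rw [h1]; ring
  rw [← norm_neg k, ← norm_mul, h2]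
  refine (norm_add_le _ _).trans (add_le_add ?_ (hle hM.decayY hk'))
  rw [Complex.norm_real, Real.norm_eq_abs]

theorem g0_isBigO (hq : IsSolution u β γ₁ γ₂ f g q) :
    (g0 q) =O[Bornology.cobounded ℂ ⊓ Filter.principal {k : ℂ | k.re ≤ 0}]
      (fun k : ℂ => 1 / k) := by
  obtain ⟨C, hC⟩ := exists_norm_g0_le hq
  refine Asymptotics.IsBigO.of_bound C ?_
  rw [eventually_inf_principal]
  filter_upwards [Bornology.eventually_ne_cobounded (0 : ℂ)] with k hk0 hk
  have h1 := (hC k hk).2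
  rw [norm_div, norm_one, mul_one_div, le_div_iff₀ (norm_pos_iff.2 hk0), mul_comm]
  exact h1

theorem conj_psi_of_imag (hu : LinePotential u) {k : ℂ} (hre : k.re = 0) (him : 0 < k.im) {x : ℝ}
    (hx : 0 ≤ x) : conj (psi u x k) = psi u x k := by
  have hk0 := ne_zero_of_im_pos him
  rw [psi_eq hu him.le hk0 hx, map_mul, conj_jostM hu him.le hx, ← Complex.exp_conj]
  have : -conj k = k := by apply Complex.ext <;> simp [hre]
  rw [this]
  have h2 : conj (Complex.I * k * (x : ℂ)) = Complex.I * k * x := by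
    have : conj k = -k := by apply Complex.ext <;> simp [hre]
    simp [this]
  rw [h2]

/-- On the imaginary axis conjugation fixes `ψ` but reverses the exponent in the transform of `g`.
So the conjugate of `H` is the datum of the global relation with the opposite sign of `κ`. -/
theorem conj_HFun (hu : LinePotential u) {k : ℂ} (hre : k.re = 0) (him : 0 < k.im) :
    conj (HFun u f g k) = psiTransform u f k + psi u 0 k * expTransform g (-k) := by
  have hck : conj k = -k := by apply Complex.ext <;> simp [hre]
  rw [HFun, map_add, map_mul, conj_psi_of_imag hu hre him le_rfl, psiTransform, expTransform,
    expTransform, ← integral_conj, ← integral_conj]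
  congr 1
  · refine setIntegral_congr_fun measurableSet_Ioi fun x hx => ?_
    simp only [map_mul, Complex.conj_ofReal, conj_psi_of_imag hu hre him (le_of_lt hx)]
  · congr 2
    funext y
    rw [map_mul, ← Complex.exp_conj, map_mul, hck, Complex.conj_ofReal, Complex.conj_ofReal]

/-- The global relation on the imaginary axis, for either sign of the exponent. -/
theorem global_relation_jost (hu : LinePotential u) (hq : IsSolution u β γ₁ γ₂ f g q) {k κ : ℂ}
    (him : 0 < k.im) (hκ : κ ^ 2 = k ^ 2) (hre : κ.re = 0) :
    (psiX u k + (γ₂ + β * κ) * psi u 0 k) * g0 q (-κ) =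
      β * psi u 0 k * q 0 0 + (psiTransform u f k + psi u 0 k * expTransform g (-κ))
        + (κ - γ₁) * psiTransform u (fun x => q x 0) k := by
  have hku : k ∈ upper := him.le
  have hk0 := ne_zero_of_im_pos him
  have hJ := psi_isJost hu hku hk0
  have h := green_half hq hκ hre.ge (jost_isODE hu hku) (fun x hx => norm_jost_le hu hku hx)
    (fun x hx => norm_jostD_le hu hku hx) le_rfl
  have hqi := hq.integrableOn_q_mul hJ.continuousOn fun x hx => norm_psi_le hu hku hk0 hx
  have hqyi := hq.integrableOn_qy_mul hJ.continuousOn fun x hx => norm_psi_le hu hku hk0 hx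
  have hf : psiTransform u f k = _ := hq.integral_f_mul hqyi hqi
  have hr : ∫ x in Ioi (0 : ℝ), Complex.exp (Complex.I * k * x) * jostM u k x *
      (partialY q x 0 + κ * q x 0) = (∫ x in Ioi (0 : ℝ), (partialY q x 0 : ℂ) * psi u x k)
        + κ * ∫ x in Ioi (0 : ℝ), (q x 0 : ℂ) * psi u x k := by
    rw [← integral_const_mul, ← integral_add hqyi (hqi.const_mul _)]
    refine setIntegral_congr_fun measurableSet_Ioi fun x hx => ?_
    simp only [psi_eq hu hku hk0 (le_of_lt hx)]
    ring
  rw [hr] at h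
  simp only [Complex.ofReal_zero, mul_zero, Complex.exp_zero, one_mul] at h
  have hg := hq.expTransform_g (k := -κ) (by simp [hre])
  rw [neg_neg, hq.laplaceY_partialY hre.ge le_rfl] at hg
  rw [hg, hf, g0_eq_laplaceY, neg_neg, psiX_eq hu hku hk0, psi_zero hu hku hk0, psiTransform]
  linear_combination h

/-- The global relation is used with `κ = k` and with `κ = -k`, weighted by `k + γ₁` and `k - γ₁`;
in the sum the unknown transform of `q(·,0)` against `ψ` cancels. -/
theorem riemannHilbert_jump (hu : LinePotential u) (ha : ∀ k ∈ upper, k ≠ 0 → aCoef u k ≠ 0)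
    (hβ : β ≠ 0) (hq : IsSolution u β γ₁ γ₂ f g q) {k : ℂ} (hre : k.re = 0) (him : 0 < k.im) :
    g0 q k + JFun u β γ₁ γ₂ k * g0 q (-k) =
      2 * k * β * psi u 0 k / ((k - γ₁) * DFun u β γ₂ k) * q 0 0 + FFun u f g β γ₁ γ₂ k := by
  have h1 := global_relation_jost hu hq him (κ := k) rfl hre
  have h2 := global_relation_jost hu hq him (κ := -k) (by ring) (by simp [hre])
  rw [neg_neg] at h2
  have hD := DFun_ne (γ₂ := γ₂) hu ha hβ hre him
  have hγ := sub_ofReal_ne him γ₁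
  have hck : -conj k = k := by apply Complex.ext <;> simp [hre]
  rw [FFun, hck, conj_HFun hu hre him, JFun]
  have hD' : psiX u k + (γ₂ - β * k) * psi u 0 k = DFun u β γ₂ k := rfl
  have hD2 : psiX u k + (γ₂ + β * -k) * psi u 0 k = DFun u β γ₂ k := by rw [← hD']; ring
  rw [hD2] at h2
  rw [hD', HFun]
  field_simp
  linear_combination (k - γ₁) * h2 + (k + γ₁) * h1

end QuarterPlane

namespace QuarterPlane

open Filter Topology

/-! ### A boundary uniqueness theorem -/

theorem norm_reim_le_of_rotate {r : ℝ} {z : ℂ} (h1 : |z.re| ≤ r) (h2 : |z.im| ≤ r) (j : ℕ) :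
    |(Complex.I ^ j * z).re| ≤ r ∧ |(Complex.I ^ j * z).im| ≤ r := by
  induction j with
  | zero => simpa using ⟨h1, h2⟩
  | succ n ih =>
    rw [pow_succ, mul_comm _ Complex.I, mul_assoc]
    generalize Complex.I ^ n * z = w at ih
    simpa using ⟨ih.2, ih.1⟩

/-- A function holomorphic in a half strip, continuous up to the boundary, and zero on the real
half line, vanishes at the center of every square with a side on the half line. -/
theorem eq_zero_of_square {L : ℂ → ℂ} {η : ℝ} (hc : ContinuousOn L (Ici 0 ×ℂ Icc 0 η))
    (hd : DifferentiableOn ℂ L (Ioi 0 ×ℂ Ioo 0 η)) (h0 : ∀ x : ℝ, 0 < x → L x = 0) {c : ℂ}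
    (him : 0 < c.im) (hre : c.im < c.re) (hη : 2 * c.im < η) : L c = 0 := by
  set r := c.im with hr
  have hcl : closure (Ioo (-r) r ×ℂ Ioo (-r) r) = Icc (-r) r ×ℂ Icc (-r) r := by
    rw [Complex.closure_reProdIm, closure_Ioo (by linarith)]
  have hmaps : ∀ j : ℕ, MapsTo (fun z : ℂ => c + Complex.I ^ j * z) (Icc (-r) r ×ℂ Icc (-r) r)
      (Ici 0 ×ℂ Icc 0 η) := by
    intro j z hz
    obtain ⟨⟨h1, h2⟩, h3, h4⟩ := hz
    obtain ⟨h5, h6⟩ := norm_reim_le_of_rotate (abs_le.2 ⟨h1, h2⟩) (abs_le.2 ⟨h3, h4⟩) j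
    rw [abs_le] at h5 h6
    simp only [Complex.mem_reProdIm, Complex.add_re, Complex.add_im, mem_Ici, mem_Icc, ← hr]
    refine ⟨by linarith, by linarith, by linarith⟩
  have hmaps' : ∀ j : ℕ, MapsTo (fun z : ℂ => c + Complex.I ^ j * z) (Ioo (-r) r ×ℂ Ioo (-r) r)
      (Ioi 0 ×ℂ Ioo 0 η) := by
    intro j z hz
    obtain ⟨⟨h1, h2⟩, h3, h4⟩ := hz
    have hm : max |z.re| |z.im| < r := max_lt (abs_lt.2 ⟨h1, h2⟩) (abs_lt.2 ⟨h3, h4⟩)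
    obtain ⟨h5, h6⟩ := norm_reim_le_of_rotate (le_max_left |z.re| |z.im|)
      (le_max_right |z.re| |z.im|) j
    have h5' := abs_lt.1 (h5.trans_lt hm)
    have h6' := abs_lt.1 (h6.trans_lt hm)
    simp only [Complex.mem_reProdIm, Complex.add_re, Complex.add_im, mem_Ioi, mem_Ioo, ← hr]
    refine ⟨by linarith, by linarith, by linarith⟩
  have hj : ∀ j : ℕ, DiffContOnCl ℂ (fun z : ℂ => L (c + Complex.I ^ j * z))
      (Ioo (-r) r ×ℂ Ioo (-r) r) := by
    intro j
    refine ⟨hd.comp (by fun_prop) (hmaps' j), ?_⟩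
    rw [hcl]
    exact hc.comp (by fun_prop) (hmaps j)
  have hmul : ∀ {a b : ℂ → ℂ}, DiffContOnCl ℂ a (Ioo (-r) r ×ℂ Ioo (-r) r) →
      DiffContOnCl ℂ b (Ioo (-r) r ×ℂ Ioo (-r) r) →
      DiffContOnCl ℂ (fun z => a z * b z) (Ioo (-r) r ×ℂ Ioo (-r) r) := fun ha hb =>
    ⟨ha.differentiableOn.mul hb.differentiableOn, ha.continuousOn.mul hb.continuousOn⟩
  -- The product of the four rotated copies vanishes on the whole frontier, since each side of the
  -- square is carried by one rotation to the side on the real half line. The maximum principle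
  -- gives `L(c)⁴ = 0`.
  have hG := hmul (hmul (hj 0) (hj 1)) (hmul (hj 2) (hj 3))
  have hreal : ∀ w : ℂ, w.im = 0 → 0 < w.re → L w = 0 := fun w h1 h2 => by
    rw [show w = (w.re : ℂ) from Complex.ext rfl (by simp [h1])]
    exact h0 _ h2
  have hfr : ∀ z ∈ frontier (Ioo (-r) r ×ℂ Ioo (-r) r),
      ‖L (c + Complex.I ^ 0 * z) * L (c + Complex.I ^ 1 * z) *
        (L (c + Complex.I ^ 2 * z) * L (c + Complex.I ^ 3 * z))‖ ≤ 0 := by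
    intro z hz
    rw [norm_le_zero_iff]
    rw [Complex.frontier_reProdIm, closure_Ioo (by linarith), frontier_Ioo (by linarith)] at hz
    rcases hz with ⟨h1, h2⟩ | ⟨h1, h2⟩
    · obtain ⟨h3, h4⟩ : -r ≤ z.re ∧ z.re ≤ r := h1
      rcases h2 with h2 | h2
      · rw [hreal (c + Complex.I ^ 0 * z) (by simp [h2, hr]) (by simp; linarith)]
        simp
      · rw [hreal (c + Complex.I ^ 2 * z) (by simp [show z.im = r from h2, hr]) (by simp; linarith)]
        simp
    · obtain ⟨h3, h4⟩ : -r ≤ z.im ∧ z.im ≤ r := h2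
      rcases h1 with h1 | h1
      · rw [hreal (c + Complex.I ^ 1 * z) (by simp [h1, hr]) (by simp; linarith)]
        simp
      · rw [hreal (c + Complex.I ^ 3 * z) (by simp [show z.re = r from h1, hr, Complex.I_pow_three])
          (by simp [Complex.I_pow_three]; linarith)]
        simp
  have hz0 : (0 : ℂ) ∈ closure (Ioo (-r) r ×ℂ Ioo (-r) r) := by
    rw [hcl]
    simp [Complex.mem_reProdIm, him.le]
  have hbd : Bornology.IsBounded (Ioo (-r) r ×ℂ Ioo (-r) r) :=
    (Metric.isBounded_Ioo _ _).reProdIm (Metric.isBounded_Ioo _ _)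
  have := Complex.norm_le_of_forall_mem_frontier_norm_le hbd hG hfr hz0
  rw [norm_le_zero_iff] at this
  simpa using this

/-- The centers of admissible squares fill a nonempty open set. The identity theorem spreads the
zero over the connected open half strip, and continuity carries it to the closure, including the top
edge. -/
theorem eqOn_zero_of_real {L : ℂ → ℂ} {η : ℝ} (hη : 0 < η)
    (hc : ContinuousOn L (Ici 0 ×ℂ Icc 0 η)) (hd : DifferentiableOn ℂ L (Ioi 0 ×ℂ Ioo 0 η))
    (h0 : ∀ x : ℝ, 0 < x → L x = 0) : EqOn L (fun _ => 0) (Ici 0 ×ℂ Icc 0 η) := by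
  have hopen : IsOpen (Ioi 0 ×ℂ Ioo 0 η) := isOpen_Ioi.reProdIm isOpen_Ioo
  have hV : EqOn L (fun _ => 0) (Ioi 0 ×ℂ Ioo 0 η) := by
    have hconv : Convex ℝ (Ioi 0 ×ℂ Ioo 0 η) := 
      ((convex_Ioi (0 : ℝ)).linear_preimage Complex.reLm).inter
        ((convex_Ioo 0 η).linear_preimage Complex.imLm)
    refine (hd.analyticOnNhd hopen).eqOn_of_preconnected_of_eventuallyEq
      analyticOnNhd_const hconv.isPreconnected (z₀ := ⟨η, η / 4⟩) ?_ ?_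
    · simp only [Complex.mem_reProdIm, mem_Ioi, mem_Ioo]
      exact ⟨hη, by linarith, by linarith⟩
    · have h1 : IsOpen {c : ℂ | 0 < c.im} := isOpen_lt continuous_const Complex.continuous_im
      have h2 : IsOpen {c : ℂ | c.im < c.re} := isOpen_lt Complex.continuous_im Complex.continuous_re
      have h3 : IsOpen {c : ℂ | 2 * c.im < η} :=
        isOpen_lt (continuous_const.mul Complex.continuous_im) continuous_const
      filter_upwards [h1.mem_nhds (show 0 < η / 4 by linarith),
        h2.mem_nhds (show η / 4 < η by linarith),
        h3.mem_nhds (show 2 * (η / 4) < η by linarith)] with c hc1 hc2 hc3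
      exact eq_zero_of_square hc hd h0 hc1 hc2 hc3
  refine hV.of_subset_closure hc continuousOn_const
    (Complex.reProdIm_subset_iff.2 (prod_mono Ioi_subset_Ici_self Ioo_subset_Icc_self)) ?_
  rw [Complex.closure_reProdIm, closure_Ioi, closure_Ioo hη.ne]

/-! ### Growth of the Dirichlet solution and exponential decay of the boundary data -/

variable {u : ℝ → ℝ} {β γ₁ γ₂ : ℝ} {f g : ℝ → ℝ} {q : ℝ → ℝ → ℝ}

/-- In `n_x = e^{2ikx} - ∫_0^x e^{2ik(x-ξ)} u n`, each exponential decays as `x → ∞`, and `|u n|`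
has an integrable majorant by the linear bound of `n`. -/
theorem tendsto_dirDN (hu : LinePotential u) {k : ℂ} (hk : 0 < k.im) :
    Tendsto (dirDN u k) atTop (𝓝 0) := by
  have hku : k ∈ upper := hk.le
  have hexp : Tendsto (fun t : ℝ => Complex.exp (2 * Complex.I * k * t)) atTop (𝓝 0) := by
    rw [tendsto_zero_iff_norm_tendsto_zero]
    have h1 : ∀ t : ℝ, ‖Complex.exp (2 * Complex.I * k * t)‖ = Real.exp (-(2 * k.im * t)) := by
      intro t
      rw [Complex.norm_exp]
      simp
    simp only [h1]
    exact Real.tendsto_exp_neg_atTop_nhds_zero.comp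
      (tendsto_id.const_mul_atTop (by positivity))
  have hint : Tendsto (fun x : ℝ => ∫ ξ in Ioi (0 : ℝ), (Iic x).indicator (fun ξ : ℝ =>
      Complex.exp (2 * Complex.I * k * (x - ξ : ℝ)) * (u ξ * dirN u k ξ)) ξ) atTop
      (𝓝 (∫ ξ in Ioi (0 : ℝ), (0 : ℂ))) := by
    refine tendsto_integral_filter_of_dominated_convergence
      (fun ξ => potBound u * momentDensity u ξ) ?_ ?_
      (hu.integrable_moment.const_mul _).integrableOn ?_
    · refine Eventually.of_forall fun x => Measurable.aestronglyMeasurable ?_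
      refine Measurable.indicator ?_ measurableSet_Iic
      have := measurable_dirN hu hku
      have := hu.continuous.measurable
      fun_prop
    · refine Eventually.of_forall fun x => ?_
      refine (ae_restrict_iff' measurableSet_Ioi).2 (Eventually.of_forall fun ξ hξ => ?_)
      have h1 := norm_u_mul_dirN_le hu hku (le_of_lt hξ)
      by_cases hx : ξ ∈ Iic x
      · rw [indicator_of_mem hx, norm_mul]
        refine le_trans ?_ h1
        refine mul_le_of_le_one_left (norm_nonneg _) (norm_exp_two_le hku (sub_nonneg.2 hx))
      · rw [indicator_of_notMem hx, norm_zero]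
        exact (norm_nonneg _).trans h1
    · refine Eventually.of_forall fun ξ => ?_
      have h2 : Tendsto (fun x : ℝ => Complex.exp (2 * Complex.I * k * (x - ξ : ℝ)) *
          (u ξ * dirN u k ξ)) atTop (𝓝 0) := by
        have := (hexp.comp (tendsto_atTop_add_const_right atTop (-ξ) tendsto_id)).mul_const
          ((u ξ : ℂ) * dirN u k ξ)
        rw [zero_mul] at this
        exact this
      refine h2.congr' ?_
      filter_upwards [eventually_ge_atTop ξ] with x hx
      rw [indicator_of_mem (mem_Iic.2 hx)]
  have heq : dirDN u k =ᶠ[atTop] fun x => Complex.exp (2 * Complex.I * k * x)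
      - ∫ ξ in Ioi (0 : ℝ), (Iic x).indicator (fun ξ : ℝ =>
        Complex.exp (2 * Complex.I * k * (x - ξ : ℝ)) * (u ξ * dirN u k ξ)) ξ := by
    filter_upwards [eventually_ge_atTop 0] with x hx
    rw [dirDN_eq, intervalIntegral.integral_of_le hx, setIntegral_indicator measurableSet_Iic,
      Ioi_inter_Iic]
  refine Tendsto.congr' heq.symm ?_
  simpa using hexp.sub hint

/-- The Wronskian of `s` and `ψ` can be solved for `n`: as `n_x → 0`, `m → 1` and `m_x → 0`, it
shows that `n` tends to `-m(0)/(2ik)`, which is nonzero. -/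
theorem eventually_le_norm_dirN (hu : LinePotential u) {k : ℂ} (hk : 0 < k.im)
    (hm : jostM u k 0 ≠ 0) : ∃ c > 0, ∃ X, 0 ≤ X ∧ ∀ x, X ≤ x → c ≤ ‖dirN u k x‖ := by
  have hku : k ∈ upper := hk.le
  have hk0 : k ≠ 0 := ne_zero_of_im_pos hk
  have h1 : Tendsto (fun x => 2 * Complex.I * k * jostM u k x + jostDM u k x) atTop
      (𝓝 (2 * Complex.I * k * 1 + 0)) :=
    ((tendsto_jostM hu hku).const_mul _).add (tendsto_jostDM hu hku)
  have h2 : Tendsto (fun x => dirDN u k x * jostM u k x - jostM u k 0) atTop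
      (𝓝 (0 * 1 - jostM u k 0)) := ((tendsto_dirDN hu hk).mul (tendsto_jostM hu hku)).sub_const _
  have hne : 2 * Complex.I * k * 1 + 0 ≠ 0 := by simp [hk0]
  have h3 : Tendsto (dirN u k) atTop
      (𝓝 ((0 * 1 - jostM u k 0) / (2 * Complex.I * k * 1 + 0))) := by
    refine (h2.div h1 hne).congr' ?_
    filter_upwards [h1.eventually_ne hne, eventually_ge_atTop 0] with x hx hx0
    rw [Pi.div_apply, div_eq_iff hx]
    linear_combination -wronskian_dir_jost hu hku hx0
  have h4 : (0 : ℝ) < ‖(0 * 1 - jostM u k 0) / (2 * Complex.I * k * 1 + 0)‖ := by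
    rw [norm_pos_iff]
    exact div_ne_zero (by simpa using hm) hne
  obtain ⟨X, hX⟩ := eventually_atTop.1 (h3.norm.eventually_const_le (half_lt_self h4))
  exact ⟨_, half_pos h4, max X 0, le_max_right _ _, fun x hx => hX x ((le_max_left _ _).trans hx)⟩

theorem norm_dirS_eq (k : ℂ) (x : ℝ) : ‖dirS u k x‖ = Real.exp (k.im * x) * ‖dirN u k x‖ := by
  rw [dirS, norm_mul, Complex.norm_exp]
  simp

/-- Integrability against the Dirichlet solution forces exponential decay. -/
theorem integrableOn_exp_mul_of_dirS (hu : LinePotential u) {k : ℂ} (hk : 0 < k.im)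
    (hm : jostM u k 0 ≠ 0) {h : ℝ → ℝ} (hc : ContinuousOn h (Ici 0))
    (hi : IntegrableOn (fun x => (h x : ℂ) * dirS u k x) (Ioi 0)) :
    IntegrableOn (fun x => Real.exp (k.im * x) * h x) (Ioi 0) := by
  obtain ⟨c, hc0, X, hX0, hX⟩ := eventually_le_norm_dirN hu hk hm
  have hcont : ContinuousOn (fun x => Real.exp (k.im * x) * h x) (Ici 0) :=
    (by fun_prop : Continuous fun x : ℝ => Real.exp (k.im * x)).continuousOn.mul hc
  rw [← Ioc_union_Ioi_eq_Ioi hX0]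
  refine IntegrableOn.union ?_ ?_
  · exact ((hcont.mono Icc_subset_Ici_self).integrableOn_Icc).mono_set Ioc_subset_Icc_self
  · refine Integrable.mono' ((hi.mono_set (Ioi_subset_Ioi hX0)).norm.const_mul c⁻¹) ?_ ?_
    · exact (hcont.mono (Ioi_subset_Ici hX0)).aestronglyMeasurable measurableSet_Ioi
    · refine (ae_restrict_iff' measurableSet_Ioi).2 (Eventually.of_forall fun x hx => ?_)
      have h1 := hX x (le_of_lt hx)
      rw [norm_mul, norm_mul, Complex.norm_real, norm_dirS_eq, Real.norm_of_nonneg (Real.exp_pos _).le,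
        ← div_eq_inv_mul, le_div_iff₀ hc0]
      have h2 : 0 ≤ Real.exp (k.im * x) * ‖h x‖ := by positivity
      nlinarith [mul_le_mul_of_nonneg_left h1 h2]

section DirichletTransform

variable {h : ℝ → ℝ} {η : ℝ}

/-- The factor `k` makes the majorant uniform down to `k = 0`, because `k n` is bounded there
independently of `x`. -/
theorem norm_mul_dirS_mul_le (hu : LinePotential u) {k : ℂ} (hk : 0 ≤ k.im) (hkη : k.im ≤ η)
    {x : ℝ} (hx : 0 ≤ x) :
    ‖k * dirS u k x * h x‖ ≤ dirBound u * ‖Real.exp (η * x) * h x‖ := by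
  have h1 := norm_mul_dirN_le hu (show k ∈ upper from hk) hx
  rw [norm_mul, norm_mul, norm_dirS_eq, Complex.norm_real, norm_mul,
    Real.norm_of_nonneg (Real.exp_pos _).le]
  have h2 : Real.exp (k.im * x) ≤ Real.exp (η * x) :=
    Real.exp_le_exp.2 (mul_le_mul_of_nonneg_right hkη hx)
  calc ‖k‖ * (Real.exp (k.im * x) * ‖dirN u k x‖) * ‖h x‖
      = (‖k‖ * ‖dirN u k x‖) * (Real.exp (k.im * x) * ‖h x‖) := by ring
    _ ≤ dirBound u * (Real.exp (η * x) * ‖h x‖) := by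
        refine mul_le_mul h1 (mul_le_mul_of_nonneg_right h2 (norm_nonneg _)) (by positivity)
          (zero_le_one.trans (one_le_dirBound u))

theorem aestronglyMeasurable_dirS_mul (hu : LinePotential u) (hc : ContinuousOn h (Ici 0)) {k : ℂ}
    (hk : 0 ≤ k.im) : AEStronglyMeasurable (fun x => k * dirS u k x * h x)
      (volume.restrict (Ioi 0)) := by
  have h1 : ContinuousOn (fun x => k * dirS u k x * h x) (Ici 0) :=
    (continuousOn_const.mul (dirS_isODE hu (show k ∈ upper from hk)).continuousOn).mul
      (Complex.continuous_ofReal.comp_continuousOn hc)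
  exact (h1.mono Ioi_subset_Ici_self).aestronglyMeasurable measurableSet_Ioi

theorem continuousOn_dirTransform (hu : LinePotential u) (hc : ContinuousOn h (Ici 0))
    (hi : IntegrableOn (fun x => Real.exp (η * x) * h x) (Ioi 0)) :
    ContinuousOn (fun k => ∫ x in Ioi (0 : ℝ), k * dirS u k x * h x) (Ici 0 ×ℂ Icc 0 η) := by
  refine continuousOn_of_dominated (bound := fun x => dirBound u * ‖Real.exp (η * x) * h x‖)
    ?_ ?_ (hi.norm.const_mul _) ?_
  · intro k hk
    exact aestronglyMeasurable_dirS_mul hu hc hk.2.1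
  · intro k hk
    exact (ae_restrict_iff' measurableSet_Ioi).2 (Eventually.of_forall fun x hx =>
      norm_mul_dirS_mul_le hu hk.2.1 hk.2.2 (le_of_lt hx))
  · refine Eventually.of_forall fun x => ?_
    have h1 := (continuousOn_dirN_left hu x).mono (show Ici 0 ×ℂ Icc 0 η ⊆ upper from
      fun k hk => hk.2.1)
    simp only [dirS]
    exact (continuousOn_id.mul ((by fun_prop : Continuous fun k : ℂ =>
      Complex.exp (-(Complex.I * k) * x)).continuousOn.mul h1)).mul continuousOn_const

theorem differentiableOn_dirTransform (hu : LinePotential u) (hc : ContinuousOn h (Ici 0))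
    (hi : IntegrableOn (fun x => Real.exp (η * x) * h x) (Ioi 0)) :
    DifferentiableOn ℂ (fun k => ∫ x in Ioi (0 : ℝ), k * dirS u k x * h x)
      (Ioi 0 ×ℂ Ioo 0 η) := by
  refine differentiableOn_integral_of_dominated (isOpen_Ioi.reProdIm isOpen_Ioo)
    (bound := fun x => dirBound u * ‖Real.exp (η * x) * h x‖) ?_ ?_ ?_ (hi.norm.const_mul _)
  · intro k hk
    exact aestronglyMeasurable_dirS_mul hu hc hk.2.1.le
  · refine Eventually.of_forall fun x => ?_
    have h1 := (differentiableOn_dirN_left hu x).mono (show Ioi 0 ×ℂ Ioo 0 η ⊆ upperO from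
      fun k hk => hk.2.1)
    simp only [dirS]
    exact (differentiableOn_id.mul ((by fun_prop : Differentiable ℂ fun k : ℂ =>
      Complex.exp (-(Complex.I * k) * x)).differentiableOn.mul h1)).mul
      (differentiableOn_const _)
  · exact (ae_restrict_iff' measurableSet_Ioi).2 (Eventually.of_forall fun x hx k hk =>
      norm_mul_dirS_mul_le hu hk.2.1.le hk.2.2.le (le_of_lt hx))

end DirichletTransform

/-! ### The Dirichlet relation -/

namespace IsSolution

theorem continuousOn_bottom (hq : IsSolution u β γ₁ γ₂ f g q) :
    ContinuousOn (fun x => q x 0) (Ici 0) := continuousOn_left hq.continuousOn le_rfl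

theorem continuousOn_partialY_bottom (hq : IsSolution u β γ₁ γ₂ f g q) :
    ContinuousOn (fun x => partialY q x 0) (Ici 0) :=
  continuousOn_left hq.continuousOn_partialY le_rfl

end IsSolution

/-- Green's identity with the Dirichlet solution, for positive `k`. -/
theorem dirichlet_relation_of_pos (hu : LinePotential u) (hq : IsSolution u β γ₁ γ₂ f g q) {k : ℝ}
    (hk : 0 < k) : g0 q (-k) = (∫ x in Ioi (0 : ℝ), (partialY q x 0 : ℂ) * dirS u k x)
      + k * ∫ x in Ioi (0 : ℝ), (q x 0 : ℂ) * dirS u k x := by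
  have him : (k : ℂ).im = 0 := Complex.ofReal_im k
  have hku : (k : ℂ) ∈ upper := him.ge
  have hk0 : (k : ℂ) ≠ 0 := Complex.ofReal_ne_zero.2 hk.ne'
  have hs := dirS_isODE hu hku
  have hA : ∀ x, 0 ≤ x → ‖dirS u k x‖ ≤ dirBound u / ‖(k : ℂ)‖ :=
    fun x hx => norm_dirS_le_of_real hu him hk0 hx
  have h := green_half hq (κ := k) rfl (by simpa using hk.le) hs hA
    (fun x hx => norm_dirDS_le_of_real hu him hx) le_rfl
  rw [dirS_zero, dirDS_zero, one_mul, zero_mul, sub_zero] at h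
  rw [g0_eq_laplaceY, neg_neg, h, ← integral_const_mul,
    ← integral_add (hq.integrableOn_qy_mul hs.continuousOn hA)
      ((hq.integrableOn_q_mul hs.continuousOn hA).const_mul _)]
  congr 1
  funext x
  ring

/-- Green's identity with the Dirichlet solution, continued into the first quadrant. -/
theorem dirichlet_relation (hu : LinePotential u) (hq : IsSolution u β γ₁ γ₂ f g q) {k : ℂ}
    (hm : jostM u k 0 ≠ 0)
    (hre : 0 ≤ k.re) (him : 0 ≤ k.im) (hk0 : k ≠ 0)
    (hiq : IntegrableOn (fun x => (q x 0 : ℂ) * dirS u k x) (Ioi 0))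
    (hiy : IntegrableOn (fun x => (partialY q x 0 : ℂ) * dirS u k x) (Ioi 0)) :
    g0 q (-k) = (∫ x in Ioi (0 : ℝ), (partialY q x 0 : ℂ) * dirS u k x)
      + k * ∫ x in Ioi (0 : ℝ), (q x 0 : ℂ) * dirS u k x := by
  rcases him.eq_or_lt with h | h
  · have hkr : k = (k.re : ℂ) := Complex.ext rfl (by simp [← h])
    have hpos : 0 < k.re := hre.lt_of_ne fun h' => hk0 (by rw [hkr, ← h', Complex.ofReal_zero])
    rw [hkr]
    exact dirichlet_relation_of_pos hu hq hpos
  have hcq := hq.continuousOn_bottom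
  have hcy := hq.continuousOn_partialY_bottom
  have heq := integrableOn_exp_mul_of_dirS hu h hm hcq hiq
  have hey := integrableOn_exp_mul_of_dirS hu h hm hcy hiy
  have hmaps : MapsTo (fun z : ℂ => -z) (Ici 0 ×ℂ Icc 0 k.im) {z : ℂ | z.re ≤ 0} :=
    fun z hz => by simpa using hz.1
  have hmaps' : MapsTo (fun z : ℂ => -z) (Ioi 0 ×ℂ Ioo 0 k.im) {z : ℂ | z.re < 0} :=
    fun z hz => by simpa using hz.1
  -- The relation is multiplied by `z`, so that it is continuous up to the corner `z = 0`. The half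
  -- strip has height `Im k`, the exact rate of the exponential decay just obtained, and `k` lies on
  -- its top edge.
  have key := eqOn_zero_of_real (L := fun z => (∫ x in Ioi (0 : ℝ), z * dirS u z x * partialY q x 0)
    + z * (∫ x in Ioi (0 : ℝ), z * dirS u z x * q x 0) - z * g0 q (-z)) h
    (((continuousOn_dirTransform hu hcy hey).add
      (continuousOn_id.mul (continuousOn_dirTransform hu hcq heq))).sub
      (continuousOn_id.mul ((g0_continuousOn hq).comp continuous_neg.continuousOn hmaps)))
    (((differentiableOn_dirTransform hu hcy hey).add
      (differentiableOn_id.mul (differentiableOn_dirTransform hu hcq heq))).sub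
      (differentiableOn_id.mul ((g0_analytic hq).differentiableOn.comp
        differentiable_neg.differentiableOn hmaps'))) ?_
  · have h1 := key (show k ∈ Ici 0 ×ℂ Icc 0 k.im from ⟨hre, him, le_rfl⟩)
    beta_reduce at h1
    simp only [mul_assoc, integral_const_mul] at h1
    simp only [mul_comm _ (dirS u k _)]
    refine mul_left_cancel₀ hk0 ?_
    linear_combination -h1
  · intro x hx
    have h1 := dirichlet_relation_of_pos hu hq hx
    simp only [mul_assoc, integral_const_mul]
    simp only [mul_comm _ (dirS u _ _)] at h1
    linear_combination -(x : ℂ) * h1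

/-! ### The formula for `ρ` -/

theorem phiTransform_eq (hu : LinePotential u) {k : ℂ} (hk : k ∈ upper) (hk0 : k ≠ 0)
    (hm : jostM u k 0 ≠ 0) {h : ℝ → ℝ}
    (h1 : IntegrableOn (fun x => (h x : ℂ) * psi u x k) (Ioi 0))
    (h2 : IntegrableOn (fun x => (h x : ℂ) * dirS u k x) (Ioi 0)) :
    phiTransform u h k = psiTransform u h k / jostM u k 0 - 2 * Complex.I * k * aCoef u k /
      jostM u k 0 * ∫ x in Ioi (0 : ℝ), (h x : ℂ) * dirS u k x := by
  rw [psiTransform, div_eq_inv_mul, ← integral_const_mul, ← integral_const_mul,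
    ← integral_sub (h1.const_mul _) (h2.const_mul _), phiTransform]
  refine setIntegral_congr_fun measurableSet_Ioi fun x hx => ?_
  simp only [phi_eq hu hk hk0 hm (le_of_lt hx)]
  ring

/-- The spectral function in terms of the Dirichlet transform of the boundary flux. -/
theorem rho_eq_dirichlet (hu : LinePotential u) (ha : ∀ k ∈ upper, k ≠ 0 → aCoef u k ≠ 0)
    (hq : IsSolution u β γ₁ γ₂ f g q) {k : ℂ} (hre : 0 ≤ k.re) (him : 0 ≤ k.im) (hk0 : k ≠ 0)
    (hiq : IntegrableOn (fun x => (q x 0 : ℂ) * dirS u k x) (Ioi 0))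
    (hiy : IntegrableOn (fun x => (partialY q x 0 : ℂ) * dirS u k x) (Ioi 0)) :
    rho u q k = (2 * (∫ x in Ioi (0 : ℝ), (partialY q x 0 : ℂ) * dirS u k x) - g0 q (-k))
      / jostM u k 0 := by
  have hku : k ∈ upper := him
  have hm := jostM_zero_ne hu ha hku
  have ha' := ha k hku hk0
  have hpq := hq.integrableOn_q_mul (psi_isJost hu hku hk0).continuousOn
    fun x hx => norm_psi_le hu hku hk0 hx
  rw [rho, f0, phiTransform_eq hu hku hk0 hm hpq hiq, phi_zero hu hk0, psi_zero hu hku hk0,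
    dirichlet_relation hu hq hm hre him hk0 hiq hiy]
  field_simp
  ring

/-- Writing `Y` and `Q` for the integrals of `q_y(·,0)` and `q(·,0)` against `s`, one has `g₀(-k) =
Y + kQ` and `∫ f s = Y + γ₁ Q`. These determine `(k - γ₁) Y` by `f` and `g₀`, and `ρ` is `(2Y -
g₀(-k))/ψ(0)`. -/
theorem rho_eq (hu : LinePotential u) (ha : ∀ k ∈ upper, k ≠ 0 → aCoef u k ≠ 0)
    (hq : IsSolution u β γ₁ γ₂ f g q) {k : ℂ} (hre : 0 ≤ k.re) (him : 0 ≤ k.im) (hk0 : k ≠ 0)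
    (hkγ : k ≠ γ₁) (hiq : IntegrableOn (fun x => (q x 0 : ℂ) * phi u x k) (Ioi 0))
    (hif : IntegrableOn (fun x => (f x : ℂ) * phi u x k) (Ioi 0)) :
    rho u q k = -((k + γ₁) / (k - γ₁)) * (g0 q (-k) / psi u 0 k) + NFun u f γ₁ k := by
  have hku : k ∈ upper := him
  have hm := jostM_zero_ne hu ha hku
  have ha' := ha k hku hk0
  have hγ : k - γ₁ ≠ 0 := sub_ne_zero.2 hkγ
  have hJ := psi_isJost hu hku hk0
  have hpq := hq.integrableOn_q_mul hJ.continuousOn fun x hx => norm_psi_le hu hku hk0 hx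
  have hpy := hq.integrableOn_qy_mul hJ.continuousOn fun x hx => norm_psi_le hu hku hk0 hx
  have hpf := hq.integrableOn_f_mul hJ.continuousOn fun x hx => norm_psi_le hu hku hk0 hx
  have hs : ∀ x ∈ Ioi (0 : ℝ), dirS u k x = (jostM u k 0 / (2 * Complex.I * k * aCoef u k)) *
      (1 / jostM u k 0 * psi u x k - phi u x k) := by
    intro x hx
    rw [phi_eq hu hku hk0 hm (le_of_lt hx)]
    field_simp [Complex.I_ne_zero]
    ring
  have hsi : ∀ {h : ℝ → ℝ}, IntegrableOn (fun x => (h x : ℂ) * phi u x k) (Ioi 0) →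
      IntegrableOn (fun x => (h x : ℂ) * psi u x k) (Ioi 0) →
      IntegrableOn (fun x => (h x : ℂ) * dirS u k x) (Ioi 0) := by
    intro h h1 h2
    refine IntegrableOn.congr_fun (((h2.const_mul (1 / jostM u k 0)).sub h1).const_mul
      (jostM u k 0 / (2 * Complex.I * k * aCoef u k))) (fun x hx => ?_) measurableSet_Ioi
    simp only [Pi.sub_apply, hs x hx]
    ring
  have hiy : IntegrableOn (fun x => (partialY q x 0 : ℂ) * phi u x k) (Ioi 0) := by
    refine (hif.sub (hiq.const_mul (γ₁ : ℂ))).congr_fun (fun x hx => ?_) measurableSet_Ioi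
    simp only [Pi.sub_apply, hq.f_eq hx]
    ring
  have hsq := hsi hiq hpq
  have hsy := hsi hiy hpy
  have hrel := dirichlet_relation hu hq hm hre him hk0 hsq hsy
  have hsf := hq.integral_f_mul hsy hsq
  rw [rho_eq_dirichlet hu ha hq hre him hk0 hsq hsy, NFun,
    phiTransform_eq hu hku hk0 hm hpf (hsi hif hpf), phi_zero hu hk0, psi_zero hu hku hk0, hsf, hrel]
  field_simp
  ring

end QuarterPlane

namespace QuarterPlane

open Filter Topology

/-! ### Integrals over symmetric domains -/

section Symmetric

variable {E : Type*} [NormedAddCommGroup E]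

theorem integrable_of_comp_neg {F : ℝ → E} (h1 : IntegrableOn F (Ioi 0))
    (h2 : IntegrableOn (fun t => F (-t)) (Ioi 0)) : Integrable F := by
  rw [← integrableOn_univ, ← Iic_union_Ioi (a := (0 : ℝ))]
  refine IntegrableOn.union ?_ h1
  have h3 := (Measure.measurePreserving_neg (volume : Measure ℝ)).integrableOn_comp_preimage
    (Homeomorph.neg ℝ).measurableEmbedding (f := fun t => F (-t)) (s := Ici 0)
  have h4 := h3.2 ((integrableOn_Ici_iff_integrableOn_Ioi).2 h2)
  have h5 : (Neg.neg ⁻¹' Ici (0 : ℝ)) = Iic 0 := by ext; simp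
  rw [h5] at h4
  exact h4.congr_fun (fun x _ => by simp) measurableSet_Iic

variable [NormedSpace ℝ E]

theorem integral_eq_integral_Ioi {F : ℝ → E} (h1 : IntegrableOn F (Ioi 0))
    (h2 : IntegrableOn (fun t => F (-t)) (Ioi 0)) :
    ∫ t, F t = ∫ t in Ioi (0 : ℝ), (F t + F (-t)) := by
  have h := integrable_of_comp_neg h1 h2
  rw [integral_add h1 h2, integral_comp_neg_Ioi, neg_zero, add_comm,
    ← setIntegral_union (Iic_disjoint_Ioi le_rfl) measurableSet_Ioi h.integrableOn h1,
    Iic_union_Ioi, setIntegral_univ]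

end Symmetric

theorem integral_exp_neg_mul_abs {κ : ℝ} (hκ : 0 < κ) :
    ∫ t : ℝ, Real.exp (-(κ * |t|)) = 2 / κ := by
  rw [integral_comp_abs (f := fun t => Real.exp (-(κ * t)))]
  have := integral_exp_mul_Ioi (a := -κ) (by linarith) 0
  simp only [neg_mul, mul_zero, Real.exp_zero] at this
  rw [this]
  field_simp

theorem integrable_exp_neg_mul_abs_sub {κ : ℝ} (hκ : 0 < κ) (x : ℝ) :
    Integrable fun t : ℝ => Real.exp (-(κ * |x - t|)) := by
  have : Integrable fun t : ℝ => Real.exp (-(κ * |t|)) :=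
    Integrable.of_integral_ne_zero (by rw [integral_exp_neg_mul_abs hκ]; positivity)
  exact this.comp_sub_left x

theorem setIntegral_exp_neg_mul_abs_sub_le {κ : ℝ} (hκ : 0 < κ) (x : ℝ) :
    ∫ t in Ioi (0 : ℝ), Real.exp (-(κ * |x - t|)) ≤ 2 / κ := by
  rw [← integral_exp_neg_mul_abs hκ, ← integral_sub_left_eq_self _ volume x]
  exact setIntegral_le_integral (integrable_exp_neg_mul_abs_sub hκ x)
    (Eventually.of_forall fun t => (Real.exp_pos _).le)

/-! ### Rotation of the contour of integration -/

/-- Rotation of a Laplace integral over the positive half line onto the imaginary axis. -/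
theorem integral_exp_mul_rotate {Φ : ℂ → ℂ} {C y : ℝ} (hc : ContinuousOn Φ (Ici 0 ×ℂ Ici 0))
    (hd : DifferentiableOn ℂ Φ (Ioi 0 ×ℂ Ioi 0))
    (hC : ∀ k ∈ Ici 0 ×ℂ Ici 0, ‖k‖ * ‖Φ k‖ ≤ C) (hy : 0 < y)
    (hr : IntegrableOn (fun k : ℝ => Complex.exp (-k * y) * Φ k) (Ioi 0))
    (hi : IntegrableOn (fun s : ℝ => Complex.exp (-(Complex.I * s) * y) * Φ (Complex.I * s))
      (Ioi 0)) :
    ∫ k in Ioi (0 : ℝ), Complex.exp (-k * y) * Φ k =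
      Complex.I * ∫ s in Ioi (0 : ℝ), Complex.exp (-(Complex.I * s) * y) * Φ (Complex.I * s) := by
  set F : ℂ → ℂ := fun k => Complex.exp (-k * y) * Φ k with hF
  have hFc : ContinuousOn F (Ici 0 ×ℂ Ici 0) :=
    (by fun_prop : Continuous fun k : ℂ => Complex.exp (-k * y)).continuousOn.mul hc
  have hFd : DifferentiableOn ℂ F (Ioi 0 ×ℂ Ioi 0) :=
    (by fun_prop : Differentiable ℂ fun k : ℂ => Complex.exp (-k * y)).differentiableOn.mul hd
  have hFn : ∀ k ∈ Ici 0 ×ℂ Ici 0, ∀ K : ℝ, 0 < K → K ≤ ‖k‖ →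
      ‖F k‖ ≤ Real.exp (-(y * k.re)) * (C / K) := by
    intro k hk K hK hKk
    rw [hF, norm_mul, Complex.norm_exp]
    have h1 : (-k * (y : ℂ)).re = -(y * k.re) := by simp [mul_comm]
    rw [h1]
    refine mul_le_mul_of_nonneg_left ?_ (Real.exp_pos _).le
    rw [le_div_iff₀ hK, mul_comm]
    exact (mul_le_mul_of_nonneg_right hKk (norm_nonneg _)).trans (hC k hk)
  have hrect : ∀ K : ℝ, 0 < K → (((∫ x : ℝ in (0 : ℝ)..K, F x)
      - ∫ x : ℝ in (0 : ℝ)..K, F (x + K * Complex.I))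
      + Complex.I * ∫ s : ℝ in (0 : ℝ)..K, F (K + s * Complex.I))
      - Complex.I * ∫ s : ℝ in (0 : ℝ)..K, F (Complex.I * s) = 0 := by
    intro K hK
    have := Complex.integral_boundary_rect_eq_zero_of_continuousOn_of_differentiableOn F 0
      (⟨K, K⟩ : ℂ) (hFc.mono ?_) (hFd.mono ?_)
    · simpa [mul_comm _ Complex.I] using this
    · rw [Complex.zero_re, Complex.zero_im, uIcc_of_le hK.le]
      exact Complex.reProdIm_subset_iff.2 (prod_mono Icc_subset_Ici_self Icc_subset_Ici_self)
    · rw [Complex.zero_re, Complex.zero_im, min_eq_left hK.le, max_eq_right hK.le]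
      exact Complex.reProdIm_subset_iff.2 (prod_mono Ioo_subset_Ioi_self Ioo_subset_Ioi_self)
  have ht1 := intervalIntegral_tendsto_integral_Ioi 0 hr tendsto_id
  have ht4 := intervalIntegral_tendsto_integral_Ioi 0 hi tendsto_id
  -- On the top side the exponential is integrable along the side and `|Φ| ≤ C/K` supplies the
  -- decay.
  have ht2 : Tendsto (fun K : ℝ => ∫ x : ℝ in (0 : ℝ)..K, F (x + K * Complex.I)) atTop (𝓝 0) := by
    have hexp : IntegrableOn (fun x : ℝ => Real.exp (-(y * x))) (Ioi 0) := by
      simpa using exp_neg_integrableOn_Ioi 0 hy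
    have h1 := (intervalIntegral_tendsto_integral_Ioi 0 hexp tendsto_id).mul
      (tendsto_const_nhds (x := C).div_atTop tendsto_id)
    rw [mul_zero] at h1
    refine squeeze_zero_norm' ?_ h1
    filter_upwards [eventually_gt_atTop 0] with K hK
    simp only [id]
    rw [← intervalIntegral.integral_mul_const]
    refine intervalIntegral.norm_integral_le_of_norm_le hK.le (Eventually.of_forall fun x hx => ?_)
      ((by fun_prop : Continuous fun x : ℝ =>
        Real.exp (-(y * x)) * (C / K)).intervalIntegrable _ _)
    have hre : ((x : ℂ) + K * Complex.I).re = x := by simp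
    have him : ((x : ℂ) + K * Complex.I).im = K := by simp
    have := hFn (x + K * Complex.I) ⟨by simpa using hx.1.le, by simpa using hK.le⟩ K hK (by
      have := Complex.abs_im_le_norm ((x : ℂ) + K * Complex.I)
      rwa [him, abs_of_pos hK] at this)
    rwa [hre] at this
  -- On the right side the roles change: the bound `C/K` only compensates the length `K`, and
  -- `e^{-yK}` supplies the decay.
  have ht3 : Tendsto (fun K : ℝ => ∫ s : ℝ in (0 : ℝ)..K, F (K + s * Complex.I)) atTop (𝓝 0) := by
    have h1 : Tendsto (fun K : ℝ => Real.exp (-(y * K)) * C) atTop (𝓝 (0 * C)) :=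
      (Real.tendsto_exp_neg_atTop_nhds_zero.comp (tendsto_id.const_mul_atTop hy)).mul_const C
    rw [zero_mul] at h1
    refine squeeze_zero_norm' ?_ h1
    filter_upwards [eventually_gt_atTop 0] with K hK
    have h2 := intervalIntegral.norm_integral_le_of_norm_le_const (a := 0) (b := K)
      (f := fun s : ℝ => F (K + s * Complex.I)) (C := Real.exp (-(y * K)) * (C / K)) ?_
    · refine h2.trans (le_of_eq ?_)
      rw [sub_zero, abs_of_pos hK]
      field_simp
    · intro s hs
      rw [uIoc_of_le hK.le] at hs
      have hre : ((K : ℂ) + s * Complex.I).re = K := by simp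
      have := hFn (K + s * Complex.I) ⟨by simpa using hK.le, by simpa using hs.1.le⟩ K hK (by
        have := Complex.abs_re_le_norm ((K : ℂ) + s * Complex.I)
        rwa [hre, abs_of_pos hK] at this)
      rwa [hre] at this
  have hlim := ((ht1.sub ht2).add (ht3.const_mul Complex.I)).sub (ht4.const_mul Complex.I)
  have hzero := tendsto_nhds_unique (hlim.congr' (by
    filter_upwards [eventually_gt_atTop 0] with K hK
    exact hrect K hK)) tendsto_const_nhds
  simp only [sub_zero, mul_zero, add_zero] at hzero
  exact sub_eq_zero.1 hzero

/-! ### The cosine inversion formula -/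

/-- Fourier inversion for the even extension of `h`, which is continuous because it is `h(|t|)`. Its
transform is `T(2πw)`, also even, so both integrals fold onto the half line. -/
theorem cosine_inversion {h : ℝ → ℝ} (hc : ContinuousOn h (Ici 0)) (hh : IntegrableOn h (Ioi 0))
    {T : ℝ → ℂ} (hT : ∀ κ, T κ = (∫ t in Ioi (0 : ℝ), Complex.exp (-(Complex.I * κ * t)) * (h t : ℂ))
      + ∫ t in Ioi (0 : ℝ), Complex.exp (Complex.I * κ * t) * (h t : ℂ))
    (hTi : IntegrableOn T (Ioi 0)) {y : ℝ} (hy : 0 ≤ y) :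
    2 * Real.pi * (h y : ℂ) = ∫ κ in Ioi (0 : ℝ),
      (Complex.exp (Complex.I * κ * y) + Complex.exp (-(Complex.I * κ * y))) * T κ := by
  have hcont : Continuous fun t : ℝ => (h |t| : ℂ) :=
    Complex.continuous_ofReal.comp (hc.comp_continuous continuous_abs fun t => abs_nonneg t)
  have hexp : ∀ κ : ℝ, ∀ t : ℝ, ‖Complex.exp (Complex.I * κ * t)‖ = 1 := by
    intro κ t
    rw [Complex.norm_exp]
    simp
  have habs : IntegrableOn (fun t : ℝ => (h |t| : ℂ)) (Ioi 0) :=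
    IntegrableOn.congr_fun hh.ofReal (fun t ht => by simp [abs_of_pos (show (0 : ℝ) < t from ht)])
      measurableSet_Ioi
  have hint : Integrable fun t : ℝ => (h |t| : ℂ) :=
    integrable_of_comp_neg habs (by simpa only [abs_neg] using habs)
  have hTneg : ∀ κ, T (-κ) = T κ := by
    intro κ
    rw [hT, hT, add_comm]
    simp only [Complex.ofReal_neg, mul_neg, neg_mul, neg_neg]
  have hFour : FourierTransform.fourier (fun t : ℝ => (h |t| : ℂ)) =
      fun w => T (2 * Real.pi * w) := by
    funext w
    rw [Real.fourier_real_eq_integral_exp_smul, hT]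
    have hI : ∀ w : ℝ, IntegrableOn (fun t : ℝ =>
        Complex.exp (Complex.I * w * t) * (h |t| : ℂ)) (Ioi 0) := by
      intro w
      refine Integrable.bdd_mul (c := 1) habs (by fun_prop) (Eventually.of_forall fun t => ?_)
      exact (hexp w t).le
    have e1 : ∀ t : ℝ, Complex.exp (((-2 * Real.pi * t * w : ℝ) : ℂ) * Complex.I) • (h |t| : ℂ) =
        Complex.exp (Complex.I * (-(2 * Real.pi * w) : ℝ) * t) * (h |t| : ℂ) := by
      intro t
      rw [smul_eq_mul]
      congr 2
      push_cast
      ring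
    have e2 : ∀ t : ℝ, Complex.exp (Complex.I * (-(2 * Real.pi * w) : ℝ) * (-t : ℝ)) =
        Complex.exp (Complex.I * (2 * Real.pi * w : ℝ) * t) := by
      intro t
      congr 1
      push_cast
      ring
    simp only [e1]
    rw [integral_eq_integral_Ioi (hI _) (by simpa only [e2, abs_neg] using hI (2 * Real.pi * w)),
      ← integral_add]
    · refine setIntegral_congr_fun measurableSet_Ioi fun t ht => ?_
      simp only [e2, abs_neg, abs_of_pos (show (0 : ℝ) < t from ht)]
      congr 3
      push_cast
      ring
    · refine (hI (-(2 * Real.pi * w))).congr_fun (fun t ht => ?_) measurableSet_Ioi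
      simp only [abs_of_pos (show (0 : ℝ) < t from ht)]
      congr 2
      push_cast
      ring
    · refine (hI (2 * Real.pi * w)).congr_fun (fun t ht => ?_) measurableSet_Ioi
      simp only [abs_of_pos (show (0 : ℝ) < t from ht)]
  have hpi : 0 < 2 * Real.pi := Real.two_pi_pos
  have hTs : IntegrableOn (fun w => T (2 * Real.pi * w)) (Ioi 0) := by
    rw [integrableOn_Ioi_comp_mul_left_iff T 0 hpi, mul_zero]
    exact hTi
  have hFi : Integrable fun w => T (2 * Real.pi * w) :=
    integrable_of_comp_neg hTs (by simpa only [mul_neg, hTneg] using hTs)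
  have hinv := congrFun (hcont.fourierInv_fourier_eq hint (by rw [hFour]; exact hFi)) y
  rw [hFour, Real.fourierInv_eq', abs_of_nonneg hy] at hinv
  have e3 : ∀ w : ℝ, Complex.exp (((2 * Real.pi * inner ℝ w y : ℝ) : ℂ) * Complex.I) •
      T (2 * Real.pi * w) = Complex.exp (Complex.I * (2 * Real.pi * w : ℝ) * y) *
        T (2 * Real.pi * w) := by
    intro w
    rw [smul_eq_mul]
    congr 2
    simp
    ring
  simp only [e3] at hinv
  have hbd : ∀ c : ℝ, IntegrableOn (fun w : ℝ => Complex.exp (Complex.I * (2 * Real.pi * w : ℝ) * c) *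
      T (2 * Real.pi * w)) (Ioi 0) := by
    intro c
    refine Integrable.bdd_mul (c := 1) hTs (by fun_prop) (Eventually.of_forall fun t => ?_)
    exact (hexp _ c).le
  have e4 : ∀ w : ℝ, Complex.exp (Complex.I * (2 * Real.pi * -w : ℝ) * y) *
      T (2 * Real.pi * -w) = Complex.exp (Complex.I * (2 * Real.pi * w : ℝ) * (-y : ℝ)) *
      T (2 * Real.pi * w) := by
    intro w
    rw [mul_neg, hTneg]
    congr 2
    push_cast
    ring
  rw [integral_eq_integral_Ioi (hbd y) (by simp only [e4]; exact hbd (-y))] at hinv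
  simp only [e4] at hinv
  have hsub := integral_comp_mul_left_Ioi (fun κ : ℝ =>
    (Complex.exp (Complex.I * κ * y) + Complex.exp (-(Complex.I * κ * y))) * T κ) 0 hpi
  rw [mul_zero] at hsub
  have e5 : ∀ w : ℝ, Complex.exp (Complex.I * (2 * Real.pi * w : ℝ) * y) * T (2 * Real.pi * w) +
      Complex.exp (Complex.I * (2 * Real.pi * w : ℝ) * (-y : ℝ)) * T (2 * Real.pi * w) =
      (Complex.exp (Complex.I * (2 * Real.pi * w : ℝ) * y) +
        Complex.exp (-(Complex.I * (2 * Real.pi * w : ℝ) * y))) * T (2 * Real.pi * w) := by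
    intro w
    rw [add_mul]
    congr 3
    push_cast
    ring
  simp only [e5] at hinv
  rw [hsub, Complex.real_smul] at hinv
  have h2 : 2 * (Real.pi : ℂ) = ((2 * Real.pi : ℝ) : ℂ) := by push_cast; ring
  rw [h2, ← hinv, Complex.ofReal_inv, mul_inv_cancel_left₀ (Complex.ofReal_ne_zero.2 hpi.ne')]

end QuarterPlane

namespace QuarterPlane

open Filter Topology

variable {u : ℝ → ℝ} {β γ₁ γ₂ : ℝ} {f g : ℝ → ℝ} {q : ℝ → ℝ → ℝ}

/-! ### The normalized Jost solution -/

theorem conj_dirS (hu : LinePotential u) {k : ℂ} (hk : k ∈ upper) {x : ℝ} (hx : 0 ≤ x) :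
    conj (dirS u k x) = dirS u (-conj k) x :=
  (IsODE.eq_of_initial hu.continuous (dirS_isODE hu hk).conjugate
    (dirS_isODE hu (neg_conj_mem_upper hk)) (by simp [dirS_zero]) (by simp [dirDS_zero]) hx).1

theorem conj_dirS_of_real (hu : LinePotential u) {k : ℂ} (hk : k.im = 0) {x : ℝ} (hx : 0 ≤ x) :
    conj (dirS u k x) = dirS u k x := by
  have hku : k ∈ upper := hk.ge
  have hck : conj k = k := Complex.conj_eq_iff_im.2 hk
  exact (IsODE.eq_of_initial hu.continuous ((dirS_isODE hu hku).conjugate.of_sq_eq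
    (by rw [hck, neg_sq])) (dirS_isODE hu hku) (by simp [dirS_zero]) (by simp [dirDS_zero]) hx).1

/-- The Jost solution normalized to be `1` at the endpoint. -/
noncomputable def jostR (u : ℝ → ℝ) (k : ℂ) (x : ℝ) : ℂ :=
  Complex.exp (Complex.I * k * x) * jostM u k x / jostM u k 0

theorem jostR_zero {k : ℂ} (hm : jostM u k 0 ≠ 0) : jostR u k 0 = 1 := by
  simp [jostR, hm]

theorem conj_jostR (hu : LinePotential u) {k : ℂ} (hk : k ∈ upper) {x : ℝ} (hx : 0 ≤ x) :
    conj (jostR u k x) = jostR u (-conj k) x := by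
  rw [jostR, jostR, map_div₀, map_mul, conj_jostM hu hk hx, conj_jostM hu hk le_rfl,
    ← Complex.exp_conj]
  simp

theorem exists_jostR_isODE (hu : LinePotential u) {k : ℂ} (hk : k ∈ upper) :
    ∃ v' A', IsODE u k (jostR u k) v' ∧ ∀ x, 0 ≤ x → ‖v' x‖ ≤ A' := by
  have h := (jost_isODE hu hk).combine (jost_isODE hu hk) (jostM u k 0)⁻¹ 0
  have e : jostR u k = fun x : ℝ => (jostM u k 0)⁻¹ *
      (Complex.exp (Complex.I * k * x) * jostM u k x)
      + 0 * (Complex.exp (Complex.I * k * x) * jostM u k x) := by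
    funext x
    rw [jostR, zero_mul, add_zero, div_eq_inv_mul]
  rw [e]
  refine ⟨_, ‖(jostM u k 0)⁻¹‖ * jostDBound u k, h, fun x hx => ?_⟩
  rw [zero_mul, add_zero, norm_mul]
  exact mul_le_mul_of_nonneg_left (norm_jostD_le hu hk hx) (norm_nonneg _)

theorem continuousOn_jostR (hu : LinePotential u) {k : ℂ} (hk : k ∈ upper) :
    ContinuousOn (jostR u k) (Ici 0) := by
  obtain ⟨v', A', h, -⟩ := exists_jostR_isODE hu hk
  exact h.continuousOn

theorem norm_jostR_eq (k : ℂ) (x : ℝ) :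
    ‖jostR u k x‖ = Real.exp (-(k.im * x)) * (‖jostM u k x‖ / ‖jostM u k 0‖) := by
  rw [jostR, norm_div, norm_mul, Complex.norm_exp, mul_div_assoc]
  simp

/-- For real `k`, the imaginary part of `jostR` is a multiple of the Dirichlet solution. -/
theorem conj_dirS_mul_jostR_sub (hu : LinePotential u) {k : ℂ} (hk : k.im = 0)
    (hm : jostM u k 0 ≠ 0) {x t : ℝ} (hx : 0 ≤ x) (ht : 0 ≤ t) :
    conj (dirS u k t * jostR u k x - dirS u k x * jostR u k t) =
      dirS u k t * jostR u k x - dirS u k x * jostR u k t := by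
  have hku : k ∈ upper := hk.ge
  have hck : conj k = k := Complex.conj_eq_iff_im.2 hk
  obtain ⟨v', A', h, -⟩ := exists_jostR_isODE hu hku
  have hs := dirS_isODE hu hku
  have hw := h.combine (h.conjugate.of_sq_eq (k₁ := k) (by rw [hck, neg_sq])) 1 (-1)
  set c := 1 * v' 0 + -1 * conj (v' 0) with hc
  -- `R` minus its conjugate solves the same equation for real `k` and vanishes at `0`, hence is a
  -- multiple of `s`. The multiple cancels in the antisymmetric combination of `t` and `x`.
  have key : ∀ {t : ℝ}, 0 ≤ t → jostR u k t - conj (jostR u k t) = c * dirS u k t := by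
    intro t ht
    have := (IsODE.eq_of_initial hu.continuous hw (hs.combine hs c 0)
      (by simp [jostR_zero hm, dirS_zero]) (by simp [dirDS_zero, hc]) ht).1
    linear_combination this
  rw [map_sub, map_mul, map_mul, conj_dirS_of_real hu hk hx, conj_dirS_of_real hu hk ht]
  linear_combination dirS u k x * key ht - dirS u k t * key hx

/-! ### The Green function of the Dirichlet problem -/

/-- The Green function of the Dirichlet problem on the half line. -/
noncomputable def greenKer (u : ℝ → ℝ) (k : ℂ) (x t : ℝ) : ℂ :=
  dirS u k (min x t) * jostR u k (max x t)

/-- The growth of `s` at the smaller argument and the decay of `R` at the larger one combine to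
`e^{-Im k |x - t|}`; only uniformly bounded or linearly growing factors remain. -/
theorem norm_greenKer_eq (k : ℂ) (x t : ℝ) :
    ‖greenKer u k x t‖ = Real.exp (-(k.im * |x - t|)) * (‖dirN u k (min x t)‖ *
      (‖jostM u k (max x t)‖ / ‖jostM u k 0‖)) := by
  rw [greenKer, norm_mul, norm_dirS_eq, norm_jostR_eq, ← max_sub_min_eq_abs',
    show -(k.im * (max x t - min x t)) = k.im * min x t + -(k.im * max x t) by ring, Real.exp_add]
  ring

theorem conj_greenKer (hu : LinePotential u) {k : ℂ} (hk : k ∈ upper) {x t : ℝ} (hx : 0 ≤ x)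
    (ht : 0 ≤ t) : conj (greenKer u k x t) = greenKer u (-conj k) x t := by
  rw [greenKer, greenKer, map_mul, conj_dirS hu hk (le_min hx ht),
    conj_jostR hu hk (hx.trans (le_max_left _ _))]

section Bounds

variable {c : ℝ}

theorem norm_jostR_le (hu : LinePotential u) (hc0 : 0 < c) (hc : ∀ k ∈ upper, c ≤ ‖jostM u k 0‖)
    {k : ℂ} (hk : k ∈ upper) (x : ℝ) :
    ‖jostR u k x‖ ≤ Real.exp (-(k.im * x)) * (potBound u / c) := by
  rw [norm_jostR_eq]
  exact mul_le_mul_of_nonneg_left (div_le_div₀ (potBound_pos u).le (norm_jostM_le hu hk x) hc0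
    (hc k hk)) (Real.exp_pos _).le

theorem norm_jostR_le_const (hu : LinePotential u) (hc0 : 0 < c)
    (hc : ∀ k ∈ upper, c ≤ ‖jostM u k 0‖) {k : ℂ} (hk : k ∈ upper) {x : ℝ} (hx : 0 ≤ x) :
    ‖jostR u k x‖ ≤ potBound u / c := by
  refine (norm_jostR_le hu hc0 hc hk x).trans (mul_le_of_le_one_left ?_ ?_)
  · exact div_nonneg (potBound_pos u).le hc0.le
  · rw [Real.exp_le_one_iff, neg_nonpos]
    exact mul_nonneg hk hx

theorem norm_greenKer_le (hu : LinePotential u) (hc0 : 0 < c)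
    (hc : ∀ k ∈ upper, c ≤ ‖jostM u k 0‖) {k : ℂ} (hk : k ∈ upper) {x t : ℝ} (hx : 0 ≤ x)
    (ht : 0 ≤ t) : ‖greenKer u k x t‖ ≤ Real.exp (-(k.im * |x - t|)) *
      (potBound u * x * (potBound u / c)) := by
  have hmin : 0 ≤ min x t := le_min hx ht
  rw [norm_greenKer_eq]
  refine mul_le_mul_of_nonneg_left (mul_le_mul ((norm_dirN_le hu hk hmin).trans ?_)
    (div_le_div₀ (potBound_pos u).le (norm_jostM_le hu hk _) hc0 (hc k hk)) (by positivity) ?_)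
    (Real.exp_pos _).le
  · exact mul_le_mul_of_nonneg_left (min_le_left _ _) (potBound_pos u).le
  · exact mul_nonneg (potBound_pos u).le hx

theorem norm_mul_greenKer_le (hu : LinePotential u) (hc0 : 0 < c)
    (hc : ∀ k ∈ upper, c ≤ ‖jostM u k 0‖) {k : ℂ} (hk : k ∈ upper) {x t : ℝ} (hx : 0 ≤ x)
    (ht : 0 ≤ t) : ‖k‖ * ‖greenKer u k x t‖ ≤ Real.exp (-(k.im * |x - t|)) *
      (dirBound u * (potBound u / c)) := by
  have hmin : 0 ≤ min x t := le_min hx ht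
  rw [norm_greenKer_eq, mul_left_comm, ← mul_assoc ‖k‖]
  refine mul_le_mul_of_nonneg_left (mul_le_mul (norm_mul_dirN_le hu hk hmin)
    (div_le_div₀ (potBound_pos u).le (norm_jostM_le hu hk _) hc0 (hc k hk)) (by positivity) ?_)
    (Real.exp_pos _).le
  exact zero_le_one.trans (one_le_dirBound u)

theorem exp_neg_im_mul_abs_le_one {k : ℂ} (hk : k ∈ upper) (s : ℝ) :
    Real.exp (-(k.im * |s|)) ≤ 1 := by
  rw [Real.exp_le_one_iff, neg_nonpos]
  exact mul_nonneg hk (abs_nonneg s)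

theorem norm_greenKer_le_const (hu : LinePotential u) (hc0 : 0 < c)
    (hc : ∀ k ∈ upper, c ≤ ‖jostM u k 0‖) {k : ℂ} (hk : k ∈ upper) {x t : ℝ} (hx : 0 ≤ x)
    (ht : 0 ≤ t) : ‖greenKer u k x t‖ ≤ potBound u * x * (potBound u / c) := by
  have hp := potBound_pos u
  exact (norm_greenKer_le hu hc0 hc hk hx ht).trans
    (mul_le_of_le_one_left (by positivity) (exp_neg_im_mul_abs_le_one hk _))

theorem continuousOn_greenKer (hu : LinePotential u) {k : ℂ} (hk : k ∈ upper) {x : ℝ}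
    (hx : 0 ≤ x) : ContinuousOn (greenKer u k x) (Ici 0) := by
  refine ContinuousOn.mul ?_ ?_
  · exact (dirS_isODE hu hk).continuousOn.comp (by fun_prop : Continuous fun t : ℝ =>
      min x t).continuousOn fun t ht => le_min hx ht
  · exact (continuousOn_jostR hu hk).comp (by fun_prop : Continuous fun t : ℝ =>
      max x t).continuousOn fun t _ => hx.trans (le_max_left x t)

theorem continuousOn_jostR_left (hu : LinePotential u) (hne : ∀ k ∈ upper, jostM u k 0 ≠ 0)
    (x : ℝ) : ContinuousOn (fun k => jostR u k x) upper := by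
  refine ContinuousOn.div (ContinuousOn.mul ?_ (continuousOn_jostM_left hu x))
    (continuousOn_jostM_left hu 0) hne
  exact (by fun_prop : Continuous fun k : ℂ => Complex.exp (Complex.I * k * x)).continuousOn

theorem differentiableOn_jostR_left (hu : LinePotential u) (hne : ∀ k ∈ upper, jostM u k 0 ≠ 0)
    (x : ℝ) : DifferentiableOn ℂ (fun k => jostR u k x) upperO := by
  refine DifferentiableOn.div (DifferentiableOn.mul ?_ (differentiableOn_jostM_left hu x))
    (differentiableOn_jostM_left hu 0) fun k hk => hne k (upperO_subset hk)
  exact (by fun_prop : Differentiable ℂ fun k : ℂ =>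
    Complex.exp (Complex.I * k * x)).differentiableOn

theorem continuousOn_greenKer_left (hu : LinePotential u) (hne : ∀ k ∈ upper, jostM u k 0 ≠ 0)
    (x t : ℝ) : ContinuousOn (fun k => greenKer u k x t) upper := by
  refine ContinuousOn.mul (ContinuousOn.mul ?_ (continuousOn_dirN_left hu _))
    (continuousOn_jostR_left hu hne _)
  exact (by fun_prop : Continuous fun k : ℂ =>
    Complex.exp (-(Complex.I * k) * (min x t : ℝ))).continuousOn

theorem differentiableOn_greenKer_left (hu : LinePotential u)
    (hne : ∀ k ∈ upper, jostM u k 0 ≠ 0) (x t : ℝ) :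
    DifferentiableOn ℂ (fun k => greenKer u k x t) upperO := by
  refine DifferentiableOn.mul (DifferentiableOn.mul ?_ (differentiableOn_dirN_left hu _))
    (differentiableOn_jostR_left hu hne _)
  exact (by fun_prop : Differentiable ℂ fun k : ℂ =>
    Complex.exp (-(Complex.I * k) * (min x t : ℝ))).differentiableOn

/-! ### The Green potential of the boundary flux -/

/-- The Green potential of `q_y(·, 0)`. -/
noncomputable def greenB (u : ℝ → ℝ) (q : ℝ → ℝ → ℝ) (k : ℂ) (x : ℝ) : ℂ :=
  ∫ t in Ioi (0 : ℝ), (partialY q t 0 : ℂ) * greenKer u k x t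

theorem conj_greenB (hu : LinePotential u) {k : ℂ} (hk : k ∈ upper) {x : ℝ} (hx : 0 ≤ x) :
    conj (greenB u q k x) = greenB u q (-conj k) x := by
  rw [greenB, greenB, ← integral_conj]
  refine setIntegral_congr_fun measurableSet_Ioi fun t ht => ?_
  simp only [map_mul, Complex.conj_ofReal, conj_greenKer hu hk hx (le_of_lt ht)]

theorem integrableOn_greenKer_mul (hu : LinePotential u) (hc0 : 0 < c)
    (hc : ∀ k ∈ upper, c ≤ ‖jostM u k 0‖) (hq : IsSolution u β γ₁ γ₂ f g q) {k : ℂ}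
    (hk : k ∈ upper) {x : ℝ} (hx : 0 ≤ x) :
    IntegrableOn (fun t => (partialY q t 0 : ℂ) * greenKer u k x t) (Ioi 0) :=
  hq.integrableOn_qy_mul (continuousOn_greenKer hu hk hx) fun _ ht =>
    norm_greenKer_le_const hu hc0 hc hk hx ht

theorem norm_greenKer_mul_le (hu : LinePotential u) (hc0 : 0 < c)
    (hc : ∀ k ∈ upper, c ≤ ‖jostM u k 0‖) {P ω : ℝ → ℝ} (hM : Majorants q P ω) {k : ℂ}
    (hk : k ∈ upper) {x t : ℝ} (hx : 0 ≤ x) (ht : 0 ≤ t) :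
    ‖(partialY q t 0 : ℂ) * greenKer u k x t‖ ≤ P t * (potBound u * x * (potBound u / c)) := by
  rw [norm_mul, Complex.norm_real, Real.norm_eq_abs]
  exact mul_le_mul (hM.decayY.le_left hM ht le_rfl)
    (norm_greenKer_le_const hu hc0 hc hk hx ht) (norm_nonneg _) (hM.nonneg t ht)

theorem continuousOn_greenB (hu : LinePotential u) (hc0 : 0 < c)
    (hc : ∀ k ∈ upper, c ≤ ‖jostM u k 0‖) (hq : IsSolution u β γ₁ γ₂ f g q) {x : ℝ}
    (hx : 0 ≤ x) : ContinuousOn (fun k => greenB u q k x) upper := by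
  obtain ⟨P, ω, hM⟩ := hq.exists_majorants
  have hne : ∀ k ∈ upper, jostM u k 0 ≠ 0 := fun k hk =>
    norm_pos_iff.1 (hc0.trans_le (hc k hk))
  refine continuousOn_of_dominated (bound := fun t => P t * (potBound u * x * (potBound u / c)))
    (fun k hk => (integrableOn_greenKer_mul hu hc0 hc hq hk hx).aestronglyMeasurable)
    (fun k hk => (ae_restrict_iff' measurableSet_Ioi).2 (Eventually.of_forall fun t ht =>
      norm_greenKer_mul_le hu hc0 hc hM hk hx (le_of_lt ht))) (hM.integrable.mul_const _)
    (Eventually.of_forall fun t => ?_)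
  exact continuousOn_const.mul (continuousOn_greenKer_left hu hne x t)

theorem differentiableOn_greenB (hu : LinePotential u) (hc0 : 0 < c)
    (hc : ∀ k ∈ upper, c ≤ ‖jostM u k 0‖) (hq : IsSolution u β γ₁ γ₂ f g q) {x : ℝ}
    (hx : 0 ≤ x) : DifferentiableOn ℂ (fun k => greenB u q k x) upperO := by
  obtain ⟨P, ω, hM⟩ := hq.exists_majorants
  have hne : ∀ k ∈ upper, jostM u k 0 ≠ 0 := fun k hk =>
    norm_pos_iff.1 (hc0.trans_le (hc k hk))
  refine differentiableOn_integral_of_dominated isOpen_upperO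
    (bound := fun t => P t * (potBound u * x * (potBound u / c)))
    (fun k hk => (integrableOn_greenKer_mul hu hc0 hc hq (upperO_subset hk)
      hx).aestronglyMeasurable) (Eventually.of_forall fun t => ?_)
    ((ae_restrict_iff' measurableSet_Ioi).2 (Eventually.of_forall fun t ht k hk =>
      norm_greenKer_mul_le hu hc0 hc hM (upperO_subset hk) hx (le_of_lt ht)))
    (hM.integrable.mul_const _)
  exact (differentiableOn_const _).mul (differentiableOn_greenKer_left hu hne x t)

theorem exists_norm_greenB_le (hu : LinePotential u) (hc0 : 0 < c)
    (hc : ∀ k ∈ upper, c ≤ ‖jostM u k 0‖) (hq : IsSolution u β γ₁ γ₂ f g q) {x : ℝ}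
    (hx : 0 ≤ x) : ∃ C, ∀ k ∈ upper, ‖greenB u q k x‖ ≤ C ∧ ‖k‖ * ‖greenB u q k x‖ ≤ C := by
  obtain ⟨P, ω, hM⟩ := hq.exists_majorants
  refine ⟨max (∫ t in Ioi (0 : ℝ), P t * (potBound u * x * (potBound u / c)))
    (∫ t in Ioi (0 : ℝ), P t * (dirBound u * (potBound u / c))), fun k hk => ⟨?_, ?_⟩⟩
  · refine le_max_of_le_left (norm_integral_le_of_norm_le (hM.integrable.mul_const _) ?_)
    exact (ae_restrict_iff' measurableSet_Ioi).2 (Eventually.of_forall fun t ht =>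
      norm_greenKer_mul_le hu hc0 hc hM hk hx (le_of_lt ht))
  · refine le_max_of_le_right ?_
    rw [← norm_mul, greenB, ← integral_const_mul]
    refine norm_integral_le_of_norm_le (hM.integrable.mul_const _)
      ((ae_restrict_iff' measurableSet_Ioi).2 (Eventually.of_forall fun t ht => ?_))
    have ht' : 0 ≤ t := le_of_lt ht
    have h1 := norm_mul_greenKer_le hu hc0 hc hk hx ht'
    have h2 := mul_le_of_le_one_left (mul_nonneg (zero_le_one.trans (one_le_dirBound u))
      (div_nonneg (potBound_pos u).le hc0.le)) (exp_neg_im_mul_abs_le_one hk (x - t))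
    rw [norm_mul, norm_mul (partialY q t 0 : ℂ), mul_left_comm, Complex.norm_real, Real.norm_eq_abs]
    exact mul_le_mul (hM.decayY.le_left hM ht' le_rfl) (h1.trans h2) (by positivity)
      (hM.nonneg t ht')

/-- One factor `1/s` is the uniform bound of the kernel. The second is the integral of
`e^{-s|x-t|}`, at most `2/s`, against the bounded flux `q_y(·,0)`; together they make the Green
potential integrable along the imaginary axis. -/
theorem exists_sq_mul_norm_greenB_le (hu : LinePotential u) (hc0 : 0 < c)
    (hc : ∀ k ∈ upper, c ≤ ‖jostM u k 0‖) (hq : IsSolution u β γ₁ γ₂ f g q) {x : ℝ}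
    (hx : 0 ≤ x) : ∃ C, ∀ s : ℝ, 0 < s → s ^ 2 * ‖greenB u q (Complex.I * s) x‖ ≤ C := by
  obtain ⟨P, ω, hM⟩ := hq.exists_majorants
  obtain ⟨A, hA⟩ := hM.bounded
  have hd := zero_le_one.trans (one_le_dirBound u)
  have hp := potBound_pos u
  have hA0 : 0 ≤ A := (hM.nonneg 0 le_rfl).trans (hA 0 le_rfl)
  refine ⟨A * (dirBound u * (potBound u / c)) * 2, fun s hs => ?_⟩
  have hk : Complex.I * s ∈ upper := I_mul_mem_upper hs.le
  have him : (Complex.I * (s : ℂ)).im = s := by simp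
  have hnorm : ‖Complex.I * (s : ℂ)‖ = s := by simp [abs_of_pos hs]
  have h1 : ‖Complex.I * (s : ℂ)‖ * ‖greenB u q (Complex.I * s) x‖ ≤
      ∫ t in Ioi (0 : ℝ), A * (dirBound u * (potBound u / c)) * Real.exp (-(s * |x - t|)) := by
    rw [← norm_mul, greenB, ← integral_const_mul]
    refine norm_integral_le_of_norm_le
      ((integrable_exp_neg_mul_abs_sub hs x).integrableOn.const_mul _)
      ((ae_restrict_iff' measurableSet_Ioi).2 (Eventually.of_forall fun t ht => ?_))
    have ht' : 0 ≤ t := le_of_lt ht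
    have h1 := norm_mul_greenKer_le hu hc0 hc hk hx ht'
    rw [him] at h1
    rw [norm_mul, norm_mul (partialY q t 0 : ℂ), mul_left_comm, Complex.norm_real, Real.norm_eq_abs]
    refine (mul_le_mul ((hM.decayY.le_left hM ht' le_rfl).trans (hA t ht')) h1 (by positivity)
      hA0).trans (le_of_eq ?_)
    ring
  rw [hnorm, integral_const_mul] at h1
  have h2 := mul_le_mul_of_nonneg_left (setIntegral_exp_neg_mul_abs_sub_le hs x)
    (show 0 ≤ A * (dirBound u * (potBound u / c)) by positivity)
  have h3 := mul_le_mul_of_nonneg_left (h1.trans h2) hs.le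
  calc s ^ 2 * ‖greenB u q (Complex.I * s) x‖ = s * (s * ‖greenB u q (Complex.I * s) x‖) := by ring
    _ ≤ _ := h3
    _ = _ := by field_simp

theorem integrableOn_greenB_imag (hu : LinePotential u) (hc0 : 0 < c)
    (hc : ∀ k ∈ upper, c ≤ ‖jostM u k 0‖) (hq : IsSolution u β γ₁ γ₂ f g q) {x : ℝ}
    (hx : 0 ≤ x) : IntegrableOn (fun s : ℝ => greenB u q (Complex.I * s) x) (Ioi 0) := by
  obtain ⟨C₁, h1⟩ := exists_norm_greenB_le hu hc0 hc hq hx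
  obtain ⟨C₂, h2⟩ := exists_sq_mul_norm_greenB_le hu hc0 hc hq hx
  refine Integrable.mono' ((integrable_inv_one_add_sq.const_mul (C₁ + C₂)).integrableOn) ?_ ?_
  · refine ContinuousOn.aestronglyMeasurable ?_ measurableSet_Ioi
    exact (continuousOn_greenB hu hc0 hc hq hx).comp (by fun_prop : Continuous fun s : ℝ =>
      Complex.I * (s : ℂ)).continuousOn fun s hs => I_mul_mem_upper (le_of_lt hs)
  · refine (ae_restrict_iff' measurableSet_Ioi).2 (Eventually.of_forall fun s hs => ?_)
    rw [← div_eq_mul_inv, le_div_iff₀ (by positivity)]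
    linarith [(h1 _ (I_mul_mem_upper (le_of_lt hs))).1, h2 s hs]

/-- The decay `e^{-sx}` comes from `x > 0`. It allows the pieces of the representation to be
separated as absolutely convergent integrals. -/
theorem integrableOn_jostR_imag (hu : LinePotential u) (hc0 : 0 < c)
    (hc : ∀ k ∈ upper, c ≤ ‖jostM u k 0‖) {x : ℝ} (hx : 0 < x) :
    IntegrableOn (fun s : ℝ => jostR u (Complex.I * s) x) (Ioi 0) := by
  have hne : ∀ k ∈ upper, jostM u k 0 ≠ 0 := fun k hk =>
    norm_pos_iff.1 (hc0.trans_le (hc k hk))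
  have hexp : IntegrableOn (fun s : ℝ => Real.exp (-(s * x)) * (potBound u / c)) (Ioi 0) := by
    have : IntegrableOn (fun s => Real.exp (-x * s) * (potBound u / c)) (Ioi 0) :=
      (exp_neg_integrableOn_Ioi 0 hx).mul_const (potBound u / c)
    simpa only [neg_mul, mul_comm x] using this
  refine Integrable.mono' hexp ?_ ?_
  · refine ContinuousOn.aestronglyMeasurable ?_ measurableSet_Ioi
    exact (continuousOn_jostR_left hu hne x).comp (by fun_prop : Continuous fun s : ℝ =>
      Complex.I * (s : ℂ)).continuousOn fun s hs => I_mul_mem_upper (le_of_lt hs)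
  · refine (ae_restrict_iff' measurableSet_Ioi).2 (Eventually.of_forall fun s hs => ?_)
    have := norm_jostR_le hu hc0 hc (I_mul_mem_upper (le_of_lt hs)) x
    simpa using this

end Bounds

end QuarterPlane

namespace QuarterPlane

open Filter Topology

variable {u : ℝ → ℝ} {β γ₁ γ₂ : ℝ} {f g : ℝ → ℝ} {q : ℝ → ℝ → ℝ}

/-! ### The cosine transform of the solution -/

section Representation

variable {c : ℝ}

theorem greenB_eq (hu : LinePotential u) (hc0 : 0 < c) (hc : ∀ k ∈ upper, c ≤ ‖jostM u k 0‖)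
    (hq : IsSolution u β γ₁ γ₂ f g q) {k : ℂ} (hk : k ∈ upper) {x : ℝ} (hx : 0 ≤ x) :
    greenB u q k x = jostR u k x * (∫ t in (0 : ℝ)..x, dirS u k t * (partialY q t 0 : ℂ))
      + dirS u k x * ∫ t in Ioi x, jostR u k t * (partialY q t 0 : ℂ) := by
  have hi := integrableOn_greenKer_mul hu hc0 hc hq hk hx
  rw [greenB, ← Ioc_union_Ioi_eq_Ioi hx, setIntegral_union (Ioc_disjoint_Ioi le_rfl)
    measurableSet_Ioi (hi.mono_set Ioc_subset_Ioi_self) (hi.mono_set (Ioi_subset_Ioi hx)),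
    intervalIntegral.integral_of_le hx, ← integral_const_mul, ← integral_const_mul]
  congr 1
  · refine setIntegral_congr_fun measurableSet_Ioc fun t ht => ?_
    simp only [greenKer, min_eq_right ht.2, max_eq_left ht.2]
    ring
  · refine setIntegral_congr_fun measurableSet_Ioi fun t ht => ?_
    simp only [greenKer, min_eq_left (le_of_lt (show x < t from ht)),
      max_eq_right (le_of_lt (show x < t from ht))]
    ring

/-- Adding Green's identity for `κ = k` and `κ = -k` cancels the terms with `q(·,0)` and leaves only
the flux `q_y(·,0)`. The identity with `s` on `[0, x]` and the one with `R` on `[x, ∞)` then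
eliminate the transform of `q_x`, through the Wronskian of `s` and `R`. -/
theorem laplaceY_add_laplaceY_neg (hu : LinePotential u) (hc0 : 0 < c)
    (hc : ∀ k ∈ upper, c ≤ ‖jostM u k 0‖) (hq : IsSolution u β γ₁ γ₂ f g q) {k : ℂ}
    (hre : k.re = 0) (him : 0 < k.im) {x : ℝ} (hx : 0 ≤ x) :
    laplaceY q k x + laplaceY q (-k) x =
      jostR u k x * (g0 q k + g0 q (-k)) - 2 * greenB u q k x := by
  have hk : k ∈ upper := him.le
  have hm : jostM u k 0 ≠ 0 := norm_pos_iff.1 (hc0.trans_le (hc k hk))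
  have hs := dirS_isODE hu hk
  obtain ⟨R', A', hR, hA'⟩ := exists_jostR_isODE hu hk
  have hA : ∀ t, 0 ≤ t → ‖jostR u k t‖ ≤ potBound u / c :=
    fun t ht => norm_jostR_le_const hu hc0 hc hk ht
  have hRq := (hq.integrableOn_q_mul hR.continuousOn hA).mono_set (Ioi_subset_Ioi hx)
  have hRy := (hq.integrableOn_qy_mul hR.continuousOn hA).mono_set (Ioi_subset_Ioi hx)
  simp only [mul_comm _ (jostR u k _)] at hRq hRy
  have hsub : Icc 0 x ⊆ Ici 0 := Icc_subset_Ici_self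
  have hsq : IntervalIntegrable (fun t => dirS u k t * (q t 0 : ℂ)) volume 0 x :=
    ((hs.continuousOn.mul (Complex.continuous_ofReal.comp_continuousOn
      hq.continuousOn_bottom)).mono hsub).intervalIntegrable_of_Icc hx
  have hsy : IntervalIntegrable (fun t => dirS u k t * (partialY q t 0 : ℂ)) volume 0 x :=
    ((hs.continuousOn.mul (Complex.continuous_ofReal.comp_continuousOn
      hq.continuousOn_partialY_bottom)).mono hsub).intervalIntegrable_of_Icc hx
  have key : ∀ κ : ℂ, κ ^ 2 = k ^ 2 → κ.re = 0 →
      (dirS u k x * laplaceY (partialX q) κ x - dirDS u k x * laplaceY q κ x + laplaceY q κ 0 =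
        (∫ t in (0 : ℝ)..x, dirS u k t * (partialY q t 0 : ℂ))
          + κ * ∫ t in (0 : ℝ)..x, dirS u k t * (q t 0 : ℂ)) ∧
      (R' x * laplaceY q κ x - jostR u k x * laplaceY (partialX q) κ x =
        (∫ t in Ioi x, jostR u k t * (partialY q t 0 : ℂ))
          + κ * ∫ t in Ioi x, jostR u k t * (q t 0 : ℂ)) := by
    intro κ hκ hκre
    have h1 := green_strip hq hκ hκre.ge hs le_rfl hx
    have h2 := green_half hq hκ hκre.ge hR hA hA' hx
    simp only [dirS_zero, dirDS_zero, mul_add, mul_left_comm _ κ] at h1 h2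
    rw [intervalIntegral.integral_add hsy (hsq.const_mul _),
      intervalIntegral.integral_const_mul] at h1
    rw [integral_add hRy (hRq.const_mul _), integral_const_mul] at h2
    exact ⟨by linear_combination h1, h2⟩
  obtain ⟨h1, h2⟩ := key k rfl hre
  obtain ⟨h3, h4⟩ := key (-k) (by ring) (by simp [hre])
  have hW := hs.wronskian_eq hR hx
  rw [dirS_zero, dirDS_zero, jostR_zero hm] at hW
  rw [greenB_eq hu hc0 hc hq hk hx, g0_eq_laplaceY, g0_eq_laplaceY, neg_neg]
  linear_combination (laplaceY q k x + laplaceY q (-k) x) * hW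
    - jostR u k x * (h1 + h3) - dirS u k x * (h2 + h4)

/-! ### The spectral function of the Dirichlet problem -/

/-- The function whose jump across the real axis is the integrand of the representation. -/
noncomputable def spectralFun (u : ℝ → ℝ) (q : ℝ → ℝ → ℝ) (x : ℝ) (k : ℂ) : ℂ :=
  jostR u k x * g0 q (-k) - 2 * greenB u q k x

theorem continuousOn_spectralFun (hu : LinePotential u) (hc0 : 0 < c)
    (hc : ∀ k ∈ upper, c ≤ ‖jostM u k 0‖) (hq : IsSolution u β γ₁ γ₂ f g q) {x : ℝ}
    (hx : 0 ≤ x) : ContinuousOn (spectralFun u q x) (Ici 0 ×ℂ Ici 0) := by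
  have hne : ∀ k ∈ upper, jostM u k 0 ≠ 0 := fun k hk =>
    norm_pos_iff.1 (hc0.trans_le (hc k hk))
  have hsub : Ici 0 ×ℂ Ici 0 ⊆ upper := fun k hk => hk.2
  refine ContinuousOn.sub (((continuousOn_jostR_left hu hne x).mono hsub).mul ?_)
    (continuousOn_const.mul ((continuousOn_greenB hu hc0 hc hq hx).mono hsub))
  exact (g0_continuousOn hq).comp continuous_neg.continuousOn fun k hk => by simpa using hk.1

theorem differentiableOn_spectralFun (hu : LinePotential u) (hc0 : 0 < c)
    (hc : ∀ k ∈ upper, c ≤ ‖jostM u k 0‖) (hq : IsSolution u β γ₁ γ₂ f g q) {x : ℝ}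
    (hx : 0 ≤ x) : DifferentiableOn ℂ (spectralFun u q x) (Ioi 0 ×ℂ Ioi 0) := by
  have hne : ∀ k ∈ upper, jostM u k 0 ≠ 0 := fun k hk =>
    norm_pos_iff.1 (hc0.trans_le (hc k hk))
  have hsub : Ioi 0 ×ℂ Ioi 0 ⊆ upperO := fun k hk => hk.2
  refine DifferentiableOn.sub (((differentiableOn_jostR_left hu hne x).mono hsub).mul ?_)
    ((differentiableOn_const _).mul ((differentiableOn_greenB hu hc0 hc hq hx).mono hsub))
  exact (g0_analytic hq).differentiableOn.comp differentiable_neg.differentiableOn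
    fun k hk => by simpa using hk.1

theorem exists_norm_spectralFun_le (hu : LinePotential u) (hc0 : 0 < c)
    (hc : ∀ k ∈ upper, c ≤ ‖jostM u k 0‖) (hq : IsSolution u β γ₁ γ₂ f g q) {x : ℝ}
    (hx : 0 ≤ x) : ∃ C, ∀ k ∈ Ici 0 ×ℂ Ici 0,
      ‖spectralFun u q x k‖ ≤ C ∧ ‖k‖ * ‖spectralFun u q x k‖ ≤ C := by
  obtain ⟨C₁, h1⟩ := exists_norm_g0_le hq
  obtain ⟨C₂, h2⟩ := exists_norm_greenB_le hu hc0 hc hq hx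
  refine ⟨potBound u / c * C₁ + 2 * C₂, fun k hk => ?_⟩
  have hku : k ∈ upper := hk.2
  have hR := norm_jostR_le_const hu hc0 hc hku hx
  obtain ⟨h3, h4⟩ := h1 (-k) (by simpa using hk.1)
  obtain ⟨h5, h6⟩ := h2 k hku
  rw [norm_neg] at h4
  have hQ : 0 ≤ potBound u / c := div_nonneg (potBound_pos u).le hc0.le
  have hS : ‖spectralFun u q x k‖ ≤ potBound u / c * ‖g0 q (-k)‖ + 2 * ‖greenB u q k x‖ := by
    refine (norm_sub_le _ _).trans (add_le_add ?_ ?_)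
    · rw [norm_mul]
      exact mul_le_mul_of_nonneg_right hR (norm_nonneg _)
    · rw [norm_mul, Complex.norm_ofNat]
  refine ⟨hS.trans (add_le_add (mul_le_mul_of_nonneg_left h3 hQ) (by linarith)), ?_⟩
  calc ‖k‖ * ‖spectralFun u q x k‖
      ≤ ‖k‖ * (potBound u / c * ‖g0 q (-k)‖ + 2 * ‖greenB u q k x‖) :=
        mul_le_mul_of_nonneg_left hS (norm_nonneg _)
    _ = potBound u / c * (‖k‖ * ‖g0 q (-k)‖) + 2 * (‖k‖ * ‖greenB u q k x‖) := by ring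
    _ ≤ _ := add_le_add (mul_le_mul_of_nonneg_left h4 hQ) (by linarith)

/-- On the positive half line the integrand is the jump of `spectralFun`. -/
theorem realIntegrand_eq (hu : LinePotential u) (ha : ∀ k ∈ upper, k ≠ 0 → aCoef u k ≠ 0)
    (hc0 : 0 < c) (hc : ∀ k ∈ upper, c ≤ ‖jostM u k 0‖) (hq : IsSolution u β γ₁ γ₂ f g q)
    {x : ℝ} (hx : 0 ≤ x) (y : ℝ) {k : ℝ} (hk : 0 < k) :
    realIntegrand u q x y k = conj (Complex.exp (-k * y) * spectralFun u q x k)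
      - Complex.exp (-k * y) * spectralFun u q x k := by
  have him : (k : ℂ).im = 0 := Complex.ofReal_im k
  have hku : (k : ℂ) ∈ upper := him.ge
  have hk0 : (k : ℂ) ≠ 0 := Complex.ofReal_ne_zero.2 hk.ne'
  have hm : jostM u k 0 ≠ 0 := norm_pos_iff.1 (hc0.trans_le (hc k hku))
  have hs := dirS_isODE hu hku
  have hA : ∀ t, 0 ≤ t → ‖dirS u k t‖ ≤ dirBound u / ‖(k : ℂ)‖ :=
    fun t ht => norm_dirS_le_of_real hu him hk0 ht
  have hiy := hq.integrableOn_qy_mul hs.continuousOn hA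
  have hrho := rho_eq_dirichlet hu ha hq (by simpa using hk.le) him.ge hk0
    (hq.integrableOn_q_mul hs.continuousOn hA) hiy
  -- The terms with `g₀(-k)` cancel. What remains of the kernel is zero for `t ≤ x` and the
  -- antisymmetric combination of `s` and `R` for `t ≥ x`, which is real.
  have hsum : rho u q k * psi u x k + spectralFun u q x k = 2 * ∫ t in Ioi (0 : ℝ),
      (partialY q t 0 : ℂ) * (dirS u k t * jostR u k x - greenKer u k x t) := by
    have h1 : ∀ t : ℝ, (partialY q t 0 : ℂ) * (dirS u k t * jostR u k x - greenKer u k x t) =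
        (partialY q t 0 : ℂ) * dirS u k t * jostR u k x
          - (partialY q t 0 : ℂ) * greenKer u k x t := fun t => by ring
    simp only [h1]
    rw [integral_sub (hiy.mul_const _) (integrableOn_greenKer_mul hu hc0 hc hq hku hx),
      integral_mul_const, hrho, spectralFun, greenB, psi_eq hu hku hk0 hx, jostR]
    field_simp
    ring
  have hreal : conj (rho u q k * psi u x k + spectralFun u q x k) =
      rho u q k * psi u x k + spectralFun u q x k := by
    rw [hsum, map_mul, ← integral_conj, Complex.conj_ofNat]
    congr 1
    refine setIntegral_congr_fun measurableSet_Ioi fun t ht => ?_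
    simp only [map_mul, Complex.conj_ofReal]
    congr 1
    rcases le_total t x with htx | htx
    · simp [greenKer, min_eq_right htx, max_eq_left htx]
    · rw [greenKer, min_eq_left htx, max_eq_right htx]
      exact conj_dirS_mul_jostR_sub hu him hm hx (le_of_lt ht)
  have hexp : conj (Complex.exp (-k * y)) = Complex.exp (-k * y) := by
    rw [← Complex.exp_conj]
    simp
  rw [realIntegrand, map_mul, hexp]
  rw [map_add, map_mul] at hreal
  linear_combination -Complex.exp (-k * y) * hreal

theorem conj_g0 (k : ℂ) : conj (g0 q k) = g0 q (conj k) := by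
  rw [g0, g0, expTransform, expTransform, ← integral_conj]
  congr 1
  funext y
  rw [map_mul, ← Complex.exp_conj, map_mul, Complex.conj_ofReal, Complex.conj_ofReal]

/-- The inverse cosine transform runs over the imaginary axis. Of its four exponential terms with
`g₀`, those with `e^{-ky} g₀(k)` and `e^{ky} g₀(-k)` stay there; the other two grow when moved
separately off the axis in the wrong direction, but with the Green potential they form `e^{-ky}
S(k)` and its conjugate, the former of which rotates to the positive real axis. -/
theorem integralRepresentation (hu : LinePotential u)
    (ha : ∀ k ∈ upper, k ≠ 0 → aCoef u k ≠ 0)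
    (hq : IsSolution u β γ₁ γ₂ f g q) {x y : ℝ} (hx : 0 < x) (hy : 0 < y) :
    IntegrableOn (fun k : ℝ => realIntegrand u q x y k) (Ioi 0) ∧
      IntegrableOn (fun s : ℝ => imagIntegrand u q x y (Complex.I * s)) (Ioi 0) ∧
      (q x y : ℂ) = -(1 / (2 * Complex.I * Real.pi)) *
            (∫ k in Ioi (0 : ℝ), realIntegrand u q x y k)
          + 1 / (2 * Complex.I * Real.pi) * imagAxisIntegral (imagIntegrand u q x y) := by
  obtain ⟨c, hc0, hc⟩ := exists_le_norm_jostM_zero hu ha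
  obtain ⟨C, hC⟩ := exists_norm_spectralFun_le hu hc0 hc hq hx.le
  obtain ⟨G, hG⟩ := exists_norm_g0_le hq
  have hcont := continuousOn_spectralFun hu hc0 hc hq hx.le
  have hF : IntegrableOn (fun k : ℝ => Complex.exp (-k * y) * spectralFun u q x k) (Ioi 0) := by
    refine Integrable.mono' ((exp_neg_integrableOn_Ioi 0 hy).mul_const C) ?_ ?_
    · refine ContinuousOn.aestronglyMeasurable (ContinuousOn.mul (by fun_prop) ?_)
        measurableSet_Ioi
      exact hcont.comp Complex.continuous_ofReal.continuousOn fun k hk =>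
        ⟨by simpa using le_of_lt hk, by simp⟩
    · refine (ae_restrict_iff' measurableSet_Ioi).2 (Eventually.of_forall fun k hk => ?_)
      rw [norm_mul, Complex.norm_exp]
      have h1 : (-(k : ℂ) * y).re = -y * k := by simp [mul_comm]
      rw [h1]
      exact mul_le_mul_of_nonneg_left (hC k ⟨by simpa using le_of_lt hk, by simp⟩).1
        (Real.exp_pos _).le
  have hFc : IntegrableOn (fun k : ℝ => conj (Complex.exp (-k * y) * spectralFun u q x k))
      (Ioi 0) := Complex.conjCLE.toContinuousLinearMap.integrable_comp hF
  have hreal : ∀ k ∈ Ioi (0 : ℝ), realIntegrand u q x y k =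
      conj (Complex.exp (-k * y) * spectralFun u q x k)
        - Complex.exp (-k * y) * spectralFun u q x k :=
    fun k hk => realIntegrand_eq hu ha hc0 hc hq hx.le y hk
  have hI : ∀ s ∈ Ioi (0 : ℝ), Complex.I * (s : ℂ) ∈ upper := fun s hs =>
    I_mul_mem_upper (le_of_lt hs)
  have hg : ∀ ε : ℝ, AEStronglyMeasurable (fun s : ℝ => g0 q (ε * (Complex.I * s)))
      (volume.restrict (Ioi 0)) := fun ε => by
    refine ContinuousOn.aestronglyMeasurable ?_ measurableSet_Ioi
    exact (g0_continuousOn hq).comp (by fun_prop) fun s _ => by simp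
  have hgn : ∀ (ε s : ℝ), ‖g0 q (ε * (Complex.I * s))‖ ≤ G := fun ε s =>
    (hG _ (by simp)).1
  have hexp : ∀ ε s : ℝ, ‖Complex.exp (ε * (Complex.I * s) * y)‖ = 1 := by
    intro ε s
    rw [Complex.norm_exp]
    simp
  have hR := integrableOn_jostR_imag hu hc0 hc hx
  have hB := integrableOn_greenB_imag hu hc0 hc hq hx.le
  have hRg : ∀ ε ε' : ℝ, IntegrableOn (fun s : ℝ => Complex.exp (ε' * (Complex.I * s) * y) *
      (jostR u (Complex.I * s) x * g0 q (ε * (Complex.I * s)))) (Ioi 0) := fun ε ε' =>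
    Integrable.bdd_mul (c := 1) (Integrable.mul_bdd (c := G) hR (hg ε)
      (Eventually.of_forall fun s => hgn ε s)) (by fun_prop)
      (Eventually.of_forall fun s => (hexp ε' s).le)
  have hBe : ∀ ε : ℝ, IntegrableOn (fun s : ℝ => Complex.exp (ε * (Complex.I * s) * y) *
      (2 * greenB u q (Complex.I * s) x)) (Ioi 0) := fun ε =>
    Integrable.bdd_mul (c := 1) (hB.const_mul 2) (by fun_prop)
      (Eventually.of_forall fun s => (hexp ε s).le)
  have hpp : IntegrableOn (fun s : ℝ => Complex.exp (Complex.I * s * y) *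
      (jostR u (Complex.I * s) x * g0 q (Complex.I * s))) (Ioi 0) := by
    simpa only [Complex.ofReal_one, one_mul] using hRg 1 1
  have hmp : IntegrableOn (fun s : ℝ => Complex.exp (Complex.I * s * y) *
      (jostR u (Complex.I * s) x * g0 q (-(Complex.I * s)))) (Ioi 0) := by
    simpa only [Complex.ofReal_one, Complex.ofReal_neg, neg_mul, one_mul] using hRg (-1) 1
  have hpm : IntegrableOn (fun s : ℝ => Complex.exp (-(Complex.I * s) * y) *
      (jostR u (Complex.I * s) x * g0 q (Complex.I * s))) (Ioi 0) := by
    simpa only [Complex.ofReal_one, Complex.ofReal_neg, neg_mul, one_mul] using hRg 1 (-1)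
  have hmm : IntegrableOn (fun s : ℝ => Complex.exp (-(Complex.I * s) * y) *
      (jostR u (Complex.I * s) x * g0 q (-(Complex.I * s)))) (Ioi 0) := by
    simpa only [Complex.ofReal_one, Complex.ofReal_neg, neg_mul, one_mul] using hRg (-1) (-1)
  have hBp : IntegrableOn (fun s : ℝ => Complex.exp (Complex.I * s * y) *
      (2 * greenB u q (Complex.I * s) x)) (Ioi 0) := by
    simpa only [Complex.ofReal_one, one_mul] using hBe 1
  have hBm : IntegrableOn (fun s : ℝ => Complex.exp (-(Complex.I * s) * y) *
      (2 * greenB u q (Complex.I * s) x)) (Ioi 0) := by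
    simpa only [Complex.ofReal_one, Complex.ofReal_neg, neg_mul, one_mul] using hBe (-1)
  have him : ∀ s ∈ Ioi (0 : ℝ), imagIntegrand u q x y (Complex.I * s) =
      Complex.exp (-(Complex.I * s) * y) * (jostR u (Complex.I * s) x * g0 q (Complex.I * s)) +
      Complex.exp (Complex.I * s * y) * (jostR u (Complex.I * s) x * g0 q (-(Complex.I * s))) := by
    intro s hs
    have hs0 : Complex.I * (s : ℂ) ≠ 0 :=
      mul_ne_zero Complex.I_ne_zero (Complex.ofReal_ne_zero.2 (ne_of_gt hs))
    rw [imagIntegrand, psi_eq hu (hI s hs) hs0 hx.le, psi_zero hu (hI s hs) hs0, jostR]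
    ring
  have hsf : ∀ s : ℝ, Complex.exp (-(Complex.I * s) * y) * spectralFun u q x (Complex.I * s) =
      Complex.exp (-(Complex.I * s) * y) * (jostR u (Complex.I * s) x * g0 q (-(Complex.I * s))) -
      Complex.exp (-(Complex.I * s) * y) * (2 * greenB u q (Complex.I * s) x) := fun s => by
    rw [spectralFun, mul_sub]
  -- The positive height `y` provides the damping `e^{-ky}` on the real axis and on the right side
  -- of the rotating square.
  have hrot := integral_exp_mul_rotate hcont (differentiableOn_spectralFun hu hc0 hc hq hx.le)
    (fun k hk => (hC k hk).2) hy hF (by simp only [hsf]; exact hmm.sub hBm)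
  -- On the imaginary axis `R` and the Green potential are real and `g₀(-is)` is the conjugate of
  -- `g₀(is)`, so conjugation produces the companion term with `e^{iys}`.
  have hconj : conj (∫ s in Ioi (0 : ℝ), Complex.exp (-(Complex.I * s) * y) *
      spectralFun u q x (Complex.I * s)) =
      (∫ s in Ioi (0 : ℝ), Complex.exp (Complex.I * s * y) *
        (jostR u (Complex.I * s) x * g0 q (Complex.I * s))) -
      ∫ s in Ioi (0 : ℝ), Complex.exp (Complex.I * s * y) *
        (2 * greenB u q (Complex.I * s) x) := by
    rw [← integral_conj, ← integral_sub hpp hBp]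
    refine setIntegral_congr_fun measurableSet_Ioi fun s hs => ?_
    simp only [hsf, map_sub, map_mul, conj_jostR hu (hI s hs) hx.le, conj_greenB hu (hI s hs) hx.le,
      conj_g0, ← Complex.exp_conj, Complex.conj_ofReal, Complex.conj_ofNat]
    simp only [map_neg, map_mul, Complex.conj_I, Complex.conj_ofReal, neg_mul, neg_neg]
  obtain ⟨P, ω, hM⟩ := hq.exists_majorants
  have hh : IntegrableOn (fun t => q x t) (Ioi 0) := by
    have h1 := continuousOn_right hq.continuousOn hx.le
    refine Integrable.mono' hM.integrable
      ((h1.mono Ioi_subset_Ici_self).aestronglyMeasurable measurableSet_Ioi) ?_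
    exact (ae_restrict_iff' measurableSet_Ioi).2 (Eventually.of_forall fun t ht =>
      hM.decay.le_right hM hx.le (le_of_lt ht))
  have hT : ∀ s ∈ Ioi (0 : ℝ), laplaceY q (Complex.I * s) x + laplaceY q (-(Complex.I * s)) x =
      jostR u (Complex.I * s) x * (g0 q (Complex.I * s) + g0 q (-(Complex.I * s)))
        - 2 * greenB u q (Complex.I * s) x := fun s hs =>
    laplaceY_add_laplaceY_neg hu hc0 hc hq (by simp) (by simpa using hs) hx.le
  have hRg0 : IntegrableOn (fun s : ℝ => jostR u (Complex.I * s) x *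
      (g0 q (Complex.I * s) + g0 q (-(Complex.I * s)))) (Ioi 0) := by
    have h1 := Integrable.mul_bdd (c := G) hR (hg 1) (Eventually.of_forall fun s => hgn 1 s)
    have h2 := Integrable.mul_bdd (c := G) hR (hg (-1)) (Eventually.of_forall fun s => hgn (-1) s)
    have h3 := h1.add h2
    simp only [Complex.ofReal_one, Complex.ofReal_neg, neg_mul, one_mul] at h3
    simp only [mul_add]
    exact h3
  have hinv := cosine_inversion (h := fun t => q x t) (continuousOn_right hq.continuousOn hx.le) hh
    (T := fun s => laplaceY q (Complex.I * s) x + laplaceY q (-(Complex.I * s)) x)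
    (fun κ => by simp only [laplaceY, neg_mul, neg_neg])
    (IntegrableOn.congr_fun (hRg0.sub (hB.const_mul 2)) (fun s hs => (hT s hs).symm)
      measurableSet_Ioi) hy.le
  have hsplit : 2 * Real.pi * (q x y : ℂ) =
      ((∫ s in Ioi (0 : ℝ), Complex.exp (-(Complex.I * s) * y) *
        (jostR u (Complex.I * s) x * g0 q (Complex.I * s))) +
      ∫ s in Ioi (0 : ℝ), Complex.exp (Complex.I * s * y) *
        (jostR u (Complex.I * s) x * g0 q (-(Complex.I * s)))) +
      ((∫ s in Ioi (0 : ℝ), Complex.exp (-(Complex.I * s) * y) *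
        spectralFun u q x (Complex.I * s)) +
      conj (∫ s in Ioi (0 : ℝ), Complex.exp (-(Complex.I * s) * y) *
        spectralFun u q x (Complex.I * s))) := by
    rw [hconj, hinv]
    simp only [hsf]
    rw [integral_sub hmm hBm, ← sub_eq_zero]
    have hsum := integral_add (hpm.add hmp) ((hmm.sub hBm).add (hpp.sub hBp))
    rw [integral_add' hpm hmp, integral_add' (hmm.sub hBm) (hpp.sub hBp), integral_sub' hmm hBm,
      integral_sub' hpp hBp] at hsum
    rw [← hsum, sub_eq_zero]
    refine setIntegral_congr_fun measurableSet_Ioi fun s hs => ?_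
    simp only [hT s hs, Pi.add_apply, Pi.sub_apply, neg_mul]
    ring
  refine ⟨IntegrableOn.congr_fun (hFc.sub hF) (fun k hk => (hreal k hk).symm) measurableSet_Ioi,
    IntegrableOn.congr_fun (hpm.add hmp) (fun s hs => (him s hs).symm) measurableSet_Ioi, ?_⟩
  have hpi : (Real.pi : ℂ) ≠ 0 := Complex.ofReal_ne_zero.2 Real.pi_ne_zero
  have hI0 := Complex.I_ne_zero
  -- Here `e` and `e'` are the rotated integral and its conjugate; rotation contributes `I` to one
  -- and `-I` to the other, and these cancel against the prefactor `1/(2πi)`.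
  have halg : ∀ Q a b e e' : ℂ, 2 * Real.pi * Q = (a + b) + (e + e') →
      Q = -(1 / (2 * Complex.I * Real.pi)) * (-Complex.I * e' - Complex.I * e)
        + 1 / (2 * Complex.I * Real.pi) * ((a + b) * Complex.I) := by
    intro Q a b e e' h
    field_simp
    linear_combination h
  rw [imagAxisIntegral, integral_mul_const, setIntegral_congr_fun measurableSet_Ioi hreal,
    setIntegral_congr_fun measurableSet_Ioi him, integral_sub hFc hF, integral_conj, hrot,
    integral_add hpm hmp, map_mul, Complex.conj_I]
  exact halg _ _ _ _ _ hsplit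

end Representation

end QuarterPlane

namespace QuarterPlane

/-! ### Dependence on the potential -/

section Congruence

variable {u u₁ : ℝ → ℝ} {β γ₁ γ₂ : ℝ} {f g : ℝ → ℝ} {q : ℝ → ℝ → ℝ}

theorem IsSolution.congr (hq : IsSolution u β γ₁ γ₂ f g q) (h : ∀ x, 0 ≤ x → u x = u₁ x) :
    IsSolution u₁ β γ₁ γ₂ f g q where
  contDiffOn_interior := hq.contDiffOn_interior
  contDiffOn_closed := hq.contDiffOn_closed
  decay := hq.decay
  pde x y hx hy := by rw [← h x hx.le]; exact hq.pde x y hx hy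
  boundary_bottom := hq.boundary_bottom
  boundary_left := hq.boundary_left

theorem psiX_congr (hψ : psi u = psi u₁) : psiX u = psiX u₁ := by
  funext k
  rw [psiX, psiX, hψ]

theorem psiTransform_congr (hψ : psi u = psi u₁) : psiTransform u = psiTransform u₁ := by
  funext h k
  rw [psiTransform, psiTransform, hψ]

theorem DFun_congr (hψ : psi u = psi u₁) : DFun u β γ₂ = DFun u₁ β γ₂ := by
  funext k
  rw [DFun, DFun, psiX_congr hψ, hψ]

theorem JFun_congr (hψ : psi u = psi u₁) : JFun u β γ₁ γ₂ = JFun u₁ β γ₁ γ₂ := by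
  funext k
  rw [JFun, JFun, psiX_congr hψ, hψ]

theorem HFun_congr (hψ : psi u = psi u₁) : HFun u f g = HFun u₁ f g := by
  funext k
  rw [HFun, HFun, psiTransform_congr hψ, hψ]

theorem FFun_congr (hψ : psi u = psi u₁) : FFun u f g β γ₁ γ₂ = FFun u₁ f g β γ₁ γ₂ := by
  funext k
  rw [FFun, FFun, HFun_congr hψ, DFun_congr hψ]

theorem aCoef_congr (hψ : psi u = psi u₁) (hφ : phi u = phi u₁) :
    aCoef u = aCoef u₁ := by
  funext k
  rw [aCoef, aCoef, psiX_congr hψ, hψ, hφ, phiX, phiX, hφ]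

theorem phiTransform_congr (hφ : phi u = phi u₁) : phiTransform u = phiTransform u₁ := by
  funext h k
  rw [phiTransform, phiTransform, hφ]

theorem rho_congr (hψ : psi u = psi u₁) (hφ : phi u = phi u₁) :
    rho u q = rho u₁ q := by
  funext k
  rw [rho, rho, f0, f0, aCoef_congr hψ hφ, psiTransform_congr hψ, phiTransform_congr hφ, hψ, hφ]

theorem NFun_congr (hψ : psi u = psi u₁) (hφ : phi u = phi u₁) :
    NFun u f γ₁ = NFun u₁ f γ₁ := by
  funext k
  rw [NFun, NFun, aCoef_congr hψ hφ, psiTransform_congr hψ, phiTransform_congr hφ, hψ, hφ]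

theorem realIntegrand_congr (hψ : psi u = psi u₁) (hφ : phi u = phi u₁) :
    realIntegrand u q = realIntegrand u₁ q := by
  funext x y k
  rw [realIntegrand, realIntegrand, rho_congr hψ hφ, hψ]

theorem imagIntegrand_congr (hψ : psi u = psi u₁) : imagIntegrand u q = imagIntegrand u₁ q := by
  funext x y k
  rw [imagIntegrand, imagIntegrand, hψ]

end Congruence

end QuarterPlane

/-! ### Assembly of the result. -/

theorem proposition3p2 (u : ℝ → ℝ) (hu : QuarterPlane.IsPotential u)
    (ha : ∀ k : ℂ, 0 ≤ k.im → k ≠ 0 → QuarterPlane.aCoef u k ≠ 0)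
    (β γ₁ γ₂ : ℝ) (hβ : β ≠ 0) (f g : ℝ → ℝ) (q : ℝ → ℝ → ℝ)
    (hq : QuarterPlane.IsSolution u β γ₁ γ₂ f g q) :
    -- the eigenfunctions are well defined, and no denominator below vanishes
    ((∀ k : ℂ, 0 ≤ k.im → k ≠ 0 → QuarterPlane.IsJost u k (fun x => QuarterPlane.psi u x k)) ∧
      (∀ k : ℂ, k ≠ 0 → QuarterPlane.IsRegular u k (fun x => QuarterPlane.phi u x k)) ∧
      (∀ k : ℂ, 0 ≤ k.im → k ≠ 0 → QuarterPlane.psi u 0 k ≠ 0) ∧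
      (∀ k : ℂ, k.re = 0 → 0 < k.im → (k - γ₁) * QuarterPlane.DFun u β γ₂ k ≠ 0)) ∧
    -- the transforms converge absolutely
    ((∀ k : ℂ, k.re ≤ 0 →
        IntegrableOn (fun y : ℝ => Complex.exp (k * y) * (q 0 y : ℂ)) (Ioi 0) ∧
        IntegrableOn (fun y : ℝ => Complex.exp (k * y) * (g y : ℂ)) (Ioi 0)) ∧
      (∀ k : ℂ, 0 ≤ k.im → k ≠ 0 →
        IntegrableOn (fun x : ℝ => (q x 0 : ℂ) * QuarterPlane.psi u x k) (Ioi 0) ∧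
        IntegrableOn (fun x : ℝ => (f x : ℂ) * QuarterPlane.psi u x k) (Ioi 0)) ∧
      (∀ k : ℝ, k ≠ 0 →
        IntegrableOn (fun x : ℝ => (q x 0 : ℂ) * QuarterPlane.phi u x k) (Ioi 0) ∧
        IntegrableOn (fun x : ℝ => (f x : ℂ) * QuarterPlane.phi u x k) (Ioi 0))) ∧
    -- the integral representation of the solution
    (∀ x y : ℝ, 0 < x → 0 < y →
      IntegrableOn (fun k : ℝ => QuarterPlane.realIntegrand u q x y k) (Ioi 0) ∧
      IntegrableOn (fun s : ℝ => QuarterPlane.imagIntegrand u q x y (Complex.I * s)) (Ioi 0) ∧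
      (q x y : ℂ) =
        -(1 / (2 * Complex.I * Real.pi)) *
            (∫ k in Ioi (0 : ℝ), QuarterPlane.realIntegrand u q x y k)
          + 1 / (2 * Complex.I * Real.pi) *
            QuarterPlane.imagAxisIntegral (QuarterPlane.imagIntegrand u q x y)) ∧
    -- the Riemann-Hilbert problem for the sectionally analytic function `{g₀(k), g₀(-k)}`
    (AnalyticOnNhd ℂ (QuarterPlane.g0 q) {k : ℂ | k.re < 0} ∧
      ContinuousOn (QuarterPlane.g0 q) {k : ℂ | k.re ≤ 0} ∧
      (QuarterPlane.g0 q) =O[Bornology.cobounded ℂ ⊓ Filter.principal {k : ℂ | k.re ≤ 0}]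
        (fun k : ℂ => 1 / k) ∧
      (∀ k : ℂ, k.re = 0 → 0 < k.im →
        QuarterPlane.g0 q k + QuarterPlane.JFun u β γ₁ γ₂ k * QuarterPlane.g0 q (-k) =
          2 * k * β * QuarterPlane.psi u 0 k / ((k - γ₁) * QuarterPlane.DFun u β γ₂ k) * q 0 0
            + QuarterPlane.FFun u f g β γ₁ γ₂ k) ∧
      (∀ k : ℂ, k.re = 0 → k.im < 0 →
        QuarterPlane.g0 q (-k) + QuarterPlane.JFun u β γ₁ γ₂ (-k) * QuarterPlane.g0 q k =
          2 * k * β * QuarterPlane.psi u 0 (-k) /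
              ((k + γ₁) * QuarterPlane.DFun u β γ₂ (-k)) * q 0 0
            + QuarterPlane.FFun u f g β γ₁ γ₂ (-k))) ∧
    -- the formula for `ρ`, on the closed first quadrant, wherever the integrals converge
    (∀ k : ℂ, 0 ≤ k.re → 0 ≤ k.im → k ≠ 0 → k ≠ γ₁ →
      IntegrableOn (fun x : ℝ => (q x 0 : ℂ) * QuarterPlane.phi u x k) (Ioi 0) →
      IntegrableOn (fun x : ℝ => (f x : ℂ) * QuarterPlane.phi u x k) (Ioi 0) →
      QuarterPlane.rho u q k =
        -((k + γ₁) / (k - γ₁)) * (QuarterPlane.g0 q (-k) / QuarterPlane.psi u 0 k)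
          + QuarterPlane.NFun u f γ₁ k) := by
  -- All quantities depend on the potential only through its values on `[0, ∞)`, so `u` is exchanged
  -- for its even extension, for which the estimates on the line are available.
  have h0 : ∀ x, 0 ≤ x → u x = u |x| := fun x hx => by rw [abs_of_nonneg hx]
  have hu' := hu.linePotential_abs
  have hq' := hq.congr (u₁ := fun x => u |x|) h0
  have hψ : QuarterPlane.psi u = QuarterPlane.psi fun x => u |x| := QuarterPlane.psi_congr h0
  have hφ : QuarterPlane.phi u = QuarterPlane.phi fun x => u |x| := QuarterPlane.phi_congr h0
  have ha' : ∀ k ∈ QuarterPlane.upper, k ≠ 0 → QuarterPlane.aCoef (fun x => u |x|) k ≠ 0 := by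
    rw [← QuarterPlane.aCoef_congr hψ hφ]
    exact ha
  rw [QuarterPlane.DFun_congr hψ, QuarterPlane.JFun_congr hψ, QuarterPlane.FFun_congr hψ,
    QuarterPlane.rho_congr hψ hφ, QuarterPlane.NFun_congr hψ hφ,
    QuarterPlane.realIntegrand_congr hψ hφ, QuarterPlane.imagIntegrand_congr hψ]
  simp only [QuarterPlane.isJost_congr h0, QuarterPlane.isRegular_congr h0]
  rw [hψ, hφ]
  open QuarterPlane in
  refine ⟨⟨fun k hk hk0 => psi_isJost hu' hk hk0, fun k hk0 => phi_isRegular hu' hk0,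
    fun k hk hk0 => psi_zero_ne hu' ha' hk hk0, fun k hre him =>
      mul_ne_zero (sub_ofReal_ne him γ₁) (DFun_ne hu' ha' hβ hre him)⟩,
    ⟨fun k hk => ⟨hq.integrableOn_exp_q hk, hq.integrableOn_exp_g hk⟩, fun k hk hk0 => ?_,
      fun k hk0 => ?_⟩,
    fun x y hx hy => integralRepresentation hu' ha' hq' hx hy,
    ⟨g0_analytic hq, g0_continuousOn hq, g0_isBigO hq,
      fun k hre him => riemannHilbert_jump hu' ha' hβ hq' hre him, fun k hre him => ?_⟩,
    fun k hre him hk0 hkγ hiq hif => rho_eq hu' ha' hq' hre him hk0 hkγ hiq hif⟩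
  · have hJ := QuarterPlane.psi_isJost hu' hk hk0
    exact ⟨hq.integrableOn_q_mul hJ.continuousOn fun x hx => QuarterPlane.norm_psi_le hu' hk hk0 hx,
      hq.integrableOn_f_mul hJ.continuousOn fun x hx => QuarterPlane.norm_psi_le hu' hk hk0 hx⟩
  · have hk0' : (k : ℂ) ≠ 0 := Complex.ofReal_ne_zero.2 hk0
    have hR := QuarterPlane.phi_isRegular hu' hk0'
    obtain ⟨A, hA⟩ := QuarterPlane.norm_phi_le_of_real hu' (Complex.ofReal_im k) hk0'
    exact ⟨hq.integrableOn_q_mul hR.continuousOn hA, hq.integrableOn_f_mul hR.continuousOn hA⟩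
  -- On the negative imaginary axis the relation is the previous one at `-k`; the sign changes in
  -- numerator and denominator of the coefficient of `q(0,0)` cancel.
  · have h := QuarterPlane.riemannHilbert_jump hu' ha' hβ hq' (k := -k) (by simp [hre])
      (by simpa using him)
    rw [neg_neg] at h
    rw [h]
    congr 1
    rw [show (-k - γ₁ : ℂ) = -(k + γ₁) by ring, show (2 * -k * β : ℂ) = -(2 * k * β) by ring,
      neg_mul, neg_mul, neg_div_neg_eq]
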